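/- Let $\kappa:\mathbb R\to\mathbb R$ be continuous with limits $\kappa_\pm=\lim_{x\to\pm\infty}\kappa(x)$ satisfying $\kappa_+\kappa_-<0$, and assume $\kappa-\kappa_+\in L^1([0,\infty))$ and $\kappa-\kappa_-\in L^1((-\infty,0])$. Let $$\mathcal D=\tfrac32\bigl[-i\partial_x\sigma_1+\kappa(x)\sigma_2\bigr],\qquad \sigma_1=\begin{pmatrix}0&1\\1&0\end{pmatrix},\quad \sigma_2=\begin{pmatrix}0&-i\\ i&0\end{pmatrix},$$ be the Dirac operator on $L^2(\mathbb R;\mathbb C^2)$ with domain $H^1(\mathbb R;\mathbb C^2)$, and put $a=\tfrac32\min\{|\kappa_+|,|\kappa_-|\}$. For $e=(e_1,e_2)\in\mathbb C^2$ say that $\Psi:\mathbb R\to\mathbb C^2$ has *exponential decay with phases $e$* if there are real numbers $\lambda_-<0<\lambda_+$ and nonzero vectors $q_\pm\in\mathbb R^2$ with $$\lim_{x\to+\infty}e^{\lambda_+x}\Psi(x)=\operatorname{diag}(e)\,q_+,\qquad \lim_{x\to-\infty}e^{\lambda_-x}\Psi(x)=\operatorname{diag}(e)\,q_- .$$ Then: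 (a) The essential spectrum of $\mathcal D$ (the set of $z\in\mathbb C$ for which $\mathcal D-z$ is not a Fredholm operator) equals $(-\infty,-a]\cup[a,\infty)$. (b) $0$ is a simple eigenvalue of $\mathcal D$ (its eigenspace is one-dimensional). For every zero eigenfunction there is a constant $c\in\mathbb C\setminus\{0\}$ such that its continuous representative $\Psi$ has exponential decay with phases $(c,c)$. If moreover $\kappa\in C_b^\infty(\mathbb R)$ (that is, $\kappa$ is smooth and $\kappa$ and all its derivatives are bounded), then $\Psi$ is smooth, every derivative $\Psi^{(j)}$, $j\ge 0$, has exponential decay with phases $(c,c)$, and $\Psi\in H^s(\mathbb R;\mathbb C^2)$ for all $s\in\mathbb N$. (c) Every eigenvalue $E\in(-a,a)$ of $\mathcal D$ is simple. For every corresponding eigenfunction there is a constant $c\in\mathbb C\setminus\{0\}$ such that its continuous representative $\Psi$ has exponential decay with phases $(c\,e^{i\pi/4},c\,e^{-i\pi/4})$. If moreover $\kappa\in C_b^\infty(\mathbb R)$, then $\Psi$ is smooth, every derivative $\Psi^{(j)}$, $j\ge0$, has exponential decay with the same phases, and $\Psi\in H^s(\mathbb R;\mathbb C^2)$ for all $s\in\mathbb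 N$. -/

import Mathlib

open MeasureTheory Filter Topology Set
open scoped ContDiff SchwartzMap

noncomputable section

namespace DiracDomainWall

/-- The spinor space `ℂ²` with its Hermitian norm. -/
abbrev Spinor : Type := EuclideanSpace ℂ (Fin 2)

/-- The Hilbert space `L²(ℝ; ℂ²)`. -/
abbrev L2 : Type := Lp Spinor 2 (volume : Measure ℝ)

/-- An `L²` function viewed as a tempered distribution. -/
abbrev toDist (u : L2) : 𝓢'(ℝ, Spinor) := Lp.toTemperedDistribution u

/-- `w ∈ L²` is the distributional derivative of `u ∈ L²`. -/
def HasL2Deriv (u w : L2) : Prop :=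
  TemperedDistribution.derivCLM Spinor (toDist u) = toDist w

/-- The first Pauli matrix. -/
def pauli1 : Matrix (Fin 2) (Fin 2) ℂ := !![0, 1; 1, 0]

/-- The second Pauli matrix. -/
def pauli2 : Matrix (Fin 2) (Fin 2) ℂ := !![0, -Complex.I; Complex.I, 0]

/-- The pointwise expression `(3/2) (-i σ₁ w + k σ₂ u)`. -/
def diracSymbol (k : ℝ) (w u : Spinor) : Spinor :=
  (3 / 2 : ℂ) • (-Complex.I • Matrix.toEuclideanLin pauli1 w +
    (k : ℂ) • Matrix.toEuclideanLin pauli2 u)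

theorem diracSymbol_add (k : ℝ) (w w' u u' : Spinor) :
    diracSymbol k (w + w') (u + u') = diracSymbol k w u + diracSymbol k w' u' := by
  simp only [diracSymbol, map_add, smul_add]
  abel

theorem diracSymbol_smul (k : ℝ) (c : ℂ) (w u : Spinor) :
    diracSymbol k (c • w) (c • u) = c • diracSymbol k w u := by
  simp only [diracSymbol, map_smul, smul_add, smul_smul]
  congr 2 <;> ring

theorem hasL2Deriv_unique {u w w' : L2} (h : HasL2Deriv u w) (h' : HasL2Deriv u w') :
    w = w' := by
  have hk := Lp.ker_toTemperedDistributionCLM_eq_bot (E := ℝ) (F := Spinor)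
    (μ := volume) (p := 2)
  exact LinearMap.ker_eq_bot.mp hk (h.symm.trans h')

/-- The graph of the Dirac operator: all pairs `(u, v)` in `L² × L²` such that `u` has a
distributional derivative `w ∈ L²` and `v = (3/2) (-i σ₁ w + κ σ₂ u)` almost everywhere. -/
def diracGraph (κ : ℝ → ℝ) : Submodule ℂ (L2 × L2) where
  carrier := {p | ∃ w : L2, HasL2Deriv p.1 w ∧
    ∀ᵐ x, p.2 x = diracSymbol (κ x) (w x) (p.1 x)}
  zero_mem' := by
    refine ⟨0, ?_, ?_⟩
    · have h0 : toDist 0 = 0 := map_zero (Lp.toTemperedDistributionCLM Spinor volume 2)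
      simp [HasL2Deriv, h0]
    · filter_upwards [Lp.coeFn_zero Spinor 2 (volume : Measure ℝ)] with x hx
      change (0 : L2) x = diracSymbol (κ x) ((0 : L2) x) ((0 : L2) x)
      rw [hx]
      simp [diracSymbol]
  add_mem' := by
    rintro ⟨u, v⟩ ⟨u', v'⟩ ⟨w, hw, hv⟩ ⟨w', hw', hv'⟩
    refine ⟨w + w', ?_, ?_⟩
    · have ha : ∀ f g : L2, toDist (f + g) = toDist f + toDist g :=
        map_add (Lp.toTemperedDistributionCLM Spinor volume 2)
      simp only [HasL2Deriv] at hw hw' ⊢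
      simp only [Prod.mk_add_mk, ha, map_add, hw, hw']
    · filter_upwards [hv, hv', Lp.coeFn_add u u', Lp.coeFn_add v v', Lp.coeFn_add w w']
        with x h1 h2 h3 h4 h5
      simp only [Prod.mk_add_mk] at h1 h2 ⊢
      rw [h3, h4, h5]
      simp only [Pi.add_apply, h1, h2, diracSymbol_add]
  smul_mem' := by
    rintro c ⟨u, v⟩ ⟨w, hw, hv⟩
    refine ⟨c • w, ?_, ?_⟩
    · have hs : ∀ f : L2, toDist (c • f) = c • toDist f :=
        map_smul (Lp.toTemperedDistributionCLM Spinor volume 2) c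
      simp only [HasL2Deriv] at hw ⊢
      simp only [Prod.smul_mk, hs, map_smul, hw]
    · filter_upwards [hv, Lp.coeFn_smul c u, Lp.coeFn_smul c v, Lp.coeFn_smul c w]
        with x h1 h2 h3 h4
      simp only [Prod.smul_mk] at h1 ⊢
      rw [h2, h3, h4]
      simp only [Pi.smul_apply, h1, diracSymbol_smul]

/-- The Dirac operator `D = (3/2) (-i ∂ₓ σ₁ + κ(x) σ₂)` as an unbounded operator on
`L²(ℝ; ℂ²)`, with its natural domain (see `dirac_domain` for bounded `κ`). -/
def dirac (κ : ℝ → ℝ) : L2 →ₗ.[ℂ] L2 := (diracGraph κ).toLinearPMap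

/-- The graph relation is single valued, so it really is the graph of `dirac κ`. -/
theorem dirac_graph (κ : ℝ → ℝ) : (dirac κ).graph = diracGraph κ := by
  refine Submodule.toLinearPMap_graph_eq _ ?_
  rintro ⟨u, v⟩ ⟨w, hw, hv⟩ (rfl : u = 0)
  have hw0 : w = 0 := by
    refine hasL2Deriv_unique hw ?_
    have h0 : toDist 0 = 0 := map_zero (Lp.toTemperedDistributionCLM Spinor volume 2)
    simp [HasL2Deriv, h0]
  subst hw0
  change v = 0
  apply Lp.ext
  filter_upwards [hv, Lp.coeFn_zero Spinor 2 (volume : Measure ℝ)] with x h1 h2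
  rw [h1, h2]
  simp [diracSymbol]

/-- For bounded continuous `κ` the domain of the Dirac operator is
`H¹(ℝ; ℂ²) = {u ∈ L² | u' ∈ L²}`. -/
theorem dirac_domain {κ : ℝ → ℝ} (hκ : Continuous κ) {C : ℝ} (hC : ∀ x, |κ x| ≤ C) (u : L2) :
    u ∈ (dirac κ).domain ↔ ∃ w : L2, HasL2Deriv u w := by
  constructor
  · rintro ⟨⟨u', v⟩, ⟨w, hw, -⟩, rfl⟩
    exact ⟨w, hw⟩
  · rintro ⟨w, hw⟩
    have h1 : MemLp (fun x => -Complex.I • Matrix.toEuclideanLin pauli1 (w x)) 2 volume := by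
      have h : MemLp (fun x => Matrix.toEuclideanLin pauli1 (w x)) 2 volume :=
        (Matrix.toEuclideanLin pauli1).toContinuousLinearMap.comp_memLp' (Lp.memLp w)
      exact h.const_smul (-Complex.I)
    have h2 : MemLp (fun x => (κ x : ℂ) • Matrix.toEuclideanLin pauli2 (u x)) 2 volume := by
      have h : MemLp (fun x => Matrix.toEuclideanLin pauli2 (u x)) 2 volume :=
        (Matrix.toEuclideanLin pauli2).toContinuousLinearMap.comp_memLp' (Lp.memLp u)
      refine MemLp.of_le_mul (c := C) h ?_ ?_
      · exact (Complex.continuous_ofReal.comp hκ).aestronglyMeasurable.smul h.1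
      · filter_upwards with x
        rw [norm_smul, Complex.norm_real]
        exact mul_le_mul_of_nonneg_right (hC x) (norm_nonneg _)
    have h3 : MemLp (fun x => diracSymbol (κ x) (w x) (u x)) 2 volume :=
      (h1.add h2).const_smul (3 / 2 : ℂ)
    exact ⟨(u, h3.toLp _), ⟨w, hw, h3.coeFn_toLp⟩, rfl⟩

section Spectrum

variable {H : Type*} [NormedAddCommGroup H] [InnerProductSpace ℂ H]

/-- The operator `T - z`, defined on the domain of `T`. -/
def shift (T : H →ₗ.[ℂ] H) (z : ℂ) : T.domain →ₗ[ℂ] H := T.toFun - z • T.domain.subtype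

/-- The eigenspace `ker (T - z)`. -/
def eigenspace (T : H →ₗ.[ℂ] H) (z : ℂ) : Submodule ℂ T.domain := LinearMap.ker (shift T z)

/-- `z` is an eigenvalue of `T`: some nonzero `u` in the domain has `T u = z u`. -/
def IsEigenvalue (T : H →ₗ.[ℂ] H) (z : ℂ) : Prop := ∃ u : T.domain, u ≠ 0 ∧ T u = z • (u : H)

/-- `z` is a simple eigenvalue of `T`: its eigenspace is one-dimensional. -/
def IsSimpleEigenvalue (T : H →ₗ.[ℂ] H) (z : ℂ) : Prop :=
  Module.finrank ℂ (eigenspace T z) = 1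

/-- `T - z` is a Fredholm operator: finite-dimensional kernel, and closed range of finite
codimension. -/
def IsFredholmAt (T : H →ₗ.[ℂ] H) (z : ℂ) : Prop :=
  FiniteDimensional ℂ (eigenspace T z) ∧
  IsClosed (LinearMap.range (shift T z) : Set H) ∧
  FiniteDimensional ℂ (H ⧸ LinearMap.range (shift T z))

/-- The essential spectrum: all `z ∈ ℂ` for which `T - z` is not Fredholm. -/
def essentialSpectrum (T : H →ₗ.[ℂ] H) : Set ℂ := {z | ¬ IsFredholmAt T z}

end Spectrum

/-- `Ψ` has exponential decay with limiting directions in the real plane spanned by the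
phases `e`: for some `lm < 0 < lp`, the limits of `exp (lp x) Ψ(x)` at `+∞` and of
`exp (lm x) Ψ(x)` at `-∞` exist and have components `e i * qp i`, resp. `e i * qm i`, with
nonzero real vectors `qp`, `qm`. -/
def HasExpDecay (e : Fin 2 → ℂ) (Ψ : ℝ → Spinor) : Prop :=
  ∃ lm lp : ℝ, lm < 0 ∧ 0 < lp ∧ ∃ qm qp : Fin 2 → ℝ, qm ≠ 0 ∧ qp ≠ 0 ∧
    Tendsto (fun x => Real.exp (lp * x) • Ψ x) atTop
      (𝓝 (WithLp.toLp 2 fun i => e i * (qp i : ℂ))) ∧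
    Tendsto (fun x => Real.exp (lm * x) • Ψ x) atBot
      (𝓝 (WithLp.toLp 2 fun i => e i * (qm i : ℂ)))

/-- The space `C_b^∞(ℝ)`: smooth functions all of whose derivatives are bounded. -/
def IsCbInfty (κ : ℝ → ℝ) : Prop :=
  ContDiff ℝ ∞ κ ∧ ∀ k : ℕ, ∃ C : ℝ, ∀ x, |iteratedDeriv k κ x| ≤ C

/-- The decay and regularity properties of an eigenfunction `u`, with limiting directions
governed by the phases `e` up to the normalization `c ≠ 0` of the eigenfunction: the
continuous representative `Ψ` of `u` decays exponentially and, if `κ ∈ C_b^∞`, then `Ψ` is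
smooth, all its derivatives decay exponentially, and `u ∈ H^s` for every `s ∈ ℕ`. -/
def EigenfunctionDecay (κ : ℝ → ℝ) (e : Fin 2 → ℂ) (u : L2) : Prop :=
  ∃ (Ψ : ℝ → Spinor) (c : ℂ), Continuous Ψ ∧ (∀ᵐ x, u x = Ψ x) ∧ c ≠ 0 ∧
    HasExpDecay (fun i => c * e i) Ψ ∧
    (IsCbInfty κ → ContDiff ℝ ∞ Ψ ∧
      (∀ j : ℕ, HasExpDecay (fun i => c * e i) (iteratedDeriv j Ψ)) ∧
      ∀ s : ℕ, TemperedDistribution.MemSobolev (s : ℝ) 2 (toDist u))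

/-- The phases of the diagonal unitary `V = diag(e^{iπ/4}, e^{-iπ/4})`, which conjugates the
Dirac operator to an operator with real coefficients. -/
def realPhases : Fin 2 → ℂ :=
  ![Complex.exp (Complex.I * (Real.pi / 4)), Complex.exp (-(Complex.I * (Real.pi / 4)))]

end DiracDomainWall

end

/-! Written out in components, `D u = v` is a planar linear system: the first component satisfies
`P' = κ P + (2i/3) v₁`, the second `Q' = -κ Q + (2i/3) v₀`. The equation `(D - z) u = f` therefore
becomes an ODE system with coupling `b = c = 2iz/3` and trace-free coefficient matrix. At `±∞` that
matrix is, up to an integrable error, constant with eigenvalues `±μ`, where `μ² = κ±² - (2z/3)²`. A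
root with `Re μ > 0` exists at both ends exactly when `z` is not real with `|z| ≥ a`, and the whole
argument turns on this dichotomy.

Outside the claimed essential spectrum, each end carries a solution decaying like `e^{-μ|x|}`
(`exists_decaying_sol`), while every solution grows at most like `e^{Re μ |x|}` (`Sol.growth`).
Variation of constants with zero data at the origin then gives a square integrable solution as soon
as the source is orthogonal to one decaying solution on each half-line (`memLp_Ioi_of_orthogonal`),
the remaining integral kernel being `e^{-m|x-t|}`, which is bounded on `L²`. Hence the range of `D -
z` contains the orthogonal complement of two vectors. It is closed and of finite codimension, and
the kernel has dimension at most one, so `D - z` is Fredholm (`isFredholmAt_dirac`).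

On the claimed set, cut-off plane waves at the end with the smaller `|κ±|` form a Weyl sequence
whose sup norms vanish. A closed Fredholm operator would force a subsequence to converge in `L²` to
a nonzero limit, which is impossible (`not_isFredholmAt_dirac`).

Simplicity of eigenvalues is a Wronskian argument: the Wronskian of two `L²` solutions is constant
and integrable on the line, hence zero (`Sol.exists_eq_mul`). At `z = 0` the system decouples and
`exp(∓∫κ)` is an eigenfunction, the sign being chosen by the signs of `κ±` (`isEigenvalue_zero`).

For real `E` in the gap, conjugation by the phases `e^{±iπ/4}` makes the system real
(`Sol.conj_phases`), so eigenfunctions are complex multiples of real ones. Comparison with the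
decaying solution at each end gives real nonzero limits. For smooth `κ` the equation passes the
exponential limits on to all derivatives, multiplying the limit by `-μ` each time
(`RealSol.tendsto_iteratedDeriv`), and Sobolev regularity follows from the square integrability of
all derivatives. -/

noncomputable section

namespace DiracDomainWall

/-! ### Primitives of locally integrable functions and integration by parts. -/

section Primitive

variable {E F : Type*} [NormedAddCommGroup E] [NormedAddCommGroup F]

theorem locallyIntegrable_norm {f : ℝ → E} (hf : LocallyIntegrable f) :
    LocallyIntegrable fun x => ‖f x‖ :=
  fun x => (hf x).norm

theorem locallyIntegrable_intervalIntegrable {f : ℝ → E} (hf : LocallyIntegrable f) (a b : ℝ) :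
    IntervalIntegrable f volume a b :=
  (hf.integrableOn_isCompact isCompact_uIcc).intervalIntegrable

variable [NormedSpace ℝ E] [NormedSpace ℝ F]

/-- `F` is a primitive of the locally integrable function `f`. -/
structure IsPrim (F f : ℝ → E) : Prop where
  locInt : LocallyIntegrable f
  eq_add : ∀ x, F x = F 0 + ∫ t in (0 : ℝ)..x, f t

/-- Increments of the primitive of `f` are dominated by those of the primitive of `‖f‖`, which
reduces the vector-valued case to the scalar one. -/
theorem absolutelyContinuous_integral {f : ℝ → E} (hf : LocallyIntegrable f) (a b : ℝ) :
    AbsolutelyContinuousOnInterval (fun x => ∫ t in (0 : ℝ)..x, f t) a b := by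
  -- The interval is enlarged to contain the base point `0` of the primitive, as the scalar result
  -- requires.
  set a' := min (min a b) 0 with ha'
  set b' := max (max a b) 0 with hb'
  have hab : a' ≤ b' := (min_le_right _ _).trans (le_max_right _ _)
  have hI := fun c d : ℝ => locallyIntegrable_intervalIntegrable hf c d
  have hN := fun c d : ℝ => locallyIntegrable_intervalIntegrable (locallyIntegrable_norm hf) c d
  have h0 : AbsolutelyContinuousOnInterval (fun x => ∫ t in (0 : ℝ)..x, ‖f t‖) a' b' :=
    (hN a' b').absolutelyContinuousOnInterval_intervalIntegral
      (by rw [uIcc_of_le hab]; exact ⟨min_le_right _ _, le_max_right _ _⟩)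
  have key : ∀ x y : ℝ, dist (∫ t in (0 : ℝ)..x, f t) (∫ t in (0 : ℝ)..y, f t) ≤
      dist (∫ t in (0 : ℝ)..x, ‖f t‖) (∫ t in (0 : ℝ)..y, ‖f t‖) := by
    intro x y
    rw [dist_eq_norm, Real.dist_eq, intervalIntegral.integral_interval_sub_left (hI _ _) (hI _ _),
      intervalIntegral.integral_interval_sub_left (hN _ _) (hN _ _)]
    exact intervalIntegral.norm_integral_le_abs_integral_norm
  have h2 : AbsolutelyContinuousOnInterval (fun x => ∫ t in (0 : ℝ)..x, f t) a' b' := by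
    refine squeeze_zero (fun _ => Finset.sum_nonneg fun i _ => dist_nonneg) (fun t => ?_) h0
    exact Finset.sum_le_sum fun i _ => key _ _
  refine h2.mono ?_
  rw [uIcc_of_le hab]
  exact Icc_subset_Icc (min_le_left _ _) (le_max_left _ _)

namespace IsPrim

variable {U u V v : ℝ → E}

theorem absolutelyContinuous (h : IsPrim U u) (a b : ℝ) :
    AbsolutelyContinuousOnInterval U a b := by
  have h1 : U = fun x => U 0 + ∫ t in (0 : ℝ)..x, u t := funext h.eq_add
  rw [h1]
  have hc : AbsolutelyContinuousOnInterval (fun _ : ℝ => U 0) a b :=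
    (contDiff_const (c := U 0)).contDiffOn.absolutelyContinuousOnInterval
  exact hc.fun_add (absolutelyContinuous_integral h.locInt a b)

theorem continuous (h : IsPrim U u) : Continuous U := by
  rw [show U = fun x => U 0 + ∫ t in (0 : ℝ)..x, u t from funext h.eq_add]
  exact continuous_const.add
    (intervalIntegral.continuous_primitive (locallyIntegrable_intervalIntegrable h.locInt) 0)

theorem ae_hasDerivAt [CompleteSpace E] (h : IsPrim U u) : ∀ᵐ x, HasDerivAt U (u x) x := by
  filter_upwards [LocallyIntegrable.ae_hasDerivAt_integral h.locInt] with x hx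
  rw [show U = fun x => U 0 + ∫ t in (0 : ℝ)..x, u t from funext h.eq_add]
  exact (hx 0).const_add _

/-- The difference from the integral of `u` is absolutely continuous with derivative zero almost
everywhere, hence constant. This makes a product rule available for functions differentiable only
almost everywhere. -/
theorem of_ae_hasDerivAt [CompleteSpace E] (hu : LocallyIntegrable u)
    (hac : ∀ a b, AbsolutelyContinuousOnInterval U a b) (hd : ∀ᵐ x, HasDerivAt U (u x) x) :
    IsPrim U u := by
  refine ⟨hu, fun x => ?_⟩
  have h1 : AbsolutelyContinuousOnInterval (fun x => U x - ∫ t in (0 : ℝ)..x, u t) 0 x :=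
    (hac 0 x).fun_sub (absolutelyContinuous_integral hu 0 x)
  obtain ⟨C, hC⟩ := h1.const_of_ae_hasDerivAt_zero (by
    filter_upwards [hd, LocallyIntegrable.ae_hasDerivAt_integral hu] with y hy hy' _
    exact (sub_self (u y)) ▸ hy.fun_sub (hy' 0))
  have e0 := hC 0 left_mem_uIcc
  have ex := hC x right_mem_uIcc
  simp only [intervalIntegral.integral_same, sub_zero] at e0
  rw [e0, ← ex]
  abel

theorem of_hasDerivAt [CompleteSpace E] (hu : Continuous u) (hd : ∀ x, HasDerivAt U (u x) x) :
    IsPrim U u := by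
  refine ⟨hu.locallyIntegrable, fun x => ?_⟩
  rw [intervalIntegral.integral_eq_sub_of_hasDerivAt (fun y _ => hd y)
    (hu.intervalIntegrable 0 x)]
  abel

theorem hasDerivAt [CompleteSpace E] (h : IsPrim U u) (hu : Continuous u) (x : ℝ) :
    HasDerivAt U (u x) x := by
  rw [show U = fun x => U 0 + ∫ t in (0 : ℝ)..x, u t from funext h.eq_add]
  exact (intervalIntegral.integral_hasDerivAt_right (hu.intervalIntegrable 0 x)
    (hu.stronglyMeasurableAtFilter _ _) hu.continuousAt).const_add _

theorem congr (h : IsPrim U u) (huv : u =ᵐ[volume] v) : IsPrim U v := by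
  refine ⟨h.locInt.congr huv, fun x => ?_⟩
  rw [h.eq_add x]
  congr 1
  exact intervalIntegral.integral_congr_ae (huv.mono fun _ hx _ => hx)

theorem add (h : IsPrim U u) (h' : IsPrim V v) :
    IsPrim (fun x => U x + V x) (fun x => u x + v x) := by
  refine ⟨h.locInt.add h'.locInt, fun x => ?_⟩
  rw [h.eq_add x, h'.eq_add x, intervalIntegral.integral_add
    (locallyIntegrable_intervalIntegrable h.locInt _ _)
    (locallyIntegrable_intervalIntegrable h'.locInt _ _)]
  abel

theorem clm_comp [CompleteSpace E] [CompleteSpace F] (h : IsPrim U u) (L : E →L[ℝ] F) :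
    IsPrim (fun x => L (U x)) (fun x => L (u x)) := by
  refine ⟨fun x => ?_, fun x => ?_⟩
  · obtain ⟨s, hs, hi⟩ := h.locInt x
    exact ⟨s, hs, L.integrable_comp hi⟩
  · rw [h.eq_add x, map_add, L.intervalIntegral_comp_comm
      (locallyIntegrable_intervalIntegrable h.locInt _ _)]

theorem comp_neg (h : IsPrim U u) : IsPrim (fun x => U (-x)) (fun x => -u (-x)) := by
  refine ⟨fun x => ?_, fun x => ?_⟩
  · have := (h.locInt.integrableOn_isCompact (isCompact_Icc (a := -x - 1) (b := -x + 1)))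
    refine ⟨Icc (x - 1) (x + 1), Icc_mem_nhds (by linarith) (by linarith), ?_⟩
    refine Integrable.neg ?_
    have e : -Icc (-x - 1) (-x + 1) = Icc (x - 1) (x + 1) := by
      ext y
      simp only [mem_Icc, Set.mem_neg]
      constructor <;> rintro ⟨h1, h2⟩ <;> constructor <;> linarith
    exact e ▸ this.comp_neg
  · rw [h.eq_add (-x), neg_zero, intervalIntegral.integral_neg,
      intervalIntegral.integral_comp_neg (fun t => u t), intervalIntegral.integral_symm, neg_zero]

theorem smul [CompleteSpace E] [NormedSpace ℂ E] {f f' : ℝ → ℂ} (hf : IsPrim f f') (h : IsPrim U u) :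
    IsPrim (fun x => f x • U x) (fun x => f x • u x + f' x • U x) := by
  refine of_ae_hasDerivAt ?_ (fun a b => (hf.absolutelyContinuous a b).fun_smul
    (h.absolutelyContinuous a b)) ?_
  · refine LocallyIntegrable.add ?_ ?_
    · rw [← locallyIntegrableOn_univ]
      exact h.locInt.locallyIntegrableOn _ |>.continuousOn_smul isOpen_univ.isLocallyClosed hf.continuous.continuousOn
    · rw [← locallyIntegrableOn_univ]
      exact hf.locInt.locallyIntegrableOn _ |>.smul_continuousOn isOpen_univ.isLocallyClosed h.continuous.continuousOn
  · filter_upwards [hf.ae_hasDerivAt, h.ae_hasDerivAt] with x h1 h2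
    exact h1.smul h2

end IsPrim

end Primitive

/-- Integrability of `u` gives `U` limits at both ends, and integrability of `U` forces them to be
zero. The integral of `u` is their difference. -/
theorem IsPrim.integral_eq_zero {E : Type*} [NormedAddCommGroup E] [NormedSpace ℝ E]
    [CompleteSpace E] {U u : ℝ → E} (h : IsPrim U u) (hU : Integrable U) (hu : Integrable u) :
    ∫ x, u x = 0 := by
  have ht : Tendsto U atTop (𝓝 (U 0 + ∫ x in Ioi 0, u x)) := by
    rw [show U = fun x => U 0 + ∫ t in (0 : ℝ)..x, u t from funext h.eq_add]
    simpa using (intervalIntegral_tendsto_integral_Ioi 0 hu.integrableOn tendsto_id).const_add (U 0)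
  have hb : Tendsto U atBot (𝓝 (U 0 - ∫ x in Iic 0, u x)) := by
    have := (intervalIntegral_tendsto_integral_Iic 0 hu.integrableOn tendsto_id).const_sub (U 0)
    refine this.congr fun x => ?_
    rw [h.eq_add x, intervalIntegral.integral_symm, id, sub_neg_eq_add] 
  have h1 := IntegrableAtFilter.eq_zero_of_tendsto ⟨univ, univ_mem, hU.integrableOn⟩ (fun s hs => by
    obtain ⟨b, hb⟩ := mem_atTop_sets.1 hs
    rw [← top_le_iff, ← Real.volume_Ici (a := b)]
    exact measure_mono hb) ht
  have h2 := IntegrableAtFilter.eq_zero_of_tendsto ⟨univ, univ_mem, hU.integrableOn⟩ (fun s hs => by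
    obtain ⟨b, hb⟩ := mem_atBot_sets.1 hs
    rw [← top_le_iff, ← Real.volume_Iic (a := b)]
    exact measure_mono hb) hb
  have h3 := intervalIntegral.integral_Iic_add_Ioi (b := 0) hu.integrableOn hu.integrableOn
  rw [← h3, eq_neg_of_add_eq_zero_right h1, ← sub_eq_zero.mp h2, add_neg_cancel]

/-! ### Distributional derivatives in `L²` are the same as primitives. -/

theorem memLp_smul_integrable {φ : ℝ → ℂ} {f : ℝ → Spinor} (hφ : MemLp φ 2 volume)
    (hf : MemLp f 2 volume) : Integrable fun x => φ x • f x := by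
  have := MemLp.smul (p := 2) (q := 2) (r := 1) hf hφ
  exact memLp_one_iff_integrable.mp this

/-- Integration by parts: for a Schwartz function `φ`, the product `φ U` and its derivative are
integrable, so the derivative integrates to zero. -/
theorem hasL2Deriv_of_isPrim {u w : L2} {U : ℝ → Spinor} (h : IsPrim U w)
    (hu : u =ᵐ[volume] U) : HasL2Deriv u w := by
  ext φ : 1
  have hU : MemLp U 2 volume := (memLp_congr_ae hu).mp (Lp.memLp u)
  have hw := Lp.memLp w
  have hφ := φ.memLp 2 volume
  have hφ' := (SchwartzMap.derivCLM ℂ ℂ φ).memLp 2 volume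
  have hφp : IsPrim φ (deriv φ) :=
    IsPrim.of_hasDerivAt (SchwartzMap.derivCLM ℂ ℂ φ).continuous fun x => φ.hasDerivAt x
  have i1 := memLp_smul_integrable hφ hw
  have i2 := memLp_smul_integrable hφ' hU
  have key := (hφp.smul h).integral_eq_zero (memLp_smul_integrable hφ hU) (i1.add i2)
  have e2 : ∫ x, φ x • w x + deriv φ x • U x = (∫ x, φ x • w x) + ∫ x, deriv φ x • U x :=
    integral_add i1 i2
  rw [e2] at key
  rw [TemperedDistribution.derivCLM_apply_apply, map_neg, Lp.toTemperedDistribution_apply,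
    Lp.toTemperedDistribution_apply, eq_neg_of_add_eq_zero_left key]
  congr 1
  refine integral_congr_ae ?_
  filter_upwards [hu] with x hx
  rw [hx]
  rfl

theorem hasL2Deriv_integral_eq {u w : L2} (h : HasL2Deriv u w) {g g' : ℝ → ℝ}
    (hg : ContDiff ℝ ∞ g) (hc : HasCompactSupport g) (hg' : ∀ x, HasDerivAt g (g' x) x) :
    ∫ x, g' x • u x = -∫ x, g x • w x := by
  have hg2 : ContDiff ℝ ∞ fun x => (g x : ℂ) := Complex.ofRealCLM.contDiff.comp hg
  have hc2 : HasCompactSupport fun x => (g x : ℂ) :=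
    hc.comp_left (g := fun y : ℝ => (y : ℂ)) Complex.ofReal_zero
  have := congrArg (fun T => T (hc2.toSchwartzMap hg2)) h
  simp only [TemperedDistribution.derivCLM_apply_apply, map_neg, Lp.toTemperedDistribution_apply]
    at this
  rw [eq_comm, neg_eq_iff_eq_neg.symm] at this
  have e1 : ∀ x, (SchwartzMap.derivCLM ℂ ℂ (hc2.toSchwartzMap hg2)) x = (g' x : ℂ) := fun x =>
    (HasDerivAt.ofReal_comp (hg' x)).deriv
  have e2 : ∀ x, (hc2.toSchwartzMap hg2) x = (g x : ℂ) := fun x => rfl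
  simp only [e1, e2, Complex.coe_smul] at this
  exact this.symm

/-- **du Bois-Reymond lemma**: a locally integrable function on the line whose distributional
derivative vanishes is constant. -/
theorem ae_eq_const_of_integral_deriv_smul_eq_zero {E : Type*} [NormedAddCommGroup E]
    [NormedSpace ℝ E] [CompleteSpace E] {d : ℝ → E} (hdl : LocallyIntegrable d)
    (hd : ∀ g g' : ℝ → ℝ, ContDiff ℝ ∞ g → HasCompactSupport g → (∀ x, HasDerivAt g (g' x) x) →
      ∫ x, g' x • d x = 0) : ∃ c : E, ∀ᵐ x, d x = c := by
  let χ₀ : ContDiffBump (0 : ℝ) := ⟨1, 2, by norm_num, by norm_num⟩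
  set χ : ℝ → ℝ := χ₀.normed volume with hχ
  have hχs : ContDiff ℝ ∞ χ := χ₀.contDiff_normed
  have hχc : HasCompactSupport χ := χ₀.hasCompactSupport_normed
  have hχ1 : ∫ x, χ x = 1 := χ₀.integral_normed
  set c : E := ∫ x, χ x • d x with hc
  refine ⟨c, ?_⟩
  · refine ae_eq_of_integral_contDiff_smul_eq hdl (locallyIntegrable_const c) fun g hg hgc => ?_
    -- Subtracting this multiple of `χ` makes the integral zero, which is exactly what makes the
    -- primitive `Φ` of `h` compactly supported and so an admissible test function.
    set h : ℝ → ℝ := fun x => g x - (∫ y, g y) * χ x with hh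
    have hhs : ContDiff ℝ ∞ h := hg.sub (contDiff_const.mul hχs)
    have hhc : HasCompactSupport h := by
      have h1 : HasCompactSupport ((fun _ => ∫ y, g y) * χ) := HasCompactSupport.mul_left hχc
      exact hgc.sub h1
    have hhi : ∫ x, h x = 0 := by
      rw [hh, integral_sub (hg.continuous.integrable_of_hasCompactSupport hgc)
        ((hχs.continuous.integrable_of_hasCompactSupport hχc).const_mul _),
        integral_const_mul, hχ1, mul_one, sub_self]
    obtain ⟨R, hR⟩ := hhc.isCompact.isBounded.subset_closedBall 0
    have hz : ∀ x, R < |x| → h x = 0 := fun x hx => by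
      by_contra hne
      have := hR (subset_tsupport _ hne)
      rw [mem_closedBall_zero_iff, Real.norm_eq_abs] at this
      linarith
    set Φ : ℝ → ℝ := fun x => ∫ t in Iic x, h t with hΦ
    have hhI : Integrable h := hhs.continuous.integrable_of_hasCompactSupport hhc
    have hΦd : ∀ x, HasDerivAt Φ (h x) x := by
      intro x
      have : Φ = fun x => (∫ t in Iic 0, h t) + ∫ t in (0 : ℝ)..x, h t := by
        ext x
        rw [← intervalIntegral.integral_Iic_sub_Iic hhI.integrableOn hhI.integrableOn]
        simp [hΦ]
      rw [this]
      exact (intervalIntegral.integral_hasDerivAt_right (hhs.continuous.intervalIntegrable 0 x)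
        (hhs.continuous.stronglyMeasurableAtFilter _ _) hhs.continuous.continuousAt).const_add _
    have hΦs : ContDiff ℝ ∞ Φ := by
      rw [contDiff_infty_iff_deriv]
      refine ⟨fun x => (hΦd x).differentiableAt, ?_⟩
      rw [show deriv Φ = h from funext fun x => (hΦd x).deriv]
      exact hhs
    have hΦc : HasCompactSupport Φ := by
      refine HasCompactSupport.of_support_subset_isCompact (isCompact_closedBall (0 : ℝ) R) ?_
      intro x hx
      by_contra hxR
      rw [mem_closedBall_zero_iff, Real.norm_eq_abs, not_le] at hxR
      refine hx ?_
      rcases lt_abs.mp hxR with hx1 | hx1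
      · have h2 := intervalIntegral.integral_Iic_add_Ioi (b := x) hhI.integrableOn hhI.integrableOn
        rw [hhi, setIntegral_eq_zero_of_forall_eq_zero (t := Ioi x), add_zero] at h2
        · exact h2
        · intro y hy
          exact hz y (lt_of_lt_of_le (hx1.trans hy) (le_abs_self y))
      · refine setIntegral_eq_zero_of_forall_eq_zero fun y hy => hz y ?_
        have hy : y ≤ x := hy
        exact lt_of_lt_of_le (by linarith) (neg_le_abs y)
    have h5 := hd Φ h hΦs hΦc hΦd
    have j1 : Integrable fun x => g x • d x :=
      hdl.integrable_smul_left_of_hasCompactSupport hg.continuous hgc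
    have j2 : Integrable fun x => χ x • d x :=
      hdl.integrable_smul_left_of_hasCompactSupport hχs.continuous hχc
    simp only [hh, sub_smul, mul_smul] at h5
    rw [integral_sub j1 (j2.fun_smul (∫ y, g y)), integral_smul, sub_eq_zero] at h5
    rw [h5, integral_smul_const]

/-- The difference of `u` and the integral of `w` has vanishing distributional derivative, so it is
constant by du Bois-Reymond. -/
theorem exists_isPrim {u w : L2} (h : HasL2Deriv u w) :
    ∃ U : ℝ → Spinor, IsPrim U w ∧ u =ᵐ[volume] U := by
  have hwl : LocallyIntegrable w := (Lp.memLp w).locallyIntegrable (by norm_num)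
  have hul : LocallyIntegrable u := (Lp.memLp u).locallyIntegrable (by norm_num)
  set W : ℝ → Spinor := fun x => ∫ t in (0 : ℝ)..x, w t with hW
  have hWp : IsPrim W w := ⟨hwl, fun x => by simp [hW]⟩
  have hdl : LocallyIntegrable (fun x => u x - W x) :=
    hul.sub hWp.continuous.locallyIntegrable
  have key : ∀ g g' : ℝ → ℝ, ContDiff ℝ ∞ g → HasCompactSupport g → (∀ x, HasDerivAt g (g' x) x) →
      ∫ x, g' x • (u x - W x) = 0 := by
    intro g g' hg hc hg'
    have e : g' = deriv g := funext fun x => (hg' x).deriv.symm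
    have hcg' : Continuous g' := e ▸ hg.continuous_deriv (by simp)
    have hsg' : HasCompactSupport g' := e ▸ hc.deriv
    have i1 : Integrable fun x => g' x • u x :=
      hul.integrable_smul_left_of_hasCompactSupport hcg' hsg'
    have i2 : Integrable fun x => g' x • W x :=
      hWp.continuous.locallyIntegrable.integrable_smul_left_of_hasCompactSupport hcg' hsg'
    have i3 : Integrable fun x => g x • w x :=
      hwl.integrable_smul_left_of_hasCompactSupport hg.continuous hc
    have i4 : Integrable fun x => g x • W x :=
      hWp.continuous.locallyIntegrable.integrable_smul_left_of_hasCompactSupport hg.continuous hc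
    have hp : IsPrim (fun x => (g x : ℂ)) (fun x => (g' x : ℂ)) :=
      IsPrim.of_hasDerivAt (by fun_prop) fun x => (hg' x).ofReal_comp
    have h0 := hp.smul hWp
    simp only [Complex.coe_smul] at h0
    have h1 := h0.integral_eq_zero i4 (i3.add i2)
    rw [integral_add i3 i2] at h1
    simp only [smul_sub]
    rw [integral_sub i1 i2, hasL2Deriv_integral_eq h hg hc hg', eq_neg_of_add_eq_zero_right h1,
      sub_self]
  obtain ⟨c, hc⟩ := ae_eq_const_of_integral_deriv_smul_eq_zero hdl key
  refine ⟨fun x => W x + c, ⟨hwl, fun x => ?_⟩, ?_⟩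
  · simp only [hW, intervalIntegral.integral_same]; abel
  filter_upwards [hc] with x hx
  rw [← hx]
  abel

theorem HasL2Deriv.add_smul {u w u' w' : L2} (h : HasL2Deriv u w) (h' : HasL2Deriv u' w') (c : ℂ) :
    HasL2Deriv (u + c • u') (w + c • w') := by
  have ha : ∀ f g : L2, toDist (f + g) = toDist f + toDist g :=
    map_add (Lp.toTemperedDistributionCLM Spinor volume 2)
  have hs : ∀ f : L2, toDist (c • f) = c • toDist f :=
    map_smul (Lp.toTemperedDistributionCLM Spinor volume 2) c
  simp only [HasL2Deriv] at h h' ⊢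
  rw [ha, ha, hs, hs, map_add, map_smul, h, h']

/-! ### Sobolev regularity from a chain of `L²` derivatives. -/

open TemperedDistribution LineDeriv Laplacian in
theorem laplacian_eq_derivCLM (f : 𝓢'(ℝ, Spinor)) :
    Laplacian.laplacian f = derivCLM Spinor (derivCLM Spinor f) := by
  have h1 : ∀ g : 𝓢'(ℝ, Spinor), lineDerivOp (1 : ℝ) g = derivCLM Spinor g := by
    intro g
    ext φ : 1
    rw [lineDerivOp_apply_apply, derivCLM_apply_apply]
    congr 2
  have h2 := laplacian_eq_sum (OrthonormalBasis.singleton (Fin 1) ℝ) f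
  simpa [h1] using h2

open TemperedDistribution in
-- The symbol of order two is the polynomial `1 + |ξ|²`; the factor `(2π)²` comes from the
-- normalization `e^{-2πixξ}` of the Fourier transform.
theorem besselPotential_two_apply (f : 𝓢'(ℝ, Spinor)) :
    besselPotential ℝ Spinor 2 f = f + (-((2 * Real.pi : ℂ) ^ 2)⁻¹) •
      derivCLM Spinor (derivCLM Spinor f) := by
  rw [← laplacian_eq_derivCLM, laplacian_eq_fourierMultiplierCLM, besselPotential]
  have e : (fun x : ℝ => (((1 + ‖x‖ ^ 2) ^ ((2 : ℝ) / 2) : ℝ) : ℂ)) =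
      (fun _ => 1) + fun x => ((‖x‖ ^ 2 : ℝ) : ℂ) := by
    ext x; simp
  rw [e]
  have h1 : fourierMultiplierCLM Spinor ((fun _ : ℝ => (1 : ℂ)) + fun x => ((‖x‖ ^ 2 : ℝ) : ℂ)) f =
      f + fourierMultiplierCLM Spinor (fun x : ℝ => ((‖x‖ ^ 2 : ℝ) : ℂ)) f := by
    rw [fourierMultiplierCLM_apply, fourierMultiplierCLM_apply, smulLeftCLM_add (by fun_prop)
      (by fun_prop), add_apply, smulLeftCLM_const, one_smul, FourierTransform.fourierInv_add,
      FourierTransform.fourierInv_fourier_eq]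
  rw [h1, ← Complex.coe_smul, smul_smul]
  congr 1
  have hp : (Real.pi : ℂ) ≠ 0 := by exact_mod_cast Real.pi_ne_zero
  push_cast
  rw [neg_mul_neg, inv_mul_cancel₀ (by simp [hp]), one_smul]

/-- The Bessel potential of order two sends `D 0` to `D 0 + c D 2`, and `D j + c D (j + 2)` is again
a chain of derivatives. Induction thus gains two orders at a time and gives order `2s`, more than
needed. -/
theorem memSobolev_of_hasL2Deriv {D : ℕ → L2} (h : ∀ j, HasL2Deriv (D j) (D (j + 1))) (s : ℕ) :
    TemperedDistribution.MemSobolev (s : ℝ) 2 (toDist (D 0)) := by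
  have key : ∀ (m : ℕ) (D : ℕ → L2), (∀ j, HasL2Deriv (D j) (D (j + 1))) →
      TemperedDistribution.MemSobolev (2 * m : ℝ) 2 (toDist (D 0)) := by
    intro m
    induction m with
    | zero =>
      intro D _
      rw [Nat.cast_zero, mul_zero, TemperedDistribution.memSobolev_zero_iff]
      exact ⟨D 0, rfl⟩
    | succ m ih =>
      intro D hD
      set c : ℂ := -((2 * Real.pi : ℂ) ^ 2)⁻¹
      have h1 := ih (fun j => D j + c • D (j + 2)) fun j => (hD j).add_smul (hD (j + 2)) c
      have e : toDist (D 0 + c • D 2) =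
          TemperedDistribution.besselPotential ℝ Spinor 2 (toDist (D 0)) := by
        have ha : ∀ f g : L2, toDist (f + g) = toDist f + toDist g :=
          map_add (Lp.toTemperedDistributionCLM Spinor volume 2)
        have hs : ∀ f : L2, toDist (c • f) = c • toDist f :=
          map_smul (Lp.toTemperedDistributionCLM Spinor volume 2) c
        have e1 : TemperedDistribution.derivCLM Spinor (toDist (D 0)) = toDist (D 1) := hD 0
        have e2 : TemperedDistribution.derivCLM Spinor (toDist (D 1)) = toDist (D 2) := hD 1
        rw [besselPotential_two_apply, e1, e2, ha, hs]
      rw [zero_add, e, TemperedDistribution.memSobolev_besselPotential_iff] at h1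
      convert h1 using 1
      push_cast
      ring
  refine (key s D h).mono ?_
  have : (0 : ℝ) ≤ s := Nat.cast_nonneg s
  linarith

/-! ### Weighted contraction principle and global linear initial value problems. -/

section FixedPoint

variable {E : Type*} [NormedAddCommGroup E]

open BoundedContinuousFunction in
/-- Contraction principle in the space of continuous functions bounded by a multiple of a
positive weight `ρ`. -/
theorem exists_fixedPoint_weighted [NormedSpace ℝ E] [CompleteSpace E] {ρ : ℝ → ℝ}
    (hρ : Continuous ρ) (hpos : ∀ x, 0 < ρ x) (T : (ℝ → E) → ℝ → E)
    (hcont : ∀ y, Continuous y → (∃ M, ∀ x, ‖y x‖ ≤ M * ρ x) → Continuous (T y))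
    (h0 : ∃ M, ∀ x, ‖T 0 x‖ ≤ M * ρ x)
    (hT : ∀ y z, Continuous y → Continuous z → (∃ M, ∀ x, ‖y x‖ ≤ M * ρ x) →
      (∃ M, ∀ x, ‖z x‖ ≤ M * ρ x) → ∀ M, (∀ x, ‖y x - z x‖ ≤ M * ρ x) →
        ∀ x, ‖T y x - T z x‖ ≤ M / 2 * ρ x) :
    ∃ y : ℝ → E, Continuous y ∧ (∃ M, ∀ x, ‖y x‖ ≤ M * ρ x) ∧ T y = y := by
  have hb : ∀ f : ℝ →ᵇ E, Continuous (fun x => ρ x • f x) ∧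
      ∃ M, ∀ x, ‖ρ x • f x‖ ≤ M * ρ x := by
    intro f
    refine ⟨hρ.smul f.continuous, ‖f‖, fun x => ?_⟩
    rw [norm_smul, Real.norm_of_nonneg (hpos x).le, mul_comm]
    exact mul_le_mul_of_nonneg_right (f.norm_coe_le_norm x) (hpos x).le
  have hz : Continuous (0 : ℝ → E) ∧ ∃ M, ∀ x, ‖(0 : ℝ → E) x‖ ≤ M * ρ x :=
    ⟨continuous_zero, 0, fun x => by simp⟩
  obtain ⟨M0, hM0⟩ := h0
  have hbd : ∀ f : ℝ →ᵇ E, ∃ M, ∀ x, ‖(ρ x)⁻¹ • T (fun x => ρ x • f x) x‖ ≤ M := by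
    intro f
    obtain ⟨hc, M, hM⟩ := hb f
    refine ⟨M / 2 + M0, fun x => ?_⟩
    have h1 := hT _ _ hc hz.1 ⟨M, hM⟩ hz.2 M (fun x => by simpa using hM x) x
    have h2 : ‖T (fun x => ρ x • f x) x‖ ≤ (M / 2 + M0) * ρ x := by
      calc _ = ‖(T (fun x => ρ x • f x) x - T 0 x) + T 0 x‖ := by rw [sub_add_cancel]
        _ ≤ _ := norm_add_le _ _
        _ ≤ M / 2 * ρ x + M0 * ρ x := add_le_add h1 (hM0 x)
        _ = _ := by ring
    rw [norm_smul, norm_inv, Real.norm_of_nonneg (hpos x).le, inv_mul_le_iff₀ (hpos x), mul_comm]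
    exact h2
  -- Conjugating `T` by multiplication with `ρ` turns the weighted sup norm into the ordinary one,
  -- where Banach's theorem applies.
  let S : (ℝ →ᵇ E) → (ℝ →ᵇ E) := fun f =>
    BoundedContinuousFunction.ofNormedAddCommGroup (fun x => (ρ x)⁻¹ • T (fun x => ρ x • f x) x)
      ((hρ.inv₀ fun x => (hpos x).ne').smul (hcont _ (hb f).1 (hb f).2)) (hbd f).choose
      (hbd f).choose_spec
  have hS : ContractingWith (1 / 2) S := by
    refine ⟨by norm_num, LipschitzWith.of_dist_le_mul fun f g => ?_⟩
    rw [BoundedContinuousFunction.dist_le (by positivity)]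
    intro x
    have h1 := hT _ _ (hb f).1 (hb g).1 (hb f).2 (hb g).2 (dist f g) (fun x => by
      rw [← smul_sub, norm_smul, Real.norm_of_nonneg (hpos x).le, mul_comm, ← dist_eq_norm]
      exact mul_le_mul_of_nonneg_right (BoundedContinuousFunction.dist_coe_le_dist x)
        (hpos x).le) x
    change dist ((ρ x)⁻¹ • T (fun x => ρ x • f x) x) ((ρ x)⁻¹ • T (fun x => ρ x • g x) x) ≤ _
    rw [dist_eq_norm, ← smul_sub, norm_smul, norm_inv, Real.norm_of_nonneg (hpos x).le,
      inv_mul_le_iff₀ (hpos x)]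
    refine h1.trans (le_of_eq ?_)
    push_cast
    ring
  set f := hS.fixedPoint S
  have hf : S f = f := hS.fixedPoint_isFixedPt
  refine ⟨fun x => ρ x • f x, (hb f).1, (hb f).2, ?_⟩
  ext x
  have h1 : (ρ x)⁻¹ • T (fun x => ρ x • f x) x = f x := DFunLike.congr_fun hf x
  rw [← h1, smul_inv_smul₀ (hpos x).ne']

end FixedPoint

section IVP

variable {E : Type*} [NormedAddCommGroup E] [NormedSpace ℝ E] [CompleteSpace E]

/-- This choice of weight makes the Volterra operator a contraction with constant `1/2` on the whole
line at once, with no gluing of local solutions. -/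
theorem integral_exp_mul_abs_le {L : ℝ} (hL : 0 < L) (x : ℝ) :
    |∫ t in (0 : ℝ)..x, L * Real.exp (2 * L * |t|)| ≤ 1 / 2 * Real.exp (2 * L * |x|) := by
  have key : ∀ y : ℝ, 0 ≤ y → ∫ t in (0 : ℝ)..y, L * Real.exp (2 * L * |t|) =
      1 / 2 * Real.exp (2 * L * y) - 1 / 2 := by
    intro y hy
    have h1 : ∫ t in (0 : ℝ)..y, L * Real.exp (2 * L * |t|) =
        ∫ t in (0 : ℝ)..y, L * Real.exp (2 * L * t) := by
      refine intervalIntegral.integral_congr fun t ht => ?_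
      rw [uIcc_of_le hy] at ht
      simp only [abs_of_nonneg ht.1]
    rw [h1, intervalIntegral.integral_eq_sub_of_hasDerivAt
      (f := fun t => 1 / 2 * Real.exp (2 * L * t))]
    · simp
    · intro t _
      have := (((hasDerivAt_id t).const_mul (2 * L)).exp).const_mul (1 / 2)
      refine this.congr_deriv ?_
      simp only [id]
      ring
    · exact Continuous.intervalIntegrable (by fun_prop) _ _
  have hpos : ∀ y : ℝ, 0 ≤ y → |1 / 2 * Real.exp (2 * L * y) - 1 / 2| ≤
      1 / 2 * Real.exp (2 * L * y) := by
    intro y hy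
    have : 1 ≤ Real.exp (2 * L * y) := Real.one_le_exp (by positivity)
    rw [abs_of_nonneg (by linarith)]
    linarith
  rcases le_total 0 x with hx | hx
  · rw [key x hx, abs_of_nonneg hx]
    exact hpos x hx
  · have h2 : ∫ t in (0 : ℝ)..x, L * Real.exp (2 * L * |t|) =
        -∫ t in (0 : ℝ)..(-x), L * Real.exp (2 * L * |t|) := by
      have := intervalIntegral.integral_comp_neg (a := 0) (b := -x)
        (fun t => L * Real.exp (2 * L * |t|))
      simp only [abs_neg, neg_neg, neg_zero] at this
      rw [this, intervalIntegral.integral_symm]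
    rw [h2, abs_neg, key (-x) (by linarith), abs_of_nonpos hx]
    exact hpos (-x) (by linarith)

/-- Global existence for linear ordinary differential equations with bounded continuous
coefficients. -/
theorem exists_linear_ode_solution {A : ℝ → E →L[ℝ] E} (hA : Continuous A) {L : ℝ}
    (hL : ∀ x, ‖A x‖ ≤ L) (y₀ : E) :
    ∃ y : ℝ → E, y 0 = y₀ ∧ ∀ x, HasDerivAt y (A x (y x)) x := by
  wlog hLpos : 0 < L generalizing L
  · exact this (L := |L| + 1) (fun x => (hL x).trans ((le_abs_self L).trans (by linarith)))
      (by positivity)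
  obtain ⟨y, hyc, -, hy⟩ := exists_fixedPoint_weighted (E := E)
    (ρ := fun x => Real.exp (2 * L * |x|)) (by fun_prop) (fun x => Real.exp_pos _)
    (fun y x => y₀ + ∫ t in (0 : ℝ)..x, A t (y t))
    (fun y hy _ => continuous_const.add (intervalIntegral.continuous_primitive
      (fun a b => (hA.clm_apply hy).intervalIntegrable a b) 0))
    ⟨‖y₀‖, fun x => by
      simp only [Pi.zero_apply, map_zero, intervalIntegral.integral_zero, add_zero]
      exact le_mul_of_one_le_right (norm_nonneg _) (Real.one_le_exp (by positivity))⟩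
    (fun y z hy hz _ _ M hM x => by
      rw [add_sub_add_left_eq_sub, ← intervalIntegral.integral_sub
        ((hA.clm_apply hy).intervalIntegrable _ _) ((hA.clm_apply hz).intervalIntegrable _ _)]
      have hb : ∀ t, ‖A t (y t) - A t (z t)‖ ≤ M * (L * Real.exp (2 * L * |t|)) := by
        intro t
        rw [← map_sub]
        refine ((A t).le_of_opNorm_le (hL t) _).trans ?_
        have := mul_le_mul_of_nonneg_left (hM t) hLpos.le
        linarith
      have hM0 : 0 ≤ M := by
        have := (norm_nonneg _).trans (hM 0)
        simpa using this
      have h1 : ‖∫ t in (0 : ℝ)..x, (A t (y t) - A t (z t))‖ ≤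
          |∫ t in (0 : ℝ)..x, M * (L * Real.exp (2 * L * |t|))| :=
        intervalIntegral.norm_integral_le_abs_of_norm_le (ae_of_all _ fun t => hb t)
          (Continuous.intervalIntegrable (by fun_prop) _ _)
      rw [intervalIntegral.integral_const_mul, abs_mul, abs_of_nonneg hM0] at h1
      refine h1.trans ((mul_le_mul_of_nonneg_left (integral_exp_mul_abs_le hLpos x) hM0).trans ?_)
      exact le_of_eq (by ring))
  have hc : Continuous fun t => A t (y t) := hA.clm_apply hyc
  refine ⟨y, ?_, fun x => ?_⟩
  · rw [← hy]; simp
  · have h2 : y = fun x => y₀ + ∫ t in (0 : ℝ)..x, A t (y t) := hy.symm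
    have h3 : HasDerivAt (fun x => y₀ + ∫ t in (0 : ℝ)..x, A t (y t)) (A x (y x)) x :=
      (intervalIntegral.integral_hasDerivAt_right (hc.intervalIntegrable 0 x)
        (hc.stronglyMeasurableAtFilter _ _) hc.continuousAt).const_add _
    rwa [← h2] at h3

end IVP

/-! ### Levinson-type asymptotic integration at `+∞`. -/

section Levinson

variable {E : Type*} [NormedAddCommGroup E]

theorem hasDerivAt_integral_Ioi [NormedSpace ℝ E] [CompleteSpace E] {f : ℝ → E}
    (hf : Continuous f) (hi : ∀ x, IntegrableOn f (Ioi x)) (x : ℝ) :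
    HasDerivAt (fun x => ∫ t in Ioi x, f t) (-f x) x := by
  have h1 : (fun x => ∫ t in Ioi x, f t) = fun x =>
      (∫ t in Ioi 0, f t) - ∫ t in (0 : ℝ)..x, f t := by
    ext y
    rw [eq_sub_iff_add_eq, add_comm]
    exact intervalIntegral.integral_interval_add_Ioi' (hf.intervalIntegrable 0 y) (hi y)
  rw [h1]
  exact (intervalIntegral.integral_hasDerivAt_right (hf.intervalIntegrable 0 x)
    (hf.stronglyMeasurableAtFilter _ _) hf.continuousAt).const_sub _

theorem tendsto_integral_Ioi_zero [NormedSpace ℝ E] [CompleteSpace E] {f : ℝ → E}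
    (hf : Continuous f) (hi : ∀ x, IntegrableOn f (Ioi x)) :
    Tendsto (fun x => ∫ t in Ioi x, f t) atTop (𝓝 0) := by
  have h1 : (fun x => ∫ t in Ioi x, f t) = fun x =>
      (∫ t in Ioi 0, f t) - ∫ t in (0 : ℝ)..x, f t := by
    ext y
    rw [eq_sub_iff_add_eq, add_comm]
    exact intervalIntegral.integral_interval_add_Ioi' (hf.intervalIntegrable 0 y) (hi y)
  rw [h1]
  simpa using (intervalIntegral_tendsto_integral_Ioi 0 (hi 0) tendsto_id).const_sub
    (∫ t in Ioi 0, f t)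

variable [NormedSpace ℂ E] [CompleteSpace E]

/-- Solution with prescribed limit at `+∞` of `y' = ν Q y + B(x) y`, where `P + Q = 1` is a
splitting into projections, `Re ν ≥ 0` and the perturbation `B` is integrable at `+∞`. -/
theorem exists_solution_tendsto {ν : ℂ} (hν : 0 ≤ ν.re) {P Q : E →L[ℂ] E}
    (hPQ : ∀ v, P v + Q v = v) (hQP : ∀ v, Q (P v) = 0) {B : ℝ → E →L[ℂ] E} (hB : Continuous B)
    {β : ℝ → ℝ} (hβ : Continuous β) (hBβ : ∀ t, ‖B t‖ ≤ β t) (hβi : ∀ x, IntegrableOn β (Ioi x))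
    {w : E} (hw : Q w = 0) :
    ∃ y : ℝ → E, (∀ x, HasDerivAt y (ν • Q (y x) + B x (y x)) x) ∧ Tendsto y atTop (𝓝 w) := by
  have hβ0 : ∀ t, 0 ≤ β t := fun t => (norm_nonneg _).trans (hBβ t)
  set C : ℝ := ‖P‖ + ‖Q‖ + 1 with hC
  have hCpos : 0 < C := by positivity
  set R : ℝ → ℝ := fun x => ∫ t in Ioi x, β t with hR
  have hRd : ∀ x, HasDerivAt R (-β x) x := hasDerivAt_integral_Ioi hβ hβi
  have hRc : Continuous R := continuous_iff_continuousAt.mpr fun x => (hRd x).continuousAt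
  have hR0 : Tendsto R atTop (𝓝 0) := tendsto_integral_Ioi_zero hβ hβi
  have hRnn : ∀ x, 0 ≤ R x := fun x => integral_nonneg hβ0
  have hRanti : ∀ x t, x ≤ t → R t ≤ R x := fun x t h =>
    setIntegral_mono_set (hβi x) (ae_of_all _ hβ0) (Ioi_subset_Ioi h).eventuallyLE
  -- Since `R' = -β`, the product `β ρ` is an exact derivative, and its tail integral is at most `ρ
  -- / (2C)`. The operator below has norm at most `C` against that tail, so it contracts by `1/2`
  -- with no smallness assumption on `β`.
  set ρ : ℝ → ℝ := fun x => Real.exp (2 * C * R x) with hρ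
  have hρc : Continuous ρ := by fun_prop
  have hρpos : ∀ x, 0 < ρ x := fun x => Real.exp_pos _
  have hρ1 : ∀ x, 1 ≤ ρ x := fun x =>
    Real.one_le_exp (mul_nonneg (by positivity) (hRnn x))
  have hρanti : ∀ x t, x ≤ t → ρ t ≤ ρ x := fun x t h =>
    Real.exp_le_exp.mpr (mul_le_mul_of_nonneg_left (hRanti x t h) (by positivity))
  have hβρi : ∀ x, IntegrableOn (fun t => β t * ρ t) (Ioi x) := by
    intro x
    refine Integrable.mono' ((hβi x).mul_const (ρ x)) (by fun_prop) ?_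
    filter_upwards [ae_restrict_mem measurableSet_Ioi] with t ht
    rw [Real.norm_of_nonneg (mul_nonneg (hβ0 t) (hρpos t).le)]
    exact mul_le_mul_of_nonneg_left (hρanti x t (le_of_lt ht)) (hβ0 t)
  have hβρ : ∀ x, ∫ t in Ioi x, β t * ρ t ≤ (2 * C)⁻¹ * ρ x := by
    intro x
    have hd : ∀ t, HasDerivAt (fun t => -(2 * C)⁻¹ * ρ t) (β t * ρ t) t := by
      intro t
      refine ((((hRd t).const_mul (2 * C)).exp).const_mul (-(2 * C)⁻¹)).congr_deriv ?_
      simp only [hρ]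
      field_simp
    have hl : Tendsto (fun t => -(2 * C)⁻¹ * ρ t) atTop (𝓝 (-(2 * C)⁻¹)) := by
      have h1 := ((hR0.const_mul (2 * C)).rexp).const_mul (-(2 * C)⁻¹)
      simpa using h1
    rw [integral_Ioi_of_hasDerivAt_of_tendsto (hd x).continuousAt.continuousWithinAt
      (fun t _ => hd t) (hβρi x) hl]
    have : 0 < (2 * C)⁻¹ := by positivity
    linarith
  have hFi : ∀ F : ℝ → E, Continuous F → (∃ M, ∀ t, ‖F t‖ ≤ M * (β t * ρ t)) →
      (∀ x, IntegrableOn F (Ioi x)) ∧ 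
      ∀ x : ℝ, IntegrableOn (fun t : ℝ => Complex.exp (-ν * t) • F t) (Ioi x) := by
    rintro F hF ⟨M, hM⟩
    refine ⟨fun x => Integrable.mono' ((hβρi x).const_mul M) hF.aestronglyMeasurable
      (ae_of_all _ hM), fun x => ?_⟩
    refine Integrable.mono' (((hβρi x).const_mul M).const_mul (Real.exp (-ν.re * x)))
      (by fun_prop) ?_
    filter_upwards [ae_restrict_mem measurableSet_Ioi] with t ht
    rw [norm_smul, Complex.norm_exp]
    refine mul_le_mul ?_ (hM t) (norm_nonneg _) (Real.exp_pos _).le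
    refine Real.exp_le_exp.mpr ?_
    have ht : x < t := ht
    simp only [Complex.mul_re, Complex.neg_re, Complex.ofReal_re, Complex.ofReal_im, mul_zero,
      sub_zero]
    nlinarith
  -- For `t > x` and `Re ν ≥ 0` the propagator `e^{ν(x-t)}` has modulus at most one, so both
  -- components are integrated from infinity.
  have hbound : ∀ (F : ℝ → E) (M : ℝ), Continuous F → 0 ≤ M → (∀ t, ‖F t‖ ≤ M * (β t * ρ t)) →
      ∀ x, ‖P (∫ t in Ioi x, F t) + Complex.exp (ν * x) •
        Q (∫ t in Ioi x, Complex.exp (-ν * t) • F t)‖ ≤ C * (M * ∫ t in Ioi x, β t * ρ t) := by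
    intro F M hF hM0 hM x
    set I := ∫ t in Ioi x, β t * ρ t with hI
    have hI0 : 0 ≤ M * I := mul_nonneg hM0 (integral_nonneg fun t => mul_nonneg (hβ0 t) (hρpos t).le)
    have h1 : ‖∫ t in Ioi x, F t‖ ≤ M * I := by
      rw [hI, ← integral_const_mul]
      exact norm_integral_le_of_norm_le ((hβρi x).const_mul M) (ae_of_all _ hM)
    have h2 : ‖Complex.exp (ν * x) • ∫ t in Ioi x, Complex.exp (-ν * t) • F t‖ ≤ M * I := by
      rw [← integral_smul, hI, ← integral_const_mul]
      refine norm_integral_le_of_norm_le ((hβρi x).const_mul M) ?_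
      filter_upwards [ae_restrict_mem measurableSet_Ioi] with t ht
      rw [smul_smul, ← Complex.exp_add, norm_smul, Complex.norm_exp]
      refine (mul_le_of_le_one_left (norm_nonneg _) ?_).trans (hM t)
      refine Real.exp_le_one_iff.mpr ?_
      have ht : x < t := ht
      simp only [Complex.add_re, Complex.mul_re, Complex.neg_re, Complex.ofReal_re,
        Complex.ofReal_im, mul_zero, sub_zero]
      nlinarith
    rw [← map_smul]
    calc _ ≤ ‖P (∫ t in Ioi x, F t)‖ + ‖Q (Complex.exp (ν * x) •
          ∫ t in Ioi x, Complex.exp (-ν * t) • F t)‖ := norm_add_le _ _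
      _ ≤ ‖P‖ * (M * I) + ‖Q‖ * (M * I) := add_le_add (P.le_opNorm_of_le h1) (Q.le_opNorm_of_le h2)
      _ ≤ C * (M * I) := by rw [hC]; nlinarith
  have hFb : ∀ (y : ℝ → E) (M : ℝ), (∀ t, ‖y t‖ ≤ M * ρ t) → ∀ t, ‖B t (y t)‖ ≤ M * (β t * ρ t) := by
    intro y M hM t
    refine ((B t).le_of_opNorm_le_of_le (hBβ t) (hM t)).trans (le_of_eq ?_)
    ring
  have hderiv : ∀ F : ℝ → E, Continuous F → (∃ M, ∀ t, ‖F t‖ ≤ M * (β t * ρ t)) → ∀ x,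
      HasDerivAt (fun x : ℝ => w - (P (∫ t in Ioi x, F t) + Complex.exp (ν * x) •
        Q (∫ t in Ioi x, Complex.exp (-ν * t) • F t)))
        (F x - ν • Complex.exp (ν * x) • Q (∫ t in Ioi x, Complex.exp (-ν * t) • F t)) x := by
    intro F hF hM x
    obtain ⟨i1, i2⟩ := hFi F hF hM
    have d1 := (P.restrictScalars ℝ).hasFDerivAt.comp_hasDerivAt x (hasDerivAt_integral_Ioi hF i1 x)
    have d2 := (Q.restrictScalars ℝ).hasFDerivAt.comp_hasDerivAt x
      (hasDerivAt_integral_Ioi (by fun_prop) i2 x)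
    have d3 : HasDerivAt (fun x : ℝ => Complex.exp (ν * x)) (Complex.exp (ν * x) * ν) x := by
      have := ((hasDerivAt_id x).ofReal_comp.const_mul ν).cexp
      simpa using this
    refine ((d1.add (d3.smul d2)).const_sub w).congr_deriv ?_
    simp only [ContinuousLinearMap.coe_restrictScalars', Function.comp_apply, map_neg, map_smul]
    rw [smul_neg, smul_smul, ← Complex.exp_add]
    have e : ν * x + -ν * x = 0 := by ring
    rw [e, Complex.exp_zero, one_smul, smul_smul, mul_comm ν (Complex.exp (ν * x))]
    conv_rhs => rw [← hPQ (F x)]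
    abel
  -- The integral equation is `y = w - P ∫ₓ^∞ B y - Q ∫ₓ^∞ e^{ν(x-t)} B y`; its correction terms
  -- vanish at `+∞`, so the limit is `w`.
  obtain ⟨y, hyc, ⟨M, hM⟩, hy⟩ := exists_fixedPoint_weighted hρc hρpos
    (fun y x => w - (P (∫ t in Ioi x, B t (y t)) + Complex.exp (ν * x) •
      Q (∫ t in Ioi x, Complex.exp (-ν * t) • B t (y t))))
    (fun y hy ⟨M, hM⟩ => continuous_iff_continuousAt.mpr fun x =>
      (hderiv _ (hB.clm_apply hy) ⟨M, hFb y M hM⟩ x).continuousAt)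
    ⟨‖w‖, fun x => by
      simpa using le_mul_of_one_le_right (norm_nonneg w) (hρ1 x)⟩
    (fun y z hy hz ⟨My, hMy⟩ ⟨Mz, hMz⟩ M hM x => by
      have hM0 : 0 ≤ M := by
        have := (norm_nonneg _).trans (hM 0)
        exact nonneg_of_mul_nonneg_left this (hρpos 0)
      obtain ⟨i1, i2⟩ := hFi _ (hB.clm_apply hy) ⟨My, hFb y My hMy⟩
      obtain ⟨j1, j2⟩ := hFi _ (hB.clm_apply hz) ⟨Mz, hFb z Mz hMz⟩
      have h1 := hbound (fun t => B t (y t - z t)) M (hB.clm_apply (hy.sub hz)) hM0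
        (hFb (fun t => y t - z t) M hM) x
      have h2 : C * (M * ∫ t in Ioi x, β t * ρ t) ≤ M / 2 * ρ x := by
        calc _ ≤ C * (M * ((2 * C)⁻¹ * ρ x)) := by gcongr; exact hβρ x
          _ = _ := by field_simp
      refine le_trans (le_of_eq ?_) (h1.trans h2)
      simp only [map_sub, smul_sub]
      rw [integral_sub (i1 x) (j1 x), integral_sub (i2 x) (j2 x), map_sub, map_sub, smul_sub,
        ← norm_neg]
      congr 1
      abel)
  have hFM := hFb y M hM
  have hFc : Continuous fun t => B t (y t) := hB.clm_apply hyc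
  have hyx : ∀ x, y x = w - (P (∫ t in Ioi x, B t (y t)) + Complex.exp (ν * x) •
      Q (∫ t in Ioi x, Complex.exp (-ν * t) • B t (y t))) := fun x => (congrFun hy x).symm
  have hM0 : 0 ≤ M := nonneg_of_mul_nonneg_left ((norm_nonneg _).trans (hM 0)) (hρpos 0)
  refine ⟨y, fun x => ?_, ?_⟩
  · have h1 := hderiv _ hFc ⟨M, hFM⟩ x
    rw [← funext hyx] at h1
    refine h1.congr_deriv ?_
    -- Idempotence of `Q` follows from `P + Q = 1` and `Q P = 0`.
    have hQQ : ∀ v, Q (Q v) = Q v := fun v => by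
      have := congrArg Q (hPQ v)
      rwa [map_add, hQP, zero_add] at this
    have e : Q (y x) = -(Complex.exp (ν * x) • Q (∫ t in Ioi x, Complex.exp (-ν * t) • B t (y t))) := by
      conv_lhs => rw [hyx x]
      rw [map_sub, map_add, map_smul, hw, hQP, hQQ, zero_add, zero_sub]
    rw [e, smul_neg]
    abel
  · have h1 : Tendsto (fun x => C * (M * ∫ t in Ioi x, β t * ρ t)) atTop (𝓝 0) := by
      have := ((tendsto_integral_Ioi_zero (hβ.mul hρc) hβρi).const_mul M).const_mul C
      simpa using this
    rw [tendsto_iff_norm_sub_tendsto_zero]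
    refine squeeze_zero (fun _ => norm_nonneg _) (fun x => ?_) h1
    rw [hyx x, sub_sub_cancel_left, norm_neg]
    exact hbound _ M hFc hM0 hFM x

end Levinson

/-! ### The planar system: Wronskian, uniqueness, decaying solutions. -/

section System

/-- `(p, q)` solves the planar system `p' = κ p + b q`, `q' = c p - κ q`. -/
structure Sol (κ : ℝ → ℝ) (b c : ℂ) (p q : ℝ → ℂ) : Prop where
  fst : ∀ x, HasDerivAt p (κ x * p x + b * q x) x
  snd : ∀ x, HasDerivAt q (c * p x - κ x * q x) x

/-- The linear map on `ℂ × ℂ` with matrix `(α β; γ δ)`. -/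
def mat2 (α β γ δ : ℂ) : ℂ × ℂ →L[ℂ] ℂ × ℂ :=
  (α • ContinuousLinearMap.fst ℂ ℂ ℂ + β • ContinuousLinearMap.snd ℂ ℂ ℂ).prod
    (γ • ContinuousLinearMap.fst ℂ ℂ ℂ + δ • ContinuousLinearMap.snd ℂ ℂ ℂ)

theorem mat2_apply (α β γ δ : ℂ) (v : ℂ × ℂ) :
    mat2 α β γ δ v = (α * v.1 + β * v.2, γ * v.1 + δ * v.2) := rfl

namespace Sol

variable {κ : ℝ → ℝ} {b c : ℂ} {p q p' q' : ℝ → ℂ}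

theorem continuous_fst (h : Sol κ b c p q) : Continuous p :=
  continuous_iff_continuousAt.mpr fun x => (h.fst x).continuousAt

theorem continuous_snd (h : Sol κ b c p q) : Continuous q :=
  continuous_iff_continuousAt.mpr fun x => (h.snd x).continuousAt

theorem sub_smul (h : Sol κ b c p q) (h' : Sol κ b c p' q') (t : ℂ) :
    Sol κ b c (fun x => p x - t * p' x) (fun x => q x - t * q' x) := by
  refine ⟨fun x => ?_, fun x => ?_⟩
  · exact ((h.fst x).fun_sub ((h'.fst x).const_mul t)).congr_deriv (by ring)
  · exact ((h.snd x).fun_sub ((h'.snd x).const_mul t)).congr_deriv (by ring)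

/-- The coefficient matrix has trace zero, so the determinant of two solutions is constant. -/
theorem wronskian (h : Sol κ b c p q) (h' : Sol κ b c p' q') (x : ℝ) :
    p x * q' x - q x * p' x = p 0 * q' 0 - q 0 * p' 0 := by
  have hd : ∀ x, HasDerivAt (fun x => p x * q' x - q x * p' x) 0 x := fun x =>
    (((h.fst x).fun_mul (h'.snd x)).fun_sub ((h.snd x).fun_mul (h'.fst x))).congr_deriv (by ring)
  exact is_const_of_deriv_eq_zero (fun x => (hd x).differentiableAt) (fun x => (hd x).deriv) x 0

end Sol

variable {κ : ℝ → ℝ} {b c : ℂ}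

theorem exists_sol (hκ : Continuous κ) {L : ℝ} (hL : ∀ x, |κ x| ≤ L) (b c p₀ q₀ : ℂ) :
    ∃ p q, Sol κ b c p q ∧ p 0 = p₀ ∧ q 0 = q₀ := by
  set A : ℝ → ℂ × ℂ →L[ℝ] ℂ × ℂ := fun x =>
    κ x • (mat2 1 0 0 (-1)).restrictScalars ℝ + (mat2 0 b c 0).restrictScalars ℝ with hA
  have hAc : Continuous A := by fun_prop
  have hAL : ∀ x, ‖A x‖ ≤ L * ‖(mat2 1 0 0 (-1)).restrictScalars ℝ‖ +
      ‖(mat2 0 b c 0).restrictScalars ℝ‖ := fun x => by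
    refine (norm_add_le _ _).trans (add_le_add_left ?_ _)
    rw [norm_smul]
    exact mul_le_mul_of_nonneg_right (hL x) (norm_nonneg _)
  obtain ⟨y, hy0, hy⟩ := exists_linear_ode_solution hAc hAL (p₀, q₀)
  refine ⟨fun x => (y x).1, fun x => (y x).2, ⟨fun x => ?_, fun x => ?_⟩, by simp [hy0], by simp [hy0]⟩
  · refine ((ContinuousLinearMap.fst ℝ ℂ ℂ).hasFDerivAt.comp_hasDerivAt x (hy x)).congr_deriv ?_
    simp [hA, mat2_apply]
  · refine ((ContinuousLinearMap.snd ℝ ℂ ℂ).hasFDerivAt.comp_hasDerivAt x (hy x)).congr_deriv ?_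
    simp [hA, mat2_apply]
    ring

/-- The Wronskians with the two fundamental solutions vanish, while the fundamental pair has
Wronskian one; Cramer's rule does the rest. -/
theorem Sol.eq_zero (hκ : Continuous κ) {L : ℝ} (hL : ∀ x, |κ x| ≤ L) {p q : ℝ → ℂ}
    (h : Sol κ b c p q) (hp : p 0 = 0) (hq : q 0 = 0) (x : ℝ) : p x = 0 ∧ q x = 0 := by
  obtain ⟨p1, q1, h1, hp1, hq1⟩ := exists_sol hκ hL b c 1 0
  obtain ⟨p2, q2, h2, hp2, hq2⟩ := exists_sol hκ hL b c 0 1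
  have e1 := h1.wronskian h x
  have e2 := h2.wronskian h x
  have e3 := h1.wronskian h2 x
  simp only [hp1, hq1, hp2, hq2, hp, hq, mul_zero, sub_zero, mul_one] at e1 e2 e3
  constructor
  · linear_combination p2 x * e1 - p1 x * e2 - p x * e3
  · linear_combination q2 x * e1 - q1 x * e2 - q x * e3

theorem integrableOn_Ioi_of_continuous {f : ℝ → ℝ} (hf : Continuous f)
    (hi : IntegrableOn f (Ici 0)) (x : ℝ) : IntegrableOn f (Ioi x) := by
  refine IntegrableOn.mono_set (t := Icc x 0 ∪ Ici 0)
    ((hf.integrableOn_Icc).union hi) fun y hy => ?_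
  rcases le_total y 0 with h | h
  · exact Or.inl ⟨le_of_lt hy, h⟩
  · exact Or.inr h

/-- Existence of a solution decaying at `+∞` with a prescribed exponential rate, for coefficients
which differ from a constant by an integrable function. -/
theorem exists_decaying_sol (hκ : Continuous κ) {κp : ℝ}
    (hi : IntegrableOn (fun x => κ x - κp) (Ici 0)) {μ : ℂ} (hμ : 0 < μ.re)
    (hμ2 : μ ^ 2 = κp ^ 2 + b * c) :
    ∃ p q, Sol κ b c p q ∧ ∃ w₁ w₂ : ℂ, (w₁ ≠ 0 ∨ w₂ ≠ 0) ∧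
      Tendsto (fun x : ℝ => Complex.exp (μ * x) * p x) atTop (𝓝 w₁) ∧
      Tendsto (fun x : ℝ => Complex.exp (μ * x) * q x) atTop (𝓝 w₂) := by
  have hμ0 : μ ≠ 0 := by rintro rfl; simp at hμ
  -- With `A` the limiting matrix, `A² = μ²`, and `P = (μ - A)/(2μ)`, `Q = (μ + A)/(2μ)` are the
  -- spectral projections for `-μ` and `μ`.
  set P := mat2 ((μ - κp) / (2 * μ)) (-b / (2 * μ)) (-c / (2 * μ)) ((μ + κp) / (2 * μ)) with hP
  set Q := mat2 ((μ + κp) / (2 * μ)) (b / (2 * μ)) (c / (2 * μ)) ((μ - κp) / (2 * μ)) with hQ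
  have hPQ : ∀ v, P v + Q v = v := fun v => by
    rw [hP, hQ, mat2_apply, mat2_apply]
    ext <;> simp <;> field_simp <;> ring
  have hQP : ∀ v, Q (P v) = 0 := fun v => by
    rw [hP, hQ, mat2_apply, mat2_apply]
    ext <;> simp only [Prod.fst_zero, Prod.snd_zero] <;> field_simp
    · linear_combination v.1 * hμ2
    · linear_combination v.2 * hμ2
  -- `P` has trace one, so it does not kill both basis vectors.
  obtain ⟨w, hw, hw0⟩ : ∃ w, Q w = 0 ∧ w ≠ 0 := by
    by_cases h1 : P (1, 0) = 0
    · by_cases h2 : P (0, 1) = 0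
      · exfalso
        simp only [hP, mat2_apply, Prod.mk_eq_zero, mul_one, mul_zero, add_zero, zero_add,
          div_eq_zero_iff, mul_eq_zero, OfNat.ofNat_ne_zero, hμ0, or_false] at h1 h2
        exact hμ0 (by linear_combination (1 / 2 : ℂ) * h1.1 + (1 / 2 : ℂ) * h2.2)
      · exact ⟨_, hQP _, h2⟩
    · exact ⟨_, hQP _, h1⟩
  set B : ℝ → ℂ × ℂ →L[ℂ] ℂ × ℂ := fun x => ((κ x - κp : ℝ) : ℂ) • mat2 1 0 0 (-1) with hB
  have hk : Continuous fun x => |κ x - κp| * ‖mat2 1 0 0 (-1)‖ := by fun_prop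
  -- Multiplying a solution by `e^{μx}` shifts `A` to `A + μ = 2μ Q`, whence `ν = 2μ`; the remainder
  -- `B` is the integrable deviation of `κ` from its limit.
  obtain ⟨y, hy, hlim⟩ := exists_solution_tendsto (ν := 2 * μ) (by simp; linarith) hPQ hQP
    (B := B) (by fun_prop) hk
    (fun t => by
      rw [hB, norm_smul, Complex.norm_real, Real.norm_eq_abs])
    (fun x => ((integrableOn_Ioi_of_continuous (by fun_prop) hi x).abs).mul_const _) hw
  have he : ∀ x : ℝ, HasDerivAt (fun x : ℝ => Complex.exp (-μ * x))
      (-μ * Complex.exp (-μ * x)) x := fun x => by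
    have := ((hasDerivAt_id x).ofReal_comp.const_mul (-μ)).cexp
    refine this.congr_deriv ?_
    simp; ring
  refine ⟨fun x => Complex.exp (-μ * x) * (y x).1, fun x => Complex.exp (-μ * x) * (y x).2,
    ⟨fun x => ?_, fun x => ?_⟩, w.1, w.2, ?_, ?_, ?_⟩
  · have h1 := (ContinuousLinearMap.fst ℝ ℂ ℂ).hasFDerivAt.comp_hasDerivAt x (hy x)
    refine ((he x).fun_mul h1).congr_deriv ?_
    simp only [hB, hQ, smul_apply, mat2_apply,
      Prod.fst_add, Prod.smul_fst, smul_eq_mul, Function.comp_apply, ContinuousLinearMap.coe_fst']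
    push_cast
    field_simp
    ring
  · have h1 := (ContinuousLinearMap.snd ℝ ℂ ℂ).hasFDerivAt.comp_hasDerivAt x (hy x)
    refine ((he x).fun_mul h1).congr_deriv ?_
    simp only [hB, hQ, smul_apply, mat2_apply,
      Prod.snd_add, Prod.smul_snd, smul_eq_mul, Function.comp_apply, ContinuousLinearMap.coe_snd']
    push_cast
    field_simp
    ring
  · by_contra hcon
    push Not at hcon
    exact hw0 (Prod.ext hcon.1 hcon.2)
  all_goals
    have e : ∀ x : ℝ, ∀ z : ℂ, Complex.exp (μ * x) * (Complex.exp (-μ * x) * z) = z := by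
      intro x z
      rw [← mul_assoc, ← Complex.exp_add, neg_mul, add_neg_cancel, Complex.exp_zero, one_mul]
    simp only [e]
  · exact (continuous_fst.tendsto w).comp hlim
  · exact (continuous_snd.tendsto w).comp hlim

/-- Grönwall's inequality: with the integrating factor `exp(-∫g)` the quantity is antitone. -/
theorem le_mul_exp_integral {N N' g : ℝ → ℝ} (hN : ∀ x, HasDerivAt N (N' x) x)
    (hg : Continuous g) (hle : ∀ x, N' x ≤ g x * N x) {x : ℝ} (hx : 0 ≤ x) :
    N x ≤ N 0 * Real.exp (∫ t in (0 : ℝ)..x, g t) := by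
  set G : ℝ → ℝ := fun x => ∫ t in (0 : ℝ)..x, g t with hG
  have hGd : ∀ x, HasDerivAt G (g x) x := fun x =>
    intervalIntegral.integral_hasDerivAt_right (hg.intervalIntegrable 0 x)
      (hg.stronglyMeasurableAtFilter _ _) hg.continuousAt
  have hd : ∀ x, HasDerivAt (fun x => N x * Real.exp (-G x))
      ((N' x - g x * N x) * Real.exp (-G x)) x := fun x =>
    ((hN x).fun_mul (hGd x).fun_neg.exp).congr_deriv (by ring)
  have hanti : Antitone fun x => N x * Real.exp (-G x) :=
    antitone_of_deriv_nonpos (fun x => (hd x).differentiableAt) fun x => by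
      rw [(hd x).deriv]
      exact mul_nonpos_of_nonpos_of_nonneg (sub_nonpos.mpr (hle x)) (Real.exp_pos _).le
  have h1 := hanti hx
  have h0 : G 0 = 0 := intervalIntegral.integral_same
  simp only [h0, neg_zero, Real.exp_zero, mul_one] at h1
  calc N x = N x * Real.exp (-G x) * Real.exp (G x) := by
        rw [mul_assoc, ← Real.exp_add, neg_add_cancel, Real.exp_zero, mul_one]
    _ ≤ _ := mul_le_mul_of_nonneg_right h1 (Real.exp_pos _).le

end System

/-! ### Sharp growth rate of arbitrary solutions. -/

section Growth

/-- The left side is the derivative of `‖f‖²` along `f' = l f + k h`: only the real part of `l`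
contributes, and the cross term is split by the arithmetic-geometric mean inequality. -/
theorem two_inner_le {f h l : ℂ} {k m : ℝ} (hm : |l.re| ≤ m) :
    2 * inner ℝ f (l * f + (k : ℂ) * h) ≤ 2 * m * ‖f‖ ^ 2 + |k| * (‖f‖ ^ 2 + ‖h‖ ^ 2) := by
  have e1 : inner ℝ f (l * f) = l.re * ‖f‖ ^ 2 := by
    rw [Complex.inner, ← Complex.normSq_eq_norm_sq, Complex.normSq_apply]
    simp [Complex.mul_re, Complex.mul_im]
    ring
  have e2 : inner ℝ f ((k : ℂ) * h) ≤ |k| * (‖f‖ * ‖h‖) := by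
    refine (real_inner_le_norm _ _).trans (le_of_eq ?_)
    rw [norm_mul, Complex.norm_real, Real.norm_eq_abs]
    ring
  rw [inner_add_right, e1]
  have h1 : l.re * ‖f‖ ^ 2 ≤ m * ‖f‖ ^ 2 :=
    mul_le_mul_of_nonneg_right ((le_abs_self _).trans hm) (sq_nonneg _)
  have h2 : |k| * (2 * (‖f‖ * ‖h‖)) ≤ |k| * (‖f‖ ^ 2 + ‖h‖ ^ 2) :=
    mul_le_mul_of_nonneg_left (by nlinarith [sq_nonneg (‖f‖ - ‖h‖)]) (abs_nonneg _)
  linarith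

theorem norm_add_mul_sq_le (α β p q : ℂ) :
    ‖α * p + β * q‖ ^ 2 ≤ (‖α‖ ^ 2 + ‖β‖ ^ 2) * (‖p‖ ^ 2 + ‖q‖ ^ 2) := by
  have h1 : ‖α * p + β * q‖ ≤ ‖α‖ * ‖p‖ + ‖β‖ * ‖q‖ :=
    (norm_add_le _ _).trans (by rw [norm_mul, norm_mul])
  have h2 := pow_le_pow_left₀ (norm_nonneg _) h1 2
  nlinarith [sq_nonneg (‖α‖ * ‖q‖ - ‖β‖ * ‖p‖)]

theorem norm_sub_sq_le_two (z w : ℂ) : ‖z - w‖ ^ 2 ≤ 2 * (‖z‖ ^ 2 + ‖w‖ ^ 2) := by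
  have h2 := pow_le_pow_left₀ (norm_nonneg _) (norm_sub_le z w) 2
  nlinarith [sq_nonneg (‖z‖ - ‖w‖)]

variable {κ : ℝ → ℝ} {b c : ℂ}

/-- Every solution grows at most like `exp (Re μ x)` on the positive half-line. -/
theorem Sol.growth (hκ : Continuous κ) {κp : ℝ}
    (hi : IntegrableOn (fun x => κ x - κp) (Ici 0)) {μ : ℂ} (hμ : 0 < μ.re)
    (hμ2 : μ ^ 2 = κp ^ 2 + b * c) {p q : ℝ → ℂ} (h : Sol κ b c p q) :
    ∃ C, 0 ≤ C ∧ ∀ x, 0 ≤ x → ‖p x‖ ≤ C * Real.exp (μ.re * x) ∧ ‖q x‖ ≤ C * Real.exp (μ.re * x) := by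
  have hμ0 : μ ≠ 0 := by rintro rfl; simp at hμ
  have hμn : 0 < ‖μ‖ := norm_pos_iff.mpr hμ0
  set k : ℝ → ℝ := fun x => κ x - κp with hk
  have hkc : Continuous k := by fun_prop
  -- `S = (A + μ)(p, q)` and `D = (A - μ)(p, q)` are the spectral components. They evolve with rates
  -- `μ` and `-μ` up to the integrable `k`, so their energy grows at rate exactly `2 Re μ`. A direct
  -- norm estimate would give the norm of `A` instead, too large to pair with the decaying solution.
  set S1 : ℝ → ℂ := fun x => (κp + μ) * p x + b * q x with hS1
  set S2 : ℝ → ℂ := fun x => c * p x + (μ - κp) * q x with hS2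
  set D1 : ℝ → ℂ := fun x => (κp - μ) * p x + b * q x with hD1
  set D2 : ℝ → ℂ := fun x => c * p x + (-κp - μ) * q x with hD2
  have dS1 : ∀ x, HasDerivAt S1 (μ * S1 x + (k x : ℂ) * ((κp + μ) * p x + -b * q x)) x := fun x => by
    refine (((h.fst x).const_mul _).fun_add ((h.snd x).const_mul _)).congr_deriv ?_
    simp only [hS1, hk]; push_cast
    linear_combination (-p x) * hμ2
  have dS2 : ∀ x, HasDerivAt S2 (μ * S2 x + (k x : ℂ) * (c * p x + -(μ - κp) * q x)) x := fun x => by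
    refine (((h.fst x).const_mul _).fun_add ((h.snd x).const_mul _)).congr_deriv ?_
    simp only [hS2, hk]; push_cast
    linear_combination (-q x) * hμ2
  have dD1 : ∀ x, HasDerivAt D1 (-μ * D1 x + (k x : ℂ) * ((κp - μ) * p x + -b * q x)) x := fun x => by
    refine (((h.fst x).const_mul _).fun_add ((h.snd x).const_mul _)).congr_deriv ?_
    simp only [hD1, hk]; push_cast
    linear_combination (-p x) * hμ2
  have dD2 : ∀ x, HasDerivAt D2 (-μ * D2 x + (k x : ℂ) * (c * p x + (κp + μ) * q x)) x := fun x => by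
    refine (((h.fst x).const_mul _).fun_add ((h.snd x).const_mul _)).congr_deriv ?_
    simp only [hD2, hk]; push_cast
    linear_combination (-q x) * hμ2
  set N : ℝ → ℝ := fun x => ‖S1 x‖ ^ 2 + ‖S2 x‖ ^ 2 + ‖D1 x‖ ^ 2 + ‖D2 x‖ ^ 2 with hN
  -- The solution is recovered from `S - D = 2μ (p, q)`.
  have hpq : ∀ x, ‖p x‖ ^ 2 + ‖q x‖ ^ 2 ≤ (2 * ‖μ‖ ^ 2)⁻¹ * N x := by
    intro x
    have e1 : 2 * μ * p x = S1 x - D1 x := by simp only [hS1, hD1]; ring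
    have e2 : 2 * μ * q x = S2 x - D2 x := by simp only [hS2, hD2]; ring
    have i1 := norm_sub_sq_le_two (S1 x) (D1 x)
    have i2 := norm_sub_sq_le_two (S2 x) (D2 x)
    rw [← e1, norm_mul, norm_mul, Complex.norm_ofNat] at i1
    rw [← e2, norm_mul, norm_mul, Complex.norm_ofNat] at i2
    rw [← div_eq_inv_mul, le_div_iff₀ (by positivity)]
    simp only [hN]
    linarith
  set Γ : ℝ := (‖(κp : ℂ) + μ‖ ^ 2 + ‖-b‖ ^ 2) + (‖c‖ ^ 2 + ‖-(μ - (κp : ℂ))‖ ^ 2) +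
    (‖(κp : ℂ) - μ‖ ^ 2 + ‖-b‖ ^ 2) + (‖c‖ ^ 2 + ‖(κp : ℂ) + μ‖ ^ 2) with hΓ
  have hΓ0 : 0 ≤ Γ := by positivity
  set K : ℝ := Γ * (2 * ‖μ‖ ^ 2)⁻¹ with hK
  have hK0 : 0 ≤ K := by positivity
  set g : ℝ → ℝ := fun x => 2 * μ.re + (1 + K) * |k x| with hg
  have hgc : Continuous g := by fun_prop
  have hle : ∀ x, 2 * inner ℝ (S1 x) (μ * S1 x + (k x : ℂ) * ((κp + μ) * p x + -b * q x)) +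
      2 * inner ℝ (S2 x) (μ * S2 x + (k x : ℂ) * (c * p x + -(μ - κp) * q x)) +
      2 * inner ℝ (D1 x) (-μ * D1 x + (k x : ℂ) * ((κp - μ) * p x + -b * q x)) +
      2 * inner ℝ (D2 x) (-μ * D2 x + (k x : ℂ) * (c * p x + (κp + μ) * q x)) ≤ g x * N x := by
    intro x
    have hm1 : |μ.re| ≤ μ.re := (abs_of_pos hμ).le
    have hm2 : |(-μ).re| ≤ μ.re := by rw [Complex.neg_re, abs_neg]; exact hm1
    have j1 := two_inner_le (f := S1 x) (h := (κp + μ) * p x + -b * q x) (k := k x) hm1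
    have j2 := two_inner_le (f := S2 x) (h := c * p x + -(μ - κp) * q x) (k := k x) hm1
    have j3 := two_inner_le (f := D1 x) (h := (κp - μ) * p x + -b * q x) (k := k x) hm2
    have j4 := two_inner_le (f := D2 x) (h := c * p x + (κp + μ) * q x) (k := k x) hm2
    have i1 := norm_add_mul_sq_le (κp + μ) (-b) (p x) (q x)
    have i2 := norm_add_mul_sq_le c (-(μ - κp)) (p x) (q x)
    have i3 := norm_add_mul_sq_le (κp - μ) (-b) (p x) (q x)
    have i4 := norm_add_mul_sq_le c (κp + μ) (p x) (q x)
    have hsum : ‖(κp + μ) * p x + -b * q x‖ ^ 2 + ‖c * p x + -(μ - κp) * q x‖ ^ 2 +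
        ‖(κp - μ) * p x + -b * q x‖ ^ 2 + ‖c * p x + (κp + μ) * q x‖ ^ 2 ≤ K * N x := by
      calc _ ≤ Γ * (‖p x‖ ^ 2 + ‖q x‖ ^ 2) := by rw [hΓ]; linarith
        _ ≤ Γ * ((2 * ‖μ‖ ^ 2)⁻¹ * N x) := mul_le_mul_of_nonneg_left (hpq x) hΓ0
        _ = K * N x := by rw [hK]; ring
    have hmul := mul_le_mul_of_nonneg_left hsum (abs_nonneg (k x))
    have e : g x * N x = 2 * μ.re * N x + |k x| * N x + |k x| * (K * N x) := by
      simp only [hg]; ring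
    rw [e]
    have eN : N x = ‖S1 x‖ ^ 2 + ‖S2 x‖ ^ 2 + ‖D1 x‖ ^ 2 + ‖D2 x‖ ^ 2 := rfl
    rw [eN] at hmul ⊢
    linarith
  have hNd := fun x => ((((dS1 x).norm_sq).add (dS2 x).norm_sq).add (dD1 x).norm_sq).add
    (dD2 x).norm_sq
  set J : ℝ := ∫ t in Ioi 0, |k t| with hJ
  have hki : IntegrableOn (fun t => |k t|) (Ioi 0) := (hi.mono_set Ioi_subset_Ici_self).abs
  have hN0 : 0 ≤ N 0 := by positivity
  refine ⟨Real.sqrt ((2 * ‖μ‖ ^ 2)⁻¹ * (N 0 * Real.exp ((1 + K) * J))), Real.sqrt_nonneg _,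
    fun x hx => ?_⟩
  have h1 : N x ≤ N 0 * Real.exp (∫ t in (0 : ℝ)..x, g t) := le_mul_exp_integral hNd hgc hle hx
  have h2 : ∫ t in (0 : ℝ)..x, g t ≤ 2 * (μ.re * x) + (1 + K) * J := by
    have : ∫ t in (0 : ℝ)..x, g t = 2 * (μ.re * x) + (1 + K) * ∫ t in (0 : ℝ)..x, |k t| := by
      simp only [hg]
      rw [intervalIntegral.integral_add (by simp)
        (Continuous.intervalIntegrable (by fun_prop) _ _), intervalIntegral.integral_const,
        intervalIntegral.integral_const_mul]
      simp; ring
    rw [this, intervalIntegral.integral_of_le hx]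
    refine add_le_add_right (mul_le_mul_of_nonneg_left ?_ (by linarith)) _
    exact setIntegral_mono_set hki (ae_of_all _ fun t => abs_nonneg _)
      Ioc_subset_Ioi_self.eventuallyLE
  have h3 : ‖p x‖ ^ 2 + ‖q x‖ ^ 2 ≤
      (2 * ‖μ‖ ^ 2)⁻¹ * (N 0 * Real.exp ((1 + K) * J)) * Real.exp (μ.re * x) ^ 2 := by
    refine (hpq x).trans ?_
    have e : Real.exp ((1 + K) * J) * Real.exp (μ.re * x) ^ 2 =
        Real.exp (2 * (μ.re * x) + (1 + K) * J) := by
      rw [← Real.exp_nat_mul, ← Real.exp_add]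
      congr 1
      push_cast
      ring
    rw [mul_assoc, mul_assoc, e]
    refine mul_le_mul_of_nonneg_left (h1.trans ?_) (by positivity)
    exact mul_le_mul_of_nonneg_left (Real.exp_le_exp.mpr h2) hN0
  have h4 : ∀ r : ℝ, 0 ≤ r → r ^ 2 ≤
      (2 * ‖μ‖ ^ 2)⁻¹ * (N 0 * Real.exp ((1 + K) * J)) * Real.exp (μ.re * x) ^ 2 →
      r ≤ Real.sqrt ((2 * ‖μ‖ ^ 2)⁻¹ * (N 0 * Real.exp ((1 + K) * J))) * Real.exp (μ.re * x) := by
    intro r hr hr2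
    refine abs_le_of_sq_le_sq' ?_ (by positivity) |>.2
    rw [mul_pow, Real.sq_sqrt (by positivity)]
    exact hr2
  exact ⟨h4 _ (norm_nonneg _) (by nlinarith [sq_nonneg ‖q x‖]),
    h4 _ (norm_nonneg _) (by nlinarith [sq_nonneg ‖p x‖])⟩

end Growth

/-! ### Square integrability on a half-line under an orthogonality condition. -/

section HalfLine

open ENNReal in
/-- Convolution with an integrable kernel is bounded on `L²`. -/
theorem lintegral_conv_sq_le {k g : ℝ → ℝ≥0∞} (hk : Measurable k) (hkI : ∫⁻ t, k t ≠ ⊤)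
    (hg : AEMeasurable g) :
    ∫⁻ x, (∫⁻ t, k (x - t) * g t) ^ 2 ≤ (∫⁻ t, k t) ^ 2 * ∫⁻ t, g t ^ 2 := by
  set I := ∫⁻ t, k t with hI
  have hIx : ∀ x, ∫⁻ t, k (x - t) = I := fun x => lintegral_sub_left_eq_self k x
  have hIt : ∀ t, ∫⁻ x, k (x - t) = I := fun t => lintegral_sub_right_eq_self k t
  -- Cauchy-Schwarz after writing `k` as the product of two square roots; Tonelli then finishes as
  -- in the Schur test.
  have hcs : ∀ x, (∫⁻ t, k (x - t) * g t) ^ 2 ≤ I * ∫⁻ t, k (x - t) * g t ^ 2 := by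
    intro x
    have hm : AEMeasurable fun t => k (x - t) := (hk.comp (by fun_prop)).aemeasurable
    have h1 := lintegral_mul_le_Lp_mul_Lq volume Real.HolderConjugate.two_two
      (f := fun t => k (x - t) ^ (1 / 2 : ℝ)) (g := fun t => k (x - t) ^ (1 / 2 : ℝ) * g t)
      (hm.pow_const _) ((hm.pow_const _).mul hg)
    have e0 : ∀ y : ℝ≥0∞, y ^ (1 / 2 : ℝ) * y ^ (1 / 2 : ℝ) = y := fun y => by
      rw [← rpow_add_of_nonneg _ _ (by norm_num) (by norm_num)]; norm_num
    have e1 : ∀ t, ((fun t => k (x - t) ^ (1 / 2 : ℝ)) * fun t => k (x - t) ^ (1 / 2 : ℝ) * g t) t =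
        k (x - t) * g t := fun t => by
      simp only [Pi.mul_apply]; rw [← mul_assoc, e0]
    have e2 : ∀ t, (k (x - t) ^ (1 / 2 : ℝ)) ^ (2 : ℝ) = k (x - t) := fun t => by
      rw [← rpow_mul]; norm_num
    have e3 : ∀ t, (k (x - t) ^ (1 / 2 : ℝ) * g t) ^ (2 : ℝ) = k (x - t) * g t ^ 2 := fun t => by
      rw [mul_rpow_of_nonneg _ _ (by norm_num), e2, rpow_two]
    simp only [e1, e2, e3, hIx] at h1
    calc _ ≤ (I ^ (1 / 2 : ℝ) * (∫⁻ t, k (x - t) * g t ^ 2) ^ (1 / 2 : ℝ)) ^ 2 := by gcongr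
      _ = _ := by rw [mul_pow, sq, sq, e0, e0]
  calc _ ≤ ∫⁻ x, I * ∫⁻ t, k (x - t) * g t ^ 2 := lintegral_mono hcs
    _ ≤ I * ∫⁻ x, ∫⁻ t, k (x - t) * g t ^ 2 := by
        rw [lintegral_const_mul' _ _ hkI]
    _ = I * ∫⁻ t, ∫⁻ x, k (x - t) * g t ^ 2 := by
        rw [lintegral_lintegral_swap]
        refine AEMeasurable.mul (hk.comp (by fun_prop)).aemeasurable ?_
        exact (hg.pow_const 2).comp_snd
    _ = I * ∫⁻ t, I * g t ^ 2 := by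
        congr 1
        refine lintegral_congr fun t => ?_
        rw [lintegral_mul_const (f := fun x => k (x - t)) _ (hk.comp (by fun_prop)), hIt]
    _ = _ := by
        rw [lintegral_const_mul'' _ (hg.pow_const 2)]
        ring

theorem integrable_exp_neg_mul_abs {m : ℝ} (hm : 0 < m) :
    Integrable fun x : ℝ => Real.exp (-m * |x|) := by
  rw [← integrableOn_univ, ← Iic_union_Ioi (a := (0 : ℝ))]
  refine IntegrableOn.union ?_ ?_
  · refine (integrableOn_exp_mul_Iic hm 0).congr_fun (fun x hx => ?_) measurableSet_Iic
    have hx : x ≤ 0 := hx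
    simp only [abs_of_nonpos hx]
    congr 1; ring
  · refine (integrableOn_exp_mul_Ioi (neg_lt_zero.mpr hm) 0).congr_fun (fun x hx => ?_)
      measurableSet_Ioi
    have hx : 0 < x := hx
    simp only [abs_of_pos hx]

theorem memLp_Ioi_of_exp_bound {E : Type*} [NormedAddCommGroup E] {f : ℝ → E} {m C : ℝ}
    (hf : AEStronglyMeasurable f (volume.restrict (Ioi 0))) (hm : 0 < m)
    (hb : ∀ x, 0 ≤ x → ‖f x‖ ≤ C * Real.exp (-m * x)) :
    MemLp f 2 (volume.restrict (Ioi 0)) := by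
  have h1 : MemLp (fun x => C * Real.exp (-m * x)) 2 (volume.restrict (Ioi 0)) := by
    rw [memLp_two_iff_integrable_sq (by fun_prop)]
    refine ((integrableOn_exp_mul_Ioi (a := -(2 * m)) (by linarith) 0).const_mul (C ^ 2)).congr
      (ae_of_all _ fun x => ?_)
    simp only
    rw [mul_pow, ← Real.exp_nat_mul]
    congr 2
    push_cast; ring
  refine h1.mono' hf ?_
  filter_upwards [ae_restrict_mem measurableSet_Ioi] with x hx
  exact hb x (le_of_lt hx)

open ENNReal in
theorem memLp_of_le_conv_exp {F : ℝ → ℂ} {g : ℝ → ℝ≥0∞} {m C : ℝ} (hm : 0 < m) {s : Set ℝ}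
    (hs : MeasurableSet s) (hF : AEStronglyMeasurable F) (hg : AEMeasurable g)
    (hg2 : ∫⁻ t, g t ^ 2 ≠ ⊤)
    (hb : ∀ x ∈ s, ‖F x‖ₑ ≤ ENNReal.ofReal C * ∫⁻ t, ENNReal.ofReal (Real.exp (-m * |x - t|)) * g t) :
    MemLp F 2 (volume.restrict s) := by
  refine ⟨hF.restrict, ?_⟩
  rw [eLpNorm_lt_top_iff_lintegral_rpow_enorm_lt_top (by norm_num) (by norm_num)]
  set k : ℝ → ℝ≥0∞ := fun x => ENNReal.ofReal (Real.exp (-m * |x|)) with hk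
  have hkm : Measurable k := by fun_prop
  have hkI : ∫⁻ t, k t ≠ ⊤ := by
    have := (integrable_exp_neg_mul_abs hm).lintegral_lt_top
    exact this.ne
  have h1 := lintegral_conv_sq_le hkm hkI hg
  calc ∫⁻ x in s, ‖F x‖ₑ ^ (2 : ℝ≥0∞).toReal
      ≤ ∫⁻ x in s, ENNReal.ofReal C ^ 2 * (∫⁻ t, k (x - t) * g t) ^ 2 := by
        refine setLIntegral_mono' hs fun x hx => ?_
        rw [ENNReal.toReal_ofNat, ENNReal.rpow_two, ← mul_pow]
        gcongr
        exact hb x hx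
    _ ≤ ∫⁻ x, ENNReal.ofReal C ^ 2 * (∫⁻ t, k (x - t) * g t) ^ 2 := setLIntegral_le_lintegral _ _
    _ = ENNReal.ofReal C ^ 2 * ∫⁻ x, (∫⁻ t, k (x - t) * g t) ^ 2 :=
        lintegral_const_mul' _ _ (by finiteness)
    _ ≤ ENNReal.ofReal C ^ 2 * ((∫⁻ t, k t) ^ 2 * ∫⁻ t, g t ^ 2) := by gcongr
    _ < ⊤ := by
        refine ENNReal.mul_lt_top (by finiteness) (ENNReal.mul_lt_top ?_ hg2.lt_top)
        exact (ENNReal.pow_ne_top hkI).lt_top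

/-- Near infinity the limit gives the bound, and on the remaining compact interval continuity does.
-/
theorem norm_le_exp_of_tendsto {μ : ℂ} {f : ℝ → ℂ} {w : ℂ} (hf : Continuous f)
    (h : Tendsto (fun x : ℝ => Complex.exp (μ * x) * f x) atTop (𝓝 w)) :
    ∃ C, 0 ≤ C ∧ ∀ x, 0 ≤ x → ‖f x‖ ≤ C * Real.exp (-μ.re * x) := by
  obtain ⟨X, hX⟩ := mem_atTop_sets.mp (h.norm.eventually_le_const (lt_add_one ‖w‖))
  have hc : Continuous fun x : ℝ => Complex.exp (μ * x) * f x := by fun_prop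
  obtain ⟨K, hK⟩ := isCompact_Icc.exists_bound_of_continuousOn (s := Icc 0 X) hc.continuousOn
  refine ⟨max (‖w‖ + 1) K, le_max_of_le_left (by positivity), fun x hx => ?_⟩
  have h1 : ‖Complex.exp (μ * x) * f x‖ ≤ max (‖w‖ + 1) K := by
    rcases le_total X x with h1 | h1
    · exact (hX x h1).trans (le_max_left _ _)
    · exact (hK x ⟨hx, h1⟩).trans (le_max_right _ _)
  rw [norm_mul, Complex.norm_exp] at h1
  have e : (μ * x).re = μ.re * x := by simp
  rw [e] at h1
  calc ‖f x‖ = Real.exp (μ.re * x) * ‖f x‖ * Real.exp (-μ.re * x) := by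
        rw [mul_right_comm, ← Real.exp_add, neg_mul, add_neg_cancel, Real.exp_zero, one_mul]
    _ ≤ _ := mul_le_mul_of_nonneg_right h1 (Real.exp_pos _).le

variable {κ : ℝ → ℝ} {b c : ℂ}

theorem IsPrim.mul {U u V v : ℝ → ℂ} (hU : IsPrim U u) (hV : IsPrim V v) :
    IsPrim (fun x => U x * V x) (fun x => U x * v x + u x * V x) :=
  hU.smul hV

theorem Sol.isPrim_fst (hκ : Continuous κ) {p q : ℝ → ℂ} (h : Sol κ b c p q) :
    IsPrim p fun x => κ x * p x + b * q x :=
  IsPrim.of_hasDerivAt (by have := h.continuous_fst; have := h.continuous_snd; fun_prop) h.fst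

theorem Sol.isPrim_snd (hκ : Continuous κ) {p q : ℝ → ℂ} (h : Sol κ b c p q) :
    IsPrim q fun x => c * p x - κ x * q x :=
  IsPrim.of_hasDerivAt (by have := h.continuous_fst; have := h.continuous_snd; fun_prop) h.snd

theorem IsPrim.sub {U u V v : ℝ → ℂ} (hU : IsPrim U u) (hV : IsPrim V v) :
    IsPrim (fun x => U x - V x) (fun x => u x - v x) := by
  refine ⟨hU.locInt.sub hV.locInt, fun x => ?_⟩
  rw [hU.eq_add x, hV.eq_add x, intervalIntegral.integral_sub
    (locallyIntegrable_intervalIntegrable hU.locInt _ _)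
    (locallyIntegrable_intervalIntegrable hV.locInt _ _)]
  ring

/-- Wronskian identity for an inhomogeneous equation. -/
theorem Sol.isPrim_wronskian (hκ : Continuous κ) {p q P Q g₁ g₂ : ℝ → ℂ} (h : Sol κ b c p q)
    (hP : IsPrim P fun x => κ x * P x + b * Q x + g₁ x)
    (hQ : IsPrim Q fun x => c * P x - κ x * Q x + g₂ x) :
    IsPrim (fun x => p x * Q x - q x * P x) (fun x => p x * g₂ x - q x * g₁ x) := by
  refine (((h.isPrim_fst hκ).mul hQ).sub ((h.isPrim_snd hκ).mul hP)).congr (ae_of_all _ fun x => ?_)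
  simp only
  ring

open ENNReal in
/-- `L²` bound on the half-line for the solution of the inhomogeneous problem with zero initial
data, provided the source is orthogonal to the decaying solution. -/
theorem memLp_Ioi_of_orthogonal (hκ : Continuous κ) {L : ℝ} (hL : ∀ x, |κ x| ≤ L) {m C : ℝ}
    (hm : 0 < m) {p q : ℝ → ℂ} (h : Sol κ b c p q) (hne : p 0 ≠ 0 ∨ q 0 ≠ 0)
    (hp : ∀ x, 0 ≤ x → ‖p x‖ ≤ C * Real.exp (-m * x))
    (hq : ∀ x, 0 ≤ x → ‖q x‖ ≤ C * Real.exp (-m * x))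
    (hgrow : ∀ p q, Sol κ b c p q → ∃ C, 0 ≤ C ∧ ∀ x, 0 ≤ x →
      ‖p x‖ ≤ C * Real.exp (m * x) ∧ ‖q x‖ ≤ C * Real.exp (m * x))
    {P Q g₁ g₂ : ℝ → ℂ}
    (hP : IsPrim P fun x => κ x * P x + b * Q x + g₁ x)
    (hQ : IsPrim Q fun x => c * P x - κ x * Q x + g₂ x) (hP0 : P 0 = 0) (hQ0 : Q 0 = 0)
    (hg₁ : MemLp g₁ 2) (hg₂ : MemLp g₂ 2)
    (horth : ∫ x in Ioi 0, (p x * g₂ x - q x * g₁ x) = 0) :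
    MemLp P 2 (volume.restrict (Ioi 0)) ∧ MemLp Q 2 (volume.restrict (Ioi 0)) := by
  -- A complementary solution, in general growing, normalized to Wronskian one so that Cramer's rule
  -- has no denominators.
  obtain ⟨p', q', h', hW⟩ : ∃ p' q', Sol κ b c p' q' ∧ p 0 * q' 0 - q 0 * p' 0 = 1 := by
    by_cases h0 : p 0 = 0
    · have hq0 : q 0 ≠ 0 := hne.resolve_left (by simpa using h0)
      obtain ⟨p', q', h', e1, e2⟩ := exists_sol hκ hL b c (-(q 0)⁻¹) 0
      exact ⟨p', q', h', by rw [e1, e2]; field_simp; simp⟩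
    · obtain ⟨p', q', h', e1, e2⟩ := exists_sol hκ hL b c 0 (p 0)⁻¹
      exact ⟨p', q', h', by rw [e1, e2]; field_simp; simp⟩
  have hWx : ∀ x, p x * q' x - q x * p' x = 1 := fun x => (h.wronskian h' x).trans hW
  obtain ⟨C', hC', hgr⟩ := hgrow p' q' h'
  have hC : 0 ≤ C := by simpa using (norm_nonneg _).trans (hp 0 le_rfl)
  have hδ := h.isPrim_wronskian hκ hP hQ
  have hη := h'.isPrim_wronskian hκ hP hQ
  set δ : ℝ → ℂ := fun x => p x * Q x - q x * P x with hδd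
  set η : ℝ → ℂ := fun x => p' x * Q x - q' x * P x with hηd
  have hPe : ∀ x, P x = δ x * p' x - η x * p x := fun x => by
    simp only [hδd, hηd]; linear_combination (-P x) * hWx x
  have hQe : ∀ x, Q x = δ x * q' x - η x * q x := fun x => by
    simp only [hδd, hηd]; linear_combination (-Q x) * hWx x
  have hpL : MemLp p 2 (volume.restrict (Ioi 0)) :=
    memLp_Ioi_of_exp_bound h.continuous_fst.aestronglyMeasurable hm hp
  have hqL : MemLp q 2 (volume.restrict (Ioi 0)) :=
    memLp_Ioi_of_exp_bound h.continuous_snd.aestronglyMeasurable hm hq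
  have hfi : IntegrableOn (fun x => p x * g₂ x - q x * g₁ x) (Ioi 0) :=
    (hpL.integrable_mul (hg₂.restrict _)).sub (hqL.integrable_mul (hg₁.restrict _))
  set G : ℝ → ℝ≥0∞ := fun t => ‖g₁ t‖ₑ + ‖g₂ t‖ₑ with hG
  have hGm : AEMeasurable G := hg₁.1.enorm.add hg₂.1.enorm
  have hG2 : ∫⁻ t, G t ^ 2 ≠ ⊤ := by
    have h1 : MemLp (fun t => ‖g₁ t‖ + ‖g₂ t‖) 2 := hg₁.norm.add hg₂.norm
    have h2 := (eLpNorm_lt_top_iff_lintegral_rpow_enorm_lt_top (by norm_num) (by norm_num)).mp h1.2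
    refine ne_of_lt (lt_of_le_of_lt (lintegral_mono fun t => ?_) h2)
    rw [ENNReal.toReal_ofNat, ENNReal.rpow_two]
    simp only [hG]
    gcongr
    rw [← ofReal_norm, ← ofReal_norm, ← ofReal_norm, ← ENNReal.ofReal_add (norm_nonneg _) (norm_nonneg _)]
    exact ENNReal.ofReal_le_ofReal (le_abs_self _)
  have hmulb : ∀ (a₁ a₂ : ℂ) (r t : ℝ), 0 ≤ r → ‖a₁‖ ≤ r → ‖a₂‖ ≤ r →
      ‖a₁ * g₂ t - a₂ * g₁ t‖ₑ ≤ ENNReal.ofReal r * G t := by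
    intro a₁ a₂ r t hr h1 h2
    refine enorm_sub_le.trans ?_
    rw [enorm_mul, enorm_mul]
    simp only [hG]
    rw [mul_add, add_comm (ENNReal.ofReal r * ‖g₁ t‖ₑ)]
    gcongr
    · rw [← ofReal_norm]; exact ENNReal.ofReal_le_ofReal h1
    · rw [← ofReal_norm]; exact ENNReal.ofReal_le_ofReal h2
  set I : ℝ → ℝ≥0∞ := fun x => ∫⁻ t, ENNReal.ofReal (Real.exp (-m * |x - t|)) * G t with hI
  -- Used with `r = m` for `t > x` and with `r = -m` for `0 < t ≤ x`; both reduce to the kernel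
  -- `e^{-m|x-t|}`.
  have hkey : ∀ (A r x : ℝ) (S : Set ℝ), MeasurableSet S → 0 ≤ A →
      (∀ t ∈ S, Real.exp (r * x) * Real.exp (-r * t) = Real.exp (-m * |x - t|)) →
      ENNReal.ofReal (Real.exp (r * x)) * (∫⁻ t in S, ENNReal.ofReal (A * Real.exp (-r * t)) * G t) ≤
        ENNReal.ofReal A * I x := by
    intro A r x S hS hA hexp
    rw [← lintegral_const_mul' _ _ ENNReal.ofReal_ne_top, hI, ← lintegral_const_mul' _ _ ENNReal.ofReal_ne_top]
    refine le_trans (setLIntegral_mono' hS fun t ht => le_of_eq ?_) (setLIntegral_le_lintegral S _)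
    rw [← mul_assoc, ← mul_assoc, ← ENNReal.ofReal_mul (Real.exp_pos _).le, ← ENNReal.ofReal_mul hA,
      ← hexp t ht]
    congr 2
    ring
  have hδb : ∀ x, 0 < x → ENNReal.ofReal (Real.exp (m * x)) * ‖δ x‖ₑ ≤ ENNReal.ofReal C * I x := by
    intro x hx
    -- Here orthogonality enters: the integral over `(0, x)` equals minus the tail. Only the tail
    -- form is small enough to compensate the growth of `p'`, `q'`.
    have e1 : δ x = -∫ t in Ioi x, (p t * g₂ t - q t * g₁ t) := by
      rw [hδ.eq_add x]
      have h2 := intervalIntegral.integral_interval_add_Ioi'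
        (locallyIntegrable_intervalIntegrable hδ.locInt 0 x) (hfi.mono_set (Ioi_subset_Ioi hx.le))
      rw [horth] at h2
      simp only [hδd, hP0, hQ0, mul_zero, sub_zero, zero_add]
      exact eq_neg_of_add_eq_zero_left h2
    rw [e1, enorm_neg]
    refine le_trans ?_ (hkey C m x (Ioi x) measurableSet_Ioi hC fun t ht => ?_)
    · gcongr
      refine (enorm_integral_le_lintegral_enorm _).trans (setLIntegral_mono' measurableSet_Ioi fun t ht => ?_)
      have ht0 : 0 ≤ t := hx.le.trans (le_of_lt ht)
      exact hmulb _ _ _ t (by positivity) (hp t ht0) (hq t ht0)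
    · have ht : x < t := ht
      rw [← Real.exp_add, abs_of_neg (by linarith)]
      congr 1; ring
  have hηb : ∀ x, 0 < x → ENNReal.ofReal (Real.exp (-m * x)) * ‖η x‖ₑ ≤ ENNReal.ofReal C' * I x := by
    intro x hx
    have e1 : η x = ∫ t in Ioc 0 x, (p' t * g₂ t - q' t * g₁ t) := by
      rw [hη.eq_add x, intervalIntegral.integral_of_le hx.le]
      simp only [hηd, hP0, hQ0, mul_zero, sub_zero, zero_add]
    rw [e1]
    refine le_trans ?_ (hkey C' (-m) x (Ioc 0 x) measurableSet_Ioc hC' fun t ht => ?_)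
    · gcongr
      refine (enorm_integral_le_lintegral_enorm _).trans (setLIntegral_mono' measurableSet_Ioc fun t ht => ?_)
      rw [neg_neg]
      exact hmulb _ _ _ t (by positivity) (hgr t ht.1.le).1 (hgr t ht.1.le).2
    · rw [← Real.exp_add, abs_of_nonneg (by linarith [ht.2])]
      congr 1; ring
  have hfinal : ∀ (a a' : ℂ) (x : ℝ), 0 < x → ‖a'‖ ≤ C' * Real.exp (m * x) →
      ‖a‖ ≤ C * Real.exp (-m * x) → ‖δ x * a' - η x * a‖ₑ ≤ ENNReal.ofReal (2 * (C * C')) * I x := by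
    intro a a' x hx h1 h2
    have h1' : ‖a'‖ₑ ≤ ENNReal.ofReal C' * ENNReal.ofReal (Real.exp (m * x)) := by
      rw [← ENNReal.ofReal_mul hC', ← ofReal_norm]; exact ENNReal.ofReal_le_ofReal h1
    have h2' : ‖a‖ₑ ≤ ENNReal.ofReal C * ENNReal.ofReal (Real.exp (-m * x)) := by
      rw [← ENNReal.ofReal_mul hC, ← ofReal_norm]; exact ENNReal.ofReal_le_ofReal h2
    calc _ ≤ ‖δ x‖ₑ * ‖a'‖ₑ + ‖η x‖ₑ * ‖a‖ₑ := by
          refine enorm_sub_le.trans ?_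
          rw [enorm_mul, enorm_mul]
      _ ≤ ‖δ x‖ₑ * (ENNReal.ofReal C' * ENNReal.ofReal (Real.exp (m * x))) +
          ‖η x‖ₑ * (ENNReal.ofReal C * ENNReal.ofReal (Real.exp (-m * x))) := by gcongr
      _ = ENNReal.ofReal C' * (ENNReal.ofReal (Real.exp (m * x)) * ‖δ x‖ₑ) +
          ENNReal.ofReal C * (ENNReal.ofReal (Real.exp (-m * x)) * ‖η x‖ₑ) := by ring
      _ ≤ ENNReal.ofReal C' * (ENNReal.ofReal C * I x) +
          ENNReal.ofReal C * (ENNReal.ofReal C' * I x) := by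
          exact add_le_add (mul_le_mul' le_rfl (hδb x hx)) (mul_le_mul' le_rfl (hηb x hx))
      _ = _ := by
          rw [ENNReal.ofReal_mul (by norm_num), ENNReal.ofReal_mul hC, ENNReal.ofReal_ofNat]
          ring
  refine ⟨memLp_of_le_conv_exp hm measurableSet_Ioi hP.continuous.aestronglyMeasurable hGm hG2
    (C := 2 * (C * C')) fun x hx => ?_,
    memLp_of_le_conv_exp hm measurableSet_Ioi hQ.continuous.aestronglyMeasurable hGm hG2
    (C := 2 * (C * C')) fun x hx => ?_⟩
  · rw [hPe]
    exact hfinal _ _ x hx (hgr x (le_of_lt hx)).1 (hp x (le_of_lt hx))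
  · rw [hQe]
    exact hfinal _ _ x hx (hgr x (le_of_lt hx)).2 (hq x (le_of_lt hx))

end HalfLine

/-! ### The inhomogeneous system on both half-lines. -/

section LineSystem

variable {κ : ℝ → ℝ} {b c : ℂ}

/-- Duhamel's formula: the inhomogeneous system has a solution vanishing at the origin. -/
theorem exists_inhomogeneous_sol (hκ : Continuous κ) {L : ℝ} (hL : ∀ x, |κ x| ≤ L) (b c : ℂ)
    {g₁ g₂ : ℝ → ℂ} (h₁ : LocallyIntegrable g₁) (h₂ : LocallyIntegrable g₂) :
    ∃ P Q : ℝ → ℂ, IsPrim P (fun x => κ x * P x + b * Q x + g₁ x) ∧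
      IsPrim Q (fun x => c * P x - κ x * Q x + g₂ x) ∧ P 0 = 0 ∧ Q 0 = 0 := by
  obtain ⟨p, q, h, hp, hq⟩ := exists_sol hκ hL b c 1 0
  obtain ⟨p', q', h', hp', hq'⟩ := exists_sol hκ hL b c 0 1
  have hW : ∀ x, p x * q' x - q x * p' x = 1 := fun x => by
    rw [h.wronskian h' x, hp, hq, hp', hq']; ring
  have hli : ∀ f g : ℝ → ℂ, Continuous f → LocallyIntegrable g →
      LocallyIntegrable fun x => f x * g x := by
    intro f g hf hg
    rw [← locallyIntegrableOn_univ]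
    exact (hg.locallyIntegrableOn _).continuousOn_mul hf.continuousOn isOpen_univ.isLocallyClosed
  set d : ℝ → ℂ := fun x => p x * g₂ x - q x * g₁ x with hd
  set e : ℝ → ℂ := fun x => p' x * g₂ x - q' x * g₁ x with he
  have hdl : LocallyIntegrable d := (hli _ _ h.continuous_fst h₂).sub (hli _ _ h.continuous_snd h₁)
  have hel : LocallyIntegrable e :=
    (hli _ _ h'.continuous_fst h₂).sub (hli _ _ h'.continuous_snd h₁)
  have hδ : IsPrim (fun x => ∫ t in (0 : ℝ)..x, d t) d := ⟨hdl, fun x => by simp⟩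
  have hη : IsPrim (fun x => ∫ t in (0 : ℝ)..x, e t) e := ⟨hel, fun x => by simp⟩
  refine ⟨_, _, ((hδ.mul (h'.isPrim_fst hκ)).sub (hη.mul (h.isPrim_fst hκ))).congr
    (ae_of_all _ fun x => ?_), ((hδ.mul (h'.isPrim_snd hκ)).sub (hη.mul (h.isPrim_snd hκ))).congr
    (ae_of_all _ fun x => ?_), by simp, by simp⟩
  · simp only [hd, he]
    linear_combination (g₁ x) * hW x
  · simp only [hd, he]
    linear_combination (g₂ x) * hW x

/-- The pair `p, q` is the decaying solution. It depends only on the system, so a single linear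
condition on the source controls square integrability at `+∞`. -/
theorem exists_orthogonality_Ioi (hκ : Continuous κ) {L : ℝ} (hL : ∀ x, |κ x| ≤ L) {κp : ℝ}
    (hi : IntegrableOn (fun x => κ x - κp) (Ici 0)) {μ : ℂ} (hμ : 0 < μ.re)
    (hμ2 : μ ^ 2 = κp ^ 2 + b * c) :
    ∃ p q : ℝ → ℂ, MemLp p 2 (volume.restrict (Ioi 0)) ∧ MemLp q 2 (volume.restrict (Ioi 0)) ∧
      ∀ P Q g₁ g₂ : ℝ → ℂ, IsPrim P (fun x => κ x * P x + b * Q x + g₁ x) →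
        IsPrim Q (fun x => c * P x - κ x * Q x + g₂ x) → P 0 = 0 → Q 0 = 0 → MemLp g₁ 2 →
        MemLp g₂ 2 → ∫ x in Ioi 0, (p x * g₂ x - q x * g₁ x) = 0 →
        MemLp P 2 (volume.restrict (Ioi 0)) ∧ MemLp Q 2 (volume.restrict (Ioi 0)) := by
  obtain ⟨p, q, h, w₁, w₂, hw, hp, hq⟩ := exists_decaying_sol hκ hi hμ hμ2
  obtain ⟨C₁, hC₁, hb₁⟩ := norm_le_exp_of_tendsto h.continuous_fst hp
  obtain ⟨C₂, hC₂, hb₂⟩ := norm_le_exp_of_tendsto h.continuous_snd hq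
  have hb₁' : ∀ x, 0 ≤ x → ‖p x‖ ≤ max C₁ C₂ * Real.exp (-μ.re * x) := fun x hx =>
    (hb₁ x hx).trans (mul_le_mul_of_nonneg_right (le_max_left _ _) (Real.exp_pos _).le)
  have hb₂' : ∀ x, 0 ≤ x → ‖q x‖ ≤ max C₁ C₂ * Real.exp (-μ.re * x) := fun x hx =>
    (hb₂ x hx).trans (mul_le_mul_of_nonneg_right (le_max_right _ _) (Real.exp_pos _).le)
  have hne : p 0 ≠ 0 ∨ q 0 ≠ 0 := by
    by_contra hcon
    push Not at hcon
    have hz := fun x => h.eq_zero hκ hL hcon.1 hcon.2 x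
    have z1 : w₁ = 0 := tendsto_nhds_unique hp (by simp [(hz _).1])
    have z2 : w₂ = 0 := tendsto_nhds_unique hq (by simp [(hz _).2])
    simp [z1, z2] at hw
  refine ⟨p, q, memLp_Ioi_of_exp_bound h.continuous_fst.aestronglyMeasurable hμ hb₁,
    memLp_Ioi_of_exp_bound h.continuous_snd.aestronglyMeasurable hμ hb₂, ?_⟩
  intro P Q g₁ g₂ hP hQ hP0 hQ0 hg₁ hg₂ ho
  exact memLp_Ioi_of_orthogonal hκ hL hμ h hne hb₁' hb₂'
    (fun p q h => h.growth hκ hi hμ hμ2) hP hQ hP0 hQ0 hg₁ hg₂ ho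

theorem measurePreserving_neg_Iio : MeasurePreserving (fun x : ℝ => -x)
    (volume.restrict (Iio 0)) (volume.restrict (Ioi 0)) := by
  have := (Measure.measurePreserving_neg (volume : Measure ℝ)).restrict_preimage
    (measurableSet_Ioi (a := (0 : ℝ)))
  convert this using 2
  ext x; simp

theorem integrableOn_reflect {κm : ℝ} (hi : IntegrableOn (fun x => κ x - κm) (Iic 0)) :
    IntegrableOn (fun x => -κ (-x) - -κm) (Ici 0) := by
  have h1 := hi.comp_neg.neg
  rw [Set.neg_Iic, neg_zero] at h1
  refine h1.congr (ae_of_all _ fun x => ?_)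
  simp only [Pi.neg_apply]
  ring

/-- The reflection `x ↦ -x` replaces `κ` by `-κ(-x)` and `b, c` by `-b, -c`, leaving `κm² + b c`
unchanged, so the result at `+∞` applies. -/
theorem exists_orthogonality_Iio (hκ : Continuous κ) {L : ℝ} (hL : ∀ x, |κ x| ≤ L) {κm : ℝ}
    (hi : IntegrableOn (fun x => κ x - κm) (Iic 0)) {μ : ℂ} (hμ : 0 < μ.re)
    (hμ2 : μ ^ 2 = κm ^ 2 + b * c) :
    ∃ p q : ℝ → ℂ, MemLp p 2 (volume.restrict (Iio 0)) ∧ MemLp q 2 (volume.restrict (Iio 0)) ∧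
      ∀ P Q g₁ g₂ : ℝ → ℂ, IsPrim P (fun x => κ x * P x + b * Q x + g₁ x) →
        IsPrim Q (fun x => c * P x - κ x * Q x + g₂ x) → P 0 = 0 → Q 0 = 0 → MemLp g₁ 2 →
        MemLp g₂ 2 → ∫ x in Iio 0, (p x * g₂ x - q x * g₁ x) = 0 →
        MemLp P 2 (volume.restrict (Iio 0)) ∧ MemLp Q 2 (volume.restrict (Iio 0)) := by
  have hi' := integrableOn_reflect hi
  obtain ⟨p, q, hp, hq, h⟩ := exists_orthogonality_Ioi (κ := fun x => -κ (-x)) (b := -b) (c := -c)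
    (by fun_prop) (L := L) (fun x => by rw [abs_neg]; exact hL _) hi' hμ
    (by rw [hμ2]; push_cast; ring)
  refine ⟨fun x => p (-x), fun x => q (-x), hp.comp_measurePreserving measurePreserving_neg_Iio,
    hq.comp_measurePreserving measurePreserving_neg_Iio, ?_⟩
  intro P Q g₁ g₂ hP hQ hP0 hQ0 hg₁ hg₂ ho
  have hn := Measure.measurePreserving_neg (volume : Measure ℝ)
  obtain ⟨r1, r2⟩ := h (fun x => P (-x)) (fun x => Q (-x)) (fun x => -g₁ (-x)) (fun x => -g₂ (-x))
    (hP.comp_neg.congr (ae_of_all _ fun x => by push_cast; ring))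
    (hQ.comp_neg.congr (ae_of_all _ fun x => by push_cast; ring)) (by simpa using hP0)
    (by simpa using hQ0) (hg₁.comp_measurePreserving hn).neg (hg₂.comp_measurePreserving hn).neg
    (by
      have e := integral_comp_neg_Ioi 0 fun x => p (-x) * g₂ x - q (-x) * g₁ x
      rw [neg_zero, integral_Iic_eq_integral_Iio, ho] at e
      simp only [neg_neg] at e
      rw [← neg_eq_zero, ← integral_neg] at e
      rw [← e]
      refine integral_congr_ae (ae_of_all _ fun x => ?_)
      simp only
      ring)
  have e1 := r1.comp_measurePreserving measurePreserving_neg_Iio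
  have e2 := r2.comp_measurePreserving measurePreserving_neg_Iio
  simp only [Function.comp_def, neg_neg] at e1 e2
  exact ⟨e1, e2⟩

theorem memLp_of_Iio_Ioi {E : Type*} [NormedAddCommGroup E] {f : ℝ → E}
    (h1 : MemLp f 2 (volume.restrict (Iio 0))) (h2 : MemLp f 2 (volume.restrict (Ioi 0))) :
    MemLp f 2 := by
  have e1 := (memLp_indicator_iff_restrict measurableSet_Iio).mpr h1
  have e2 := (memLp_indicator_iff_restrict measurableSet_Ioi).mpr h2
  refine (memLp_congr_ae ?_).mp (e1.add e2)
  have h0 : ∀ᵐ x : ℝ, x ≠ 0 := by simp [ae_iff]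
  filter_upwards [h0] with x hx
  rcases lt_or_gt_of_ne hx with h | h
  · simp [h, h.le]
  · have h : 0 < x := h
    simp [h, h.le]

end LineSystem

/-! ### The Dirac operator as a first-order system. -/

section Operator

/-- The spinor field with components `P` and `Q`. -/
def spinor (P Q : ℝ → ℂ) (x : ℝ) : Spinor := WithLp.toLp 2 ![P x, Q x]

theorem spinor_eq (P Q : ℝ → ℂ) (x : ℝ) :
    spinor P Q x = P x • EuclideanSpace.single 0 1 + Q x • EuclideanSpace.single 1 1 := by
  ext i
  fin_cases i <;> simp [spinor]

theorem eq_spinor (u : ℝ → Spinor) : u = spinor (fun x => u x 0) (fun x => u x 1) := by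
  ext x i
  fin_cases i <;> simp [spinor]

theorem isPrim_spinor {P Q p q : ℝ → ℂ} (hP : IsPrim P p) (hQ : IsPrim Q q) :
    IsPrim (spinor P Q) (spinor p q) := by
  have h := (hP.clm_comp ((ContinuousLinearMap.toSpanSingleton ℂ
    (EuclideanSpace.single 0 1 : Spinor)).restrictScalars ℝ)).add
    (hQ.clm_comp ((ContinuousLinearMap.toSpanSingleton ℂ
    (EuclideanSpace.single 1 1 : Spinor)).restrictScalars ℝ))
  simp only [ContinuousLinearMap.coe_restrictScalars', ContinuousLinearMap.toSpanSingleton_apply,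
    ← spinor_eq] at h
  exact h

theorem IsPrim.apply {U u : ℝ → Spinor} (h : IsPrim U u) (i : Fin 2) :
    IsPrim (fun x => U x i) (fun x => u x i) :=
  h.clm_comp ((EuclideanSpace.proj i : Spinor →L[ℂ] ℂ).restrictScalars ℝ)

theorem memLp_apply {f : ℝ → Spinor} {μ : Measure ℝ} (h : MemLp f 2 μ) (i : Fin 2) :
    MemLp (fun x => f x i) 2 μ :=
  (EuclideanSpace.proj i : Spinor →L[ℂ] ℂ).comp_memLp' h

theorem memLp_spinor {P Q : ℝ → ℂ} {μ : Measure ℝ} (hP : MemLp P 2 μ) (hQ : MemLp Q 2 μ) :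
    MemLp (spinor P Q) 2 μ := by
  have h := ((ContinuousLinearMap.toSpanSingleton ℂ
    (EuclideanSpace.single 0 1 : Spinor)).comp_memLp' hP).add
    ((ContinuousLinearMap.toSpanSingleton ℂ (EuclideanSpace.single 1 1 : Spinor)).comp_memLp' hQ)
  refine (memLp_congr_ae (ae_of_all _ fun x => ?_)).mp h
  simp [spinor_eq]

theorem diracSymbol_zero (k : ℝ) (w u : Spinor) :
    diracSymbol k w u 0 = -(3 / 2) * Complex.I * (w 1 + k * u 1) := by
  simp [diracSymbol, pauli1, pauli2, Matrix.toLpLin_apply, Matrix.vecHead, Matrix.vecTail]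
  ring

theorem diracSymbol_one (k : ℝ) (w u : Spinor) :
    diracSymbol k w u 1 = -(3 / 2) * Complex.I * (w 0 - k * u 0) := by
  simp [diracSymbol, pauli1, pauli2, Matrix.toLpLin_apply, Matrix.vecHead, Matrix.vecTail]
  ring

variable {κ : ℝ → ℝ}

/-- Both Pauli matrices swap the components, so solving for the derivative keeps `κ` diagonal and
exchanges the components of the source. -/
theorem exists_isPrim_of_mem_diracGraph {u v : L2} (h : (u, v) ∈ diracGraph κ) :
    ∃ P Q : ℝ → ℂ, u =ᵐ[volume] spinor P Q ∧
      IsPrim P (fun x => κ x * P x + 2 / 3 * Complex.I * v x 1) ∧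
      IsPrim Q (fun x => -κ x * Q x + 2 / 3 * Complex.I * v x 0) := by
  obtain ⟨w, hw, hv⟩ := h
  obtain ⟨U, hU, huU⟩ := exists_isPrim hw
  simp only at hv huU
  refine ⟨fun x => U x 0, fun x => U x 1, by rw [← eq_spinor]; exact huU,
    (hU.apply 0).congr ?_, (hU.apply 1).congr ?_⟩
  · filter_upwards [hv, huU] with x hx hx'
    rw [hx, diracSymbol_one, hx']
    linear_combination (w x 0 - κ x * U x 0) * Complex.I_sq
  · filter_upwards [hv, huU] with x hx hx'
    rw [hx, diracSymbol_zero, hx']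
    linear_combination (w x 1 + κ x * U x 1) * Complex.I_sq

theorem memLp_mul_bdd (hκ : Continuous κ) {L : ℝ} (hL : ∀ x, |κ x| ≤ L) {P : ℝ → ℂ}
    (hP : MemLp P 2) : MemLp (fun x => κ x * P x) 2 := by
  refine MemLp.of_le_mul (c := L) hP
    ((Complex.continuous_ofReal.comp hκ).aestronglyMeasurable.mul hP.1) (ae_of_all _ fun x => ?_)
  rw [norm_mul, Complex.norm_real]
  exact mul_le_mul_of_nonneg_right (hL x) (norm_nonneg _)

/-- Boundedness of `κ` makes the right-hand sides square integrable, so they are the `L²` derivative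
of `u`. -/
theorem mem_diracGraph_of_isPrim (hκ : Continuous κ) {L : ℝ} (hL : ∀ x, |κ x| ≤ L) {u v : L2}
    {P Q : ℝ → ℂ} (hu : u =ᵐ[volume] spinor P Q)
    (hP : IsPrim P (fun x => κ x * P x + 2 / 3 * Complex.I * v x 1))
    (hQ : IsPrim Q (fun x => -κ x * Q x + 2 / 3 * Complex.I * v x 0)) :
    (u, v) ∈ diracGraph κ := by
  have hU : MemLp (spinor P Q) 2 := (memLp_congr_ae hu).mp (Lp.memLp u)
  have hPm : MemLp P 2 := by simpa [spinor] using memLp_apply hU 0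
  have hQm : MemLp Q 2 := by simpa [spinor] using memLp_apply hU 1
  have hwm := memLp_spinor
    ((memLp_mul_bdd hκ hL hPm).add ((memLp_apply (Lp.memLp v) 1).const_mul (2 / 3 * Complex.I)))
    ((memLp_mul_bdd (κ := fun x => -κ x) hκ.neg (fun x => by rw [abs_neg]; exact hL x) hQm).add
      ((memLp_apply (Lp.memLp v) 0).const_mul (2 / 3 * Complex.I)))
  refine ⟨hwm.toLp _, hasL2Deriv_of_isPrim ((isPrim_spinor hP hQ).congr ?_) hu, ?_⟩
  · filter_upwards [hwm.coeFn_toLp] with x hx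
    rw [hx]
    simp [spinor]
  · filter_upwards [hwm.coeFn_toLp, hu] with x hx hx'
    rw [hx]
    change v x = diracSymbol (κ x) _ (u x)
    rw [hx']
    ext i
    fin_cases i
    · simp only [Fin.zero_eta, diracSymbol_zero]
      simp [spinor]
      linear_combination v x 0 * Complex.I_sq
    · simp only [Fin.mk_one, diracSymbol_one]
      simp [spinor]
      linear_combination v x 1 * Complex.I_sq

theorem dirac_apply_eq_iff {u : (dirac κ).domain} {v : L2} :
    dirac κ u = v ↔ ((u : L2), v) ∈ diracGraph κ := by
  rw [← dirac_graph, LinearPMap.mem_graph_iff]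
  constructor
  · rintro rfl
    exact ⟨u, rfl, rfl⟩
  · rintro ⟨y, hy, hy'⟩
    rw [← show y = u from Subtype.ext hy]
    exact hy'

theorem exists_dirac_apply_eq {u v : L2} (h : (u, v) ∈ diracGraph κ) :
    ∃ u' : (dirac κ).domain, (u' : L2) = u ∧ dirac κ u' = v := by
  rw [← dirac_graph, LinearPMap.mem_graph_iff] at h
  exact h

end Operator

/-! ### Eigenspaces have dimension at most one. -/

section Kernel

variable {κ : ℝ → ℝ} {b c : ℂ}

/-- Two solutions with vanishing Wronskian are proportional. -/
theorem Sol.exists_eq_mul_of_wronskian {L : ℝ} (hκ : Continuous κ) (hL : ∀ x, |κ x| ≤ L)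
    {p q p' q' : ℝ → ℂ} (h : Sol κ b c p q) (h' : Sol κ b c p' q')
    (h0 : p 0 ≠ 0 ∨ q 0 ≠ 0) (hW : p 0 * q' 0 - q 0 * p' 0 = 0) :
    ∃ t : ℂ, ∀ x, p' x = t * p x ∧ q' x = t * q x := by
  obtain ⟨t, ht1, ht2⟩ : ∃ t : ℂ, p' 0 = t * p 0 ∧ q' 0 = t * q 0 := by
    rcases h0 with h0 | h0
    · refine ⟨p' 0 / p 0, by field_simp, ?_⟩
      field_simp
      linear_combination hW
    · refine ⟨q' 0 / q 0, ?_, by field_simp⟩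
      field_simp
      linear_combination -hW
  refine ⟨t, fun x => ?_⟩
  have := (h'.sub_smul h t).eq_zero hκ hL (by rw [ht1, sub_self]) (by rw [ht2, sub_self]) x
  exact ⟨sub_eq_zero.mp this.1, sub_eq_zero.mp this.2⟩

/-- The Wronskian is constant and, as a combination of products of `L²` functions, integrable; a
constant integrable on the line is zero. -/
theorem Sol.exists_eq_mul {L : ℝ} (hκ : Continuous κ) (hL : ∀ x, |κ x| ≤ L)
    {p q p' q' : ℝ → ℂ} (h : Sol κ b c p q) (h' : Sol κ b c p' q') (hp : MemLp p 2)
    (hq : MemLp q 2) (hp' : MemLp p' 2) (hq' : MemLp q' 2) (h0 : p 0 ≠ 0 ∨ q 0 ≠ 0) :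
    ∃ t : ℂ, ∀ x, p' x = t * p x ∧ q' x = t * q x := by
  refine h.exists_eq_mul_of_wronskian hκ hL h' h0 ?_
  have hi : Integrable fun x => p x * q' x - q x * p' x :=
    (hp.integrable_mul hq').sub (hq.integrable_mul hp')
  simp only [h.wronskian h'] at hi
  simpa [integrable_const_iff, isFiniteMeasure_iff] using hi

/-- Solutions of `D u = z u` are represented by solutions of a first order linear system. -/
theorem exists_sol_of_dirac_eq (hκ : Continuous κ) {z : ℂ} {u : (dirac κ).domain}
    (h : dirac κ u = z • (u : L2)) :
    ∃ p q : ℝ → ℂ, (u : L2) =ᵐ[volume] spinor p q ∧ MemLp p 2 ∧ MemLp q 2 ∧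
      Sol κ (2 / 3 * Complex.I * z) (2 / 3 * Complex.I * z) p q := by
  obtain ⟨P, Q, hu, hP, hQ⟩ := exists_isPrim_of_mem_diracGraph (dirac_apply_eq_iff.mp h)
  have hU : MemLp (spinor P Q) 2 := (memLp_congr_ae hu).mp (Lp.memLp _)
  have hz := Lp.coeFn_smul z (u : L2)
  have hPc := hP.continuous
  have hQc := hQ.continuous
  have hP' : IsPrim P fun x => κ x * P x + 2 / 3 * Complex.I * z * Q x := by
    refine hP.congr ?_
    filter_upwards [hz, hu] with x hx hx'
    rw [hx, Pi.smul_apply, hx']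
    simp [spinor, mul_assoc]
  have hQ' : IsPrim Q fun x => 2 / 3 * Complex.I * z * P x - κ x * Q x := by
    refine hQ.congr ?_
    filter_upwards [hz, hu] with x hx hx'
    rw [hx, Pi.smul_apply, hx']
    simp [spinor]
    ring
  exact ⟨P, Q, hu, by simpa [spinor] using memLp_apply hU 0,
    by simpa [spinor] using memLp_apply hU 1, hP'.hasDerivAt (by fun_prop),
    hQ'.hasDerivAt (by fun_prop)⟩

theorem zero_ne_of_ne_zero {L : ℝ} (hκ : Continuous κ) (hL : ∀ x, |κ x| ≤ L) {u : L2}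
    {p q : ℝ → ℂ} (hu : u =ᵐ[volume] spinor p q) (h : Sol κ b c p q) (h0 : u ≠ 0) :
    p 0 ≠ 0 ∨ q 0 ≠ 0 := by
  by_contra hcon
  push Not at hcon
  refine h0 (Lp.ext ?_)
  filter_upwards [hu, Lp.coeFn_zero Spinor 2 (volume : Measure ℝ)] with x hx hx'
  have := h.eq_zero hκ hL hcon.1 hcon.2 x
  rw [hx, hx']
  ext i
  fin_cases i <;> simp [spinor, this.1, this.2]

theorem mem_eigenspace_iff {z : ℂ} {u : (dirac κ).domain} :
    u ∈ eigenspace (dirac κ) z ↔ dirac κ u = z • (u : L2) := by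
  rw [eigenspace, LinearMap.mem_ker, shift, LinearMap.sub_apply, sub_eq_zero]
  rfl

theorem exists_eq_smul_of_dirac_eq {L : ℝ} (hκ : Continuous κ) (hL : ∀ x, |κ x| ≤ L) {z : ℂ}
    {u v : (dirac κ).domain} (hu : dirac κ u = z • (u : L2)) (hv : dirac κ v = z • (v : L2))
    (h0 : u ≠ 0) : ∃ t : ℂ, t • u = v := by
  obtain ⟨p, q, hpq, hp, hq, h⟩ := exists_sol_of_dirac_eq hκ hu
  obtain ⟨p', q', hpq', hp', hq', h'⟩ := exists_sol_of_dirac_eq hκ hv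
  obtain ⟨t, ht⟩ := h.exists_eq_mul hκ hL h' hp hq hp' hq'
    (zero_ne_of_ne_zero hκ hL hpq h (by simpa using h0))
  refine ⟨t, Subtype.ext (Lp.ext ?_)⟩
  change ((t • (u : L2) : L2) : ℝ → Spinor) =ᵐ[volume] _
  filter_upwards [hpq, hpq', Lp.coeFn_smul t (u : L2)] with x h1 h2 h3
  rw [h3, Pi.smul_apply, h1, h2]
  ext i
  fin_cases i <;> simp [spinor, (ht x).1, (ht x).2]

theorem isSimpleEigenvalue_of_dirac_eq {L : ℝ} (hκ : Continuous κ) (hL : ∀ x, |κ x| ≤ L) {z : ℂ}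
    (h : IsEigenvalue (dirac κ) z) : IsSimpleEigenvalue (dirac κ) z := by
  obtain ⟨u, h0, hu⟩ := h
  refine (finrank_eq_one_iff_of_nonzero' (⟨u, mem_eigenspace_iff.mpr hu⟩ : eigenspace (dirac κ) z)
    (fun h => h0 (congrArg Subtype.val h))).mpr fun v => ?_
  obtain ⟨t, ht⟩ := exists_eq_smul_of_dirac_eq hκ hL hu (mem_eigenspace_iff.mp v.2) h0
  exact ⟨t, Subtype.ext ht⟩

theorem finiteDimensional_eigenspace {L : ℝ} (hκ : Continuous κ) (hL : ∀ x, |κ x| ≤ L) (z : ℂ) :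
    FiniteDimensional ℂ (eigenspace (dirac κ) z) := by
  by_cases h : IsEigenvalue (dirac κ) z
  · exact Module.finite_of_finrank_eq_succ (isSimpleEigenvalue_of_dirac_eq hκ hL h)
  · have : eigenspace (dirac κ) z = ⊥ := by
      rw [eq_bot_iff]
      intro u hu
      by_contra h0
      exact h ⟨u, h0, mem_eigenspace_iff.mp hu⟩
    rw [this]
    infer_instance

end Kernel

/-! ### Fredholm property outside the claimed essential spectrum. -/

section Fredholm

/-- Conjugating the coefficients turns the bilinear orthogonality condition into a Hilbert space
one. -/
theorem exists_inner_eq_setIntegral {p q : ℝ → ℂ} {s : Set ℝ} (hs : MeasurableSet s)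
    (hp : MemLp p 2 (volume.restrict s)) (hq : MemLp q 2 (volume.restrict s)) :
    ∃ h : L2, ∀ f : L2, inner ℂ h f = ∫ x in s, (p x * f x 0 - q x * f x 1) := by
  have hm : MemLp (s.indicator (spinor (fun x => starRingEnd ℂ (p x))
      (fun x => -starRingEnd ℂ (q x)))) 2 :=
    (memLp_indicator_iff_restrict hs).mpr (memLp_spinor hp.star hq.star.neg)
  refine ⟨hm.toLp _, fun f => ?_⟩
  rw [L2.inner_def, ← integral_indicator hs]
  refine integral_congr_ae ?_
  filter_upwards [hm.coeFn_toLp] with x hx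
  rw [hx]
  by_cases h : x ∈ s
  · simp [h, spinor, PiLp.inner_apply]
    ring
  · simp [h]

variable {κ : ℝ → ℝ}

/-- The solution with zero data at the origin is one function on the whole line, so no matching is
needed: each half-line contributes one condition. -/
theorem exists_orthogonal_le_range (hκ : Continuous κ) {L : ℝ} (hL : ∀ x, |κ x| ≤ L) {κp κm : ℝ}
    (hip : IntegrableOn (fun x => κ x - κp) (Ici 0))
    (him : IntegrableOn (fun x => κ x - κm) (Iic 0)) {z μp μm : ℂ}
    (hμp : 0 < μp.re) (hμm : 0 < μm.re) (hp2 : μp ^ 2 = κp ^ 2 - (2 / 3 * z) ^ 2)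
    (hm2 : μm ^ 2 = κm ^ 2 - (2 / 3 * z) ^ 2) :
    ∃ h₁ h₂ : L2, ∀ f : L2, inner ℂ h₁ f = 0 → inner ℂ h₂ f = 0 →
      f ∈ LinearMap.range (shift (dirac κ) z) := by
  set b : ℂ := 2 / 3 * Complex.I * z with hb
  have hbb : b * b = -(2 / 3 * z) ^ 2 := by
    rw [hb]; linear_combination (2 / 3 * z) ^ 2 * Complex.I_sq
  obtain ⟨p, q, hp, hq, ho⟩ := exists_orthogonality_Ioi (b := b) (c := b) hκ hL hip hμp
    (by rw [hp2, hbb]; ring)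
  obtain ⟨p', q', hp', hq', ho'⟩ := exists_orthogonality_Iio (b := b) (c := b) hκ hL him hμm
    (by rw [hm2, hbb]; ring)
  obtain ⟨h₁, hh₁⟩ := exists_inner_eq_setIntegral measurableSet_Ioi hp hq
  obtain ⟨h₂, hh₂⟩ := exists_inner_eq_setIntegral measurableSet_Iio hp' hq'
  refine ⟨h₁, h₂, fun f hf₁ hf₂ => ?_⟩
  rw [hh₁] at hf₁
  rw [hh₂] at hf₂
  have hg₁ : MemLp (fun x => 2 / 3 * Complex.I * f x 1) 2 :=
    (memLp_apply (Lp.memLp f) 1).const_mul _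
  have hg₂ : MemLp (fun x => 2 / 3 * Complex.I * f x 0) 2 :=
    (memLp_apply (Lp.memLp f) 0).const_mul _
  obtain ⟨P, Q, hP, hQ, hP0, hQ0⟩ := exists_inhomogeneous_sol hκ hL b b
    (hg₁.locallyIntegrable (by norm_num)) (hg₂.locallyIntegrable (by norm_num))
  have key : ∀ (p q : ℝ → ℂ) (s : Set ℝ), ∫ x in s, (p x * f x 0 - q x * f x 1) = 0 →
      ∫ x in s, (p x * (2 / 3 * Complex.I * f x 0) - q x * (2 / 3 * Complex.I * f x 1)) = 0 := by
    intro p q s h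
    rw [← mul_zero (2 / 3 * Complex.I), ← h, ← integral_const_mul]
    congr 1
    ext x
    ring
  obtain ⟨hP₁, hQ₁⟩ := ho P Q _ _ hP hQ hP0 hQ0 hg₁ hg₂ (key _ _ _ hf₁)
  obtain ⟨hP₂, hQ₂⟩ := ho' P Q _ _ hP hQ hP0 hQ0 hg₁ hg₂ (key _ _ _ hf₂)
  have hU := memLp_spinor (memLp_of_Iio_Ioi hP₂ hP₁) (memLp_of_Iio_Ioi hQ₂ hQ₁)
  set u : L2 := hU.toLp _ with hu
  have hv : ∀ᵐ x, (f + z • u : L2) x = f x + z • spinor P Q x := by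
    filter_upwards [Lp.coeFn_add f (z • u), Lp.coeFn_smul z u, hU.coeFn_toLp] with x h1 h2 h3
    rw [h1, Pi.add_apply, h2, Pi.smul_apply, h3]
  obtain ⟨u', hu', hD⟩ := exists_dirac_apply_eq (mem_diracGraph_of_isPrim (v := f + z • u) hκ hL
    hU.coeFn_toLp (hP.congr (by
      filter_upwards [hv] with x hx
      rw [hx]; simp [spinor, hb]; ring)) (hQ.congr (by
      filter_upwards [hv] with x hx
      rw [hx]; simp [spinor, hb]; ring)))
  refine ⟨u', ?_⟩
  change dirac κ u' - z • (u' : L2) = f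
  rw [hD, hu', add_sub_cancel_right]

/-- A subspace containing a closed subspace of finite codimension is itself closed and of finite
codimension. -/
theorem isFredholmAt_dirac (hκ : Continuous κ) {L : ℝ} (hL : ∀ x, |κ x| ≤ L) {κp κm : ℝ}
    (hip : IntegrableOn (fun x => κ x - κp) (Ici 0))
    (him : IntegrableOn (fun x => κ x - κm) (Iic 0)) {z μp μm : ℂ}
    (hμp : 0 < μp.re) (hμm : 0 < μm.re) (hp2 : μp ^ 2 = κp ^ 2 - (2 / 3 * z) ^ 2)
    (hm2 : μm ^ 2 = κm ^ 2 - (2 / 3 * z) ^ 2) : IsFredholmAt (dirac κ) z := by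
  obtain ⟨h₁, h₂, h⟩ := exists_orthogonal_le_range hκ hL hip him hμp hμm hp2 hm2
  set K : Submodule ℂ L2 := Submodule.span ℂ {h₁, h₂} with hK
  have hfin : FiniteDimensional ℂ K := FiniteDimensional.span_of_finite ℂ (by simp)
  have hle : Kᗮ ≤ LinearMap.range (shift (dirac κ) z) := fun f hf =>
    h f ((Submodule.mem_orthogonal _ _).mp hf _ (Submodule.subset_span (by simp)))
      ((Submodule.mem_orthogonal _ _).mp hf _ (Submodule.subset_span (by simp)))
  have hq : FiniteDimensional ℂ (L2 ⧸ Kᗮ) :=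
    Module.Finite.equiv (Submodule.quotientEquivOfIsCompl Kᗮ K
      (Submodule.isCompl_orthogonal K).symm).symm
  exact ⟨finiteDimensional_eigenspace hκ hL z,
    Submodule.isClosed_mono_of_finiteDimensional_quotient K.isClosed_orthogonal hle,
    Module.Finite.of_surjective _ (Submodule.factor_surjective hle)⟩

/-- A purely imaginary root `s` would give `(2z/3)² = k² + (Im s)²`, making `z` real with `|z| ≥
3|k|/2`. Otherwise one of `±s` has positive real part. -/
theorem exists_sq_eq_re_pos {k : ℝ} {z : ℂ} (h : ∀ E : ℝ, 3 / 2 * |k| ≤ |E| → z ≠ E) :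
    ∃ μ : ℂ, 0 < μ.re ∧ μ ^ 2 = k ^ 2 - (2 / 3 * z) ^ 2 := by
  obtain ⟨s, hs⟩ := IsAlgClosed.exists_pow_nat_eq ((k : ℂ) ^ 2 - (2 / 3 * z) ^ 2) two_pos
  rcases lt_trichotomy s.re 0 with h0 | h0 | h0
  · exact ⟨-s, by simpa using h0, by rw [neg_sq, hs]⟩
  · exfalso
    have hs' : s ^ 2 = -(s.im : ℂ) ^ 2 := by
      rw [← s.re_add_im, h0]
      simp [mul_pow]
    have hR := Real.sq_sqrt (add_nonneg (sq_nonneg k) (sq_nonneg s.im))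
    have hk : |k| ≤ √(k ^ 2 + s.im ^ 2) := Real.abs_le_sqrt (by nlinarith [sq_nonneg s.im])
    set R := √(k ^ 2 + s.im ^ 2)
    have hR' : (R : ℂ) ^ 2 = k ^ 2 + s.im ^ 2 := by exact_mod_cast hR
    have h1 : (2 / 3 * z) ^ 2 = (R : ℂ) ^ 2 := by
      linear_combination hs - hs' - hR'
    have hR0 : 0 ≤ R := (abs_nonneg k).trans hk
    rcases sq_eq_sq_iff_eq_or_eq_neg.mp h1 with h2 | h2
    · refine h (3 / 2 * R) ?_ (by push_cast; linear_combination 3 / 2 * h2)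
      rw [abs_of_nonneg (show 0 ≤ 3 / 2 * R by linarith)]
      linarith
    · refine h (-(3 / 2 * R)) ?_ (by push_cast; linear_combination 3 / 2 * h2)
      rw [abs_neg, abs_of_nonneg (show 0 ≤ 3 / 2 * R by linarith)]
      linarith
  · exact ⟨s, h0, hs⟩

theorem exists_abs_le_of_tendsto {κp κm : ℝ} (hκ : Continuous κ) (hp : Tendsto κ atTop (𝓝 κp))
    (hm : Tendsto κ atBot (𝓝 κm)) : ∃ L, ∀ x, |κ x| ≤ L := by
  obtain ⟨X, hX⟩ := mem_atTop_sets.mp (hp.abs.eventually_le_const (lt_add_one |κp|))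
  obtain ⟨Y, hY⟩ := mem_atBot_sets.mp (hm.abs.eventually_le_const (lt_add_one |κm|))
  obtain ⟨K, hK⟩ := isCompact_Icc.exists_bound_of_continuousOn (s := Icc Y X) hκ.continuousOn
  refine ⟨max K (max (|κp| + 1) (|κm| + 1)), fun x => ?_⟩
  rcases le_total X x with h | h
  · exact (hX x h).trans ((le_max_left _ _).trans (le_max_right _ _))
  rcases le_total x Y with h' | h'
  · exact (hY x h').trans ((le_max_right _ _).trans (le_max_right _ _))
  · exact (hK x ⟨h', h⟩).trans (le_max_left _ _)

end Fredholm

/-! ### Closedness of the operator and compactness of approximate kernels. -/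

section Weyl

variable {κ : ℝ → ℝ}

/-- The derivative is determined by `w = κ A u + B v`, which is continuous in `(u, v)`. The graph is
thus the coincidence set of two continuous maps into the tempered distributions. -/
theorem isClosed_diracGraph (hκ : Continuous κ) {L : ℝ} (hL : ∀ x, |κ x| ≤ L) :
    IsClosed (diracGraph κ : Set (L2 × L2)) := by
  set A : Spinor →L[ℂ] Spinor :=
    (Matrix.toEuclideanLin !![1, 0; 0, -1]).toContinuousLinearMap with hA
  set B : Spinor →L[ℂ] Spinor :=
    (Matrix.toEuclideanLin !![0, 2 / 3 * Complex.I; 2 / 3 * Complex.I, 0]).toContinuousLinearMap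
    with hB
  have hm : MemLp (fun x => (κ x : ℂ) • A) ⊤ volume := by
    refine memLp_top_of_bound (C := L * ‖A‖) ?_ (ae_of_all _ fun x => ?_)
    · exact Continuous.aestronglyMeasurable (by fun_prop)
    · rw [norm_smul, Complex.norm_real]
      exact mul_le_mul_of_nonneg_right (hL x) (norm_nonneg _)
  set M : L2 →L[ℂ] L2 := (ContinuousLinearMap.id ℂ (Spinor →L[ℂ] Spinor)).holderL volume ⊤ 2 2
    (hm.toLp _) with hM
  have hMu : ∀ u : L2, ∀ᵐ x, M u x = (κ x : ℂ) • A (u x) := fun u => by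
    filter_upwards [(ContinuousLinearMap.id ℂ (Spinor →L[ℂ] Spinor)).coeFn_holder (r := 2)
      (hm.toLp _) u, hm.coeFn_toLp] with x h1 h2
    rw [hM, ContinuousLinearMap.holderL_apply_apply, h1, h2]
    rfl
  have hBv : ∀ v : L2, ∀ᵐ x, B.compLpL 2 volume v x = B (v x) := fun v => B.coeFn_compLpL v
  have hset : (diracGraph κ : Set (L2 × L2)) =
      {p | TemperedDistribution.derivCLM Spinor (toDist p.1) =
        toDist (M p.1 + B.compLpL 2 volume p.2)} := by
    ext ⟨u, v⟩
    have hw : ∀ᵐ x, (M u + B.compLpL 2 volume v : L2) x = (κ x : ℂ) • A (u x) + B (v x) := by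
      filter_upwards [Lp.coeFn_add (M u) (B.compLpL 2 volume v), hMu u, hBv v] with x h1 h2 h3
      rw [h1, Pi.add_apply, h2, h3]
    constructor
    · rintro ⟨w, hwu, hv⟩
      suffices e : w = M u + B.compLpL 2 volume v by rw [e] at hwu; exact hwu
      refine Lp.ext ?_
      filter_upwards [hv, hw] with x h1 h2
      change v x = diracSymbol _ _ (u x) at h1
      rw [h2, h1]
      ext i
      fin_cases i
      · simp [hA, hB, Matrix.toLpLin_apply, diracSymbol_one, Matrix.vecHead,
          Matrix.vecTail]
        linear_combination (w x 0 - κ x * u x 0) * Complex.I_sq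
      · simp [hA, hB, Matrix.toLpLin_apply, diracSymbol_zero, Matrix.vecHead,
          Matrix.vecTail]
        linear_combination (w x 1 + κ x * u x 1) * Complex.I_sq
    · intro h
      refine ⟨_, h, ?_⟩
      filter_upwards [hw] with x h2
      change v x = diracSymbol _ _ (u x)
      rw [h2]
      ext i
      fin_cases i
      · simp [hA, hB, Matrix.toLpLin_apply, diracSymbol_zero, Matrix.vecHead,
          Matrix.vecTail]
        linear_combination v x 0 * Complex.I_sq
      · simp [hA, hB, Matrix.toLpLin_apply, diracSymbol_one, Matrix.vecHead,
          Matrix.vecTail]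
        linear_combination v x 1 * Complex.I_sq
  rw [hset]
  have hc : Continuous toDist := (Lp.toTemperedDistributionCLM Spinor volume 2).continuous
  exact isClosed_eq ((TemperedDistribution.derivCLM Spinor).continuous.comp
    (hc.comp continuous_fst)) (hc.comp (by fun_prop))

/-- If `T` is closed and `T - z` is Fredholm, then bounded sequences `u` with `(T - z) u → 0`
have convergent subsequences. -/
theorem IsFredholmAt.exists_subseq_tendsto {H : Type*} [NormedAddCommGroup H]
    [InnerProductSpace ℂ H] [CompleteSpace H] {T : H →ₗ.[ℂ] H} {z : ℂ} (h : IsFredholmAt T z)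
    (hT : IsClosed (T.graph : Set (H × H))) {u : ℕ → T.domain} {C : ℝ}
    (hu : ∀ n, ‖(u n : H)‖ ≤ C) (hu' : Tendsto (fun n => T (u n) - z • (u n : H)) atTop (𝓝 0)) :
    ∃ (a : H) (φ : ℕ → ℕ), StrictMono φ ∧ Tendsto (fun n => (u (φ n) : H)) atTop (𝓝 a) := by
  obtain ⟨hfin, hcl, -⟩ := h
  have := hT.completeSpace_coe
  have := hcl.completeSpace_coe
  set R := LinearMap.range (shift T z) with hR
  let S : T.graph →L[ℂ] R := ContinuousLinearMap.codRestrict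
    ((ContinuousLinearMap.snd ℂ H H - z • ContinuousLinearMap.fst ℂ H H).comp T.graph.subtypeL) R
    (by
      rintro ⟨⟨x, y⟩, hxy⟩
      obtain ⟨v, hv, hv'⟩ := (LinearPMap.mem_graph_iff T).mp hxy
      refine ⟨v, ?_⟩
      change T v - z • (v : H) = y - z • x
      simp only at hv hv'
      rw [hv, hv'])
  have hS : Function.Surjective S := by
    rintro ⟨_, v, rfl⟩
    exact ⟨⟨(v, T v), T.mem_graph v⟩, Subtype.ext rfl⟩
  -- Open mapping theorem from the graph, complete since `T` is closed, onto the closed range: `(T -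
  -- z) u n` has preimages `g n` tending to zero.
  obtain ⟨K, hK, hK'⟩ := S.exists_preimage_norm_le hS
  choose g hg hgn using fun n => hK' ⟨T (u n) - z • (u n : H), u n, rfl⟩
  have hg0 : Tendsto (fun n => ((g n : H × H)).1) atTop (𝓝 0) := by
    refine squeeze_zero_norm (a := fun n => K * ‖T (u n) - z • (u n : H)‖) (fun n => ?_) ?_
    · exact (norm_fst_le _).trans (hgn n)
    · simpa using hu'.norm.const_mul K
  obtain ⟨C', hC'⟩ := hg0.norm.bddAbove_range
  set N : Submodule ℂ H := (eigenspace T z).map T.domain.subtype with hN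
  have hNfin : FiniteDimensional ℂ N := inferInstance
  have : ProperSpace N := FiniteDimensional.proper ℂ N
  -- The corrected sequence is bounded in the finite-dimensional eigenspace, where
  -- Bolzano-Weierstrass applies.
  have hmem : ∀ n, (u n : H) - (g n : H × H).1 ∈ N := fun n => by
    obtain ⟨v, hv, hv'⟩ := (LinearPMap.mem_graph_iff T).mp (g n).2
    refine ⟨u n - v, ?_, by simp [hv]⟩
    have e : (g n : H × H).2 - z • (g n : H × H).1 = T (u n) - z • (u n : H) :=
      congrArg Subtype.val (hg n)
    rw [← hv, ← hv'] at e
    change shift T z (u n - v) = 0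
    rw [map_sub, sub_eq_zero]
    exact e.symm
  obtain ⟨a, -, φ, hφ, ha⟩ := tendsto_subseq_of_bounded
    (Metric.isBounded_closedBall (x := (0 : N)) (r := C + C'))
    (x := fun n => (⟨_, hmem n⟩ : N)) (fun n => by
      rw [mem_closedBall_zero_iff]
      exact (norm_sub_le _ _).trans (add_le_add (hu n) (hC' ⟨n, rfl⟩)))
  refine ⟨a, φ, hφ, ?_⟩
  have h1 := ((continuous_subtype_val.tendsto a).comp ha).add (hg0.comp hφ.tendsto_atTop)
  simpa [Function.comp_def] using h1

end Weyl

/-! ### Weyl sequences and the essential spectrum. -/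

section WeylSequence

theorem eLpNorm_two_le_of_support {E : Type*} [NormedAddCommGroup E] {f : ℝ → E} {c a b : ℝ}
    (hc : 0 ≤ c) (hab : a ≤ b) (hf : ∀ x, x ∉ Icc a b → f x = 0) (hb : ∀ x ∈ Icc a b, ‖f x‖ ≤ c) :
    eLpNorm f 2 volume ≤ ENNReal.ofReal (c * √(b - a)) := by
  have h : eLpNorm ((Icc a b).indicator fun _ => c) 2 volume = ENNReal.ofReal (c * √(b - a)) := by
    rw [eLpNorm_indicator_const measurableSet_Icc (by norm_num) (by norm_num), Real.volume_Icc,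
      Real.sqrt_eq_rpow, ENNReal.ofReal_mul hc, Real.enorm_of_nonneg hc,
      ENNReal.ofReal_rpow_of_nonneg (by linarith) (by norm_num)]
    norm_num
  rw [← h]
  refine eLpNorm_mono fun x => ?_
  by_cases hx : x ∈ Icc a b
  · simpa [hx, abs_of_nonneg hc] using hb x hx
  · simp [hx, hf x hx]

theorem le_eLpNorm_two {E : Type*} [NormedAddCommGroup E] {f : ℝ → E} {c a b : ℝ}
    (hc : 0 ≤ c) (hab : a ≤ b) (hb : ∀ x ∈ Icc a b, c ≤ ‖f x‖) :
    ENNReal.ofReal (c * √(b - a)) ≤ eLpNorm f 2 volume := by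
  have h : eLpNorm ((Icc a b).indicator fun _ => c) 2 volume = ENNReal.ofReal (c * √(b - a)) := by
    rw [eLpNorm_indicator_const measurableSet_Icc (by norm_num) (by norm_num), Real.volume_Icc,
      Real.sqrt_eq_rpow, ENNReal.ofReal_mul hc, Real.enorm_of_nonneg hc,
      ENNReal.ofReal_rpow_of_nonneg (by linarith) (by norm_num)]
    norm_num
  rw [← h]
  refine eLpNorm_mono fun x => ?_
  by_cases hx : x ∈ Icc a b
  · simpa [hx, abs_of_nonneg hc] using hb x hx
  · simp [hx]

variable {κ : ℝ → ℝ}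

/-- The action of `D - E` on `θ φ`, where `φ` solves the equation with coefficient `k`. -/
theorem exists_dirac_sub_smul_eq (hκ : Continuous κ) {L : ℝ} (hL : ∀ x, |κ x| ≤ L) {k : ℝ} {E : ℂ}
    {p q : ℝ → ℂ} (h : Sol (fun _ => k) (2 / 3 * Complex.I * E) (2 / 3 * Complex.I * E) p q)
    {θ θ' : ℝ → ℝ} (hθ : ∀ x, HasDerivAt θ (θ' x) x) (hθ' : Continuous θ')
    (hc : HasCompactSupport θ) :
    ∃ (u : (dirac κ).domain) (f : L2), dirac κ u - E • (u : L2) = f ∧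
      (u : L2) =ᵐ[volume] spinor (fun x => θ x * p x) (fun x => θ x * q x) ∧
      f =ᵐ[volume] spinor (fun x => -(3 / 2) * Complex.I * ((θ' x + (κ x - k) * θ x) * q x))
        (fun x => -(3 / 2) * Complex.I * ((θ' x - (κ x - k) * θ x) * p x)) := by
  have hpc := h.continuous_fst
  have hqc := h.continuous_snd
  have hθc : Continuous θ := continuous_iff_continuousAt.mpr fun x => (hθ x).continuousAt
  have hc' : HasCompactSupport θ' := by
    rw [show θ' = deriv θ from funext fun x => (hθ x).deriv.symm]
    exact hc.deriv
  have hm : ∀ g : ℝ → ℂ, Continuous g → (∀ x, θ x = 0 → θ' x = 0 → g x = 0) → MemLp g 2 := by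
    intro g hg h0
    refine hg.memLp_of_hasCompactSupport ?_
    refine (hc.union hc').of_isClosed_subset (isClosed_tsupport _) ?_
    refine closure_minimal (fun x hx => ?_) ((isClosed_tsupport _).union (isClosed_tsupport _))
    by_contra hn
    simp only [mem_union, not_or] at hn
    exact hx (h0 x (image_eq_zero_of_notMem_tsupport hn.1) (image_eq_zero_of_notMem_tsupport hn.2))
  have hU : MemLp (spinor (fun x => θ x * p x) (fun x => θ x * q x)) 2 :=
    memLp_spinor (hm _ (by fun_prop) fun x h1 h2 => by simp [h1])
      (hm _ (by fun_prop) fun x h1 h2 => by simp [h1])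
  have hF : MemLp (spinor (fun x => -(3 / 2) * Complex.I * ((θ' x + (κ x - k) * θ x) * q x))
        (fun x => -(3 / 2) * Complex.I * ((θ' x - (κ x - k) * θ x) * p x))) 2 :=
    memLp_spinor (hm _ (by fun_prop) fun x h1 h2 => by simp [h1, h2])
      (hm _ (by fun_prop) fun x h1 h2 => by simp [h1, h2])
  set F := spinor (fun x => -(3 / 2) * Complex.I * ((θ' x + (κ x - k) * θ x) * q x))
        (fun x => -(3 / 2) * Complex.I * ((θ' x - (κ x - k) * θ x) * p x)) with hFdef
  set U := spinor (fun x => θ x * p x) (fun x => θ x * q x) with hUdef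
  have hv : ∀ᵐ x, (hF.toLp _ + E • hU.toLp _ : L2) x = F x + E • U x := by
    filter_upwards [Lp.coeFn_add (hF.toLp _) (E • hU.toLp _), Lp.coeFn_smul E (hU.toLp _),
      hU.coeFn_toLp, hF.coeFn_toLp] with x h1 h2 h3 h4
    rw [h1, Pi.add_apply, h2, Pi.smul_apply, h3, h4]
  have hP : IsPrim (fun x => θ x * p x)
      (fun x => θ' x * p x + θ x * (k * p x + 2 / 3 * Complex.I * E * q x)) :=
    IsPrim.of_hasDerivAt (by fun_prop) fun x => (hθ x).ofReal_comp.fun_mul (h.fst x)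
  have hQ : IsPrim (fun x => θ x * q x)
      (fun x => θ' x * q x + θ x * (2 / 3 * Complex.I * E * p x - k * q x)) :=
    IsPrim.of_hasDerivAt (by fun_prop) fun x => (hθ x).ofReal_comp.fun_mul (h.snd x)
  obtain ⟨u, hu, hD⟩ := exists_dirac_apply_eq (mem_diracGraph_of_isPrim
    (v := hF.toLp _ + E • hU.toLp _) hκ hL hU.coeFn_toLp (hP.congr (by
      filter_upwards [hv] with x hx
      rw [hx]; simp [hFdef, hUdef, spinor]
      linear_combination (θ' x - (κ x - k) * θ x) * p x * Complex.I_sq)) (hQ.congr (by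
      filter_upwards [hv] with x hx
      rw [hx]; simp [hFdef, hUdef, spinor]
      linear_combination (θ' x + (κ x - k) * θ x) * q x * Complex.I_sq)))
  refine ⟨u, hF.toLp _, ?_, ?_, hF.coeFn_toLp⟩
  · rw [hD, hu, add_sub_cancel_right]
  · rw [hu]; exact hU.coeFn_toLp

theorem norm_spinor_le (p q : ℝ → ℂ) (x : ℝ) : ‖spinor p q x‖ ≤ ‖p x‖ + ‖q x‖ := by
  rw [spinor_eq]
  refine (norm_add_le _ _).trans (le_of_eq ?_)
  simp [norm_smul]

theorem norm_fst_le_norm_spinor (p q : ℝ → ℂ) (x : ℝ) : ‖p x‖ ≤ ‖spinor p q x‖ := by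
  simpa [spinor] using PiLp.norm_apply_le (spinor p q x) 0

/-- The amplitude `(2iE/3, iξ - k)` is an eigenvector of the constant matrix for `iξ`; the
hypothesis is the dispersion relation. -/
theorem sol_plane_wave {k E ξ : ℝ} (h : ξ ^ 2 + k ^ 2 = (2 / 3 * E) ^ 2) :
    Sol (fun _ => k) (2 / 3 * Complex.I * E) (2 / 3 * Complex.I * E)
      (fun x => 2 / 3 * Complex.I * E * Complex.exp (ξ * x * Complex.I))
      (fun x => (ξ * Complex.I - k) * Complex.exp (ξ * x * Complex.I)) := by
  have h' : (ξ : ℂ) ^ 2 + k ^ 2 = (2 / 3 * E) ^ 2 := by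
    rw [← Complex.ofReal_pow, ← Complex.ofReal_pow, ← Complex.ofReal_add, h]
    push_cast
    ring
  have hd : ∀ x : ℝ, HasDerivAt (fun x : ℝ => Complex.exp (ξ * x * Complex.I))
      (Complex.exp (ξ * x * Complex.I) * (ξ * Complex.I)) x := fun x => by
    have := (((hasDerivAt_id x).ofReal_comp.const_mul (ξ : ℂ)).mul_const Complex.I).cexp
    simpa using this
  refine ⟨fun x => ((hd x).const_mul _).congr_deriv (by ring), fun x =>
    ((hd x).const_mul _).congr_deriv ?_⟩
  linear_combination Complex.exp (ξ * x * Complex.I) * ((ξ ^ 2 - (2 / 3 * E) ^ 2) * Complex.I_sq - h')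

/-- Plane waves are cut off at scale `N` and divided by `√N`, inside a window where `|κ - k| ≤ 1/N`.
The cutoff error and the potential error are both of size `N^{-3/2}` on a set of length `4N`, so the
residual is of order `1/N`, while the `L²` norm stays comparable to one and the sup norm is of order
`1/√N`. -/
theorem exists_weyl_sequence (hκ : Continuous κ) {L : ℝ} (hL : ∀ x, |κ x| ≤ L) {k E : ℝ}
    (hE : E ≠ 0) (hk : k ^ 2 ≤ (2 / 3 * E) ^ 2)
    (hlim : ∀ R ε : ℝ, 0 < R → 0 < ε → ∃ s, ∀ x ∈ Icc (s - R) (s + R), |κ x - k| ≤ ε) :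
    ∃ C δ : ℝ, 0 < δ ∧ ∀ N : ℝ, 1 ≤ N → ∃ u : (dirac κ).domain, δ ≤ ‖(u : L2)‖ ∧
      ‖(u : L2)‖ ≤ C ∧ ‖dirac κ u - (E : ℂ) • (u : L2)‖ ≤ C / N ∧
      ∀ᵐ x, ‖(u : L2) x‖ ≤ C / √N := by
  set ξ : ℝ := √((2 / 3 * E) ^ 2 - k ^ 2) with hξ
  have hsol := sol_plane_wave (k := k) (E := E) (ξ := ξ)
    (by rw [hξ, Real.sq_sqrt (by linarith)]; ring)
  set p : ℝ → ℂ := fun x => 2 / 3 * Complex.I * E * Complex.exp (ξ * x * Complex.I) with hp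
  set q : ℝ → ℂ := fun x => (ξ * Complex.I - k) * Complex.exp (ξ * x * Complex.I) with hq
  have hexp : ∀ x : ℝ, ‖Complex.exp (ξ * x * Complex.I)‖ = 1 := fun x => by
    have := Complex.norm_exp_ofReal_mul_I (ξ * x)
    push_cast at this
    exact this
  set α : ℝ := 2 / 3 * |E| with hα
  set β : ℝ := ‖(ξ * Complex.I - k : ℂ)‖ with hβ
  have hpn : ∀ x, ‖p x‖ = α := fun x => by simp [hp, hexp, hα]
  have hqn : ∀ x, ‖q x‖ = β := fun x => by simp only [hq, norm_mul, hexp, mul_one, hβ]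
  have hα0 : 0 < α := by positivity
  have hβ0 : 0 ≤ β := norm_nonneg _
  let χ : ContDiffBump (0 : ℝ) := ⟨1, 2, by norm_num, by norm_num⟩
  have hχd : ∀ x, HasDerivAt χ (deriv χ x) x := fun x =>
    ((χ.contDiff (n := 1)).differentiable (by norm_num) x).hasDerivAt
  have hχ'c : Continuous (deriv χ) := (χ.contDiff (n := 1)).continuous_deriv le_rfl
  obtain ⟨M, hM⟩ := hχ'c.bounded_above_of_compact_support χ.hasCompactSupport.deriv
  have hM0 : 0 ≤ M := (norm_nonneg _).trans (hM 0)
  -- The first constant dominates both the residual bound `3(M+1)(α+β)` and the norm bound `2(α+β)`.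
  -- The second comes from the interval of length `2N` where the cutoff equals `1/√N`.
  refine ⟨3 * (M + 1) * (α + β) + 2 * (α + β), √2 * α, by positivity, fun N hN => ?_⟩
  have hN0 : 0 < N := by linarith
  have hsN : 0 < √N := Real.sqrt_pos.mpr hN0
  obtain ⟨s, hs⟩ := hlim (2 * N) (1 / N) (by positivity) (by positivity)
  set θ : ℝ → ℝ := fun x => χ ((x - s) / N) / √N with hθ
  set θ' : ℝ → ℝ := fun x => deriv χ ((x - s) / N) / N / √N with hθ'
  have hθd : ∀ x, HasDerivAt θ (θ' x) x := fun x => by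
    have := ((hχd ((x - s) / N)).comp x (((hasDerivAt_id x).sub_const s).div_const N)).div_const √N
    refine this.congr_deriv ?_
    simp only [hθ']
    ring
  have hsupp : ∀ x, x ∉ Icc (s - 2 * N) (s + 2 * N) → χ ((x - s) / N) = 0 := fun x hx => by
    refine χ.zero_of_le_dist ?_
    rw [Real.dist_eq, sub_zero, abs_div, abs_of_pos hN0, le_div_iff₀ hN0]
    by_contra! hlt
    rw [abs_lt] at hlt
    exact hx ⟨by simp only [χ] at hlt; linarith, by simp only [χ] at hlt; linarith⟩
  have hθs : ∀ x, x ∉ Icc (s - 2 * N) (s + 2 * N) → θ x = 0 := fun x hx => by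
    simp [hθ, hsupp x hx]
  have hθ's : ∀ x, x ∉ Icc (s - 2 * N) (s + 2 * N) → θ' x = 0 := fun x hx => by
    have : θ =ᶠ[𝓝 x] fun _ => 0 := by
      filter_upwards [isClosed_Icc.isOpen_compl.mem_nhds hx] with y hy using hθs y hy
    exact (hθd x).unique ((hasDerivAt_const x (0 : ℝ)).congr_of_eventuallyEq this)
  have hθb : ∀ x, |θ x| ≤ 1 / √N := fun x => by
    rw [hθ, abs_div, abs_of_nonneg χ.nonneg, abs_of_pos hsN]
    exact div_le_div_of_nonneg_right χ.le_one hsN.le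
  have hθ'b : ∀ x, |θ' x| ≤ M / (N * √N) := fun x => by
    rw [hθ', abs_div, abs_div, abs_of_pos hN0, abs_of_pos hsN, div_div]
    exact div_le_div_of_nonneg_right (hM _) (by positivity)
  obtain ⟨u, f, hf, hu, hfe⟩ := exists_dirac_sub_smul_eq hκ hL hsol hθd (by fun_prop)
    (HasCompactSupport.intro isCompact_Icc hθs)
  have hlen : √(s + 2 * N - (s - 2 * N)) = 2 * √N := by
    rw [show s + 2 * N - (s - 2 * N) = 2 ^ 2 * N by ring, Real.sqrt_mul (by norm_num),
      Real.sqrt_sq (by norm_num)]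
  have hub : ∀ x, ‖spinor (fun x => θ x * p x) (fun x => θ x * q x) x‖ ≤ (α + β) / √N := fun x => by
    refine (norm_spinor_le _ _ x).trans ?_
    simp only [norm_mul, Complex.norm_real, hpn, hqn, Real.norm_eq_abs, ← mul_add]
    calc |θ x| * (α + β) ≤ 1 / √N * (α + β) :=
          mul_le_mul_of_nonneg_right (hθb x) (by positivity)
      _ = _ := by ring
  have hfb : ∀ x ∈ Icc (s - 2 * N) (s + 2 * N),
      ‖spinor (fun x => -(3 / 2) * Complex.I * ((θ' x + (κ x - k) * θ x) * q x))
        (fun x => -(3 / 2) * Complex.I * ((θ' x - (κ x - k) * θ x) * p x)) x‖ ≤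
      3 / 2 * (M + 1) * (α + β) / (N * √N) := fun x hx => by
    have h1 : |(κ x - k) * θ x| ≤ 1 / (N * √N) := by
      rw [abs_mul]
      calc |κ x - k| * |θ x| ≤ 1 / N * (1 / √N) :=
            mul_le_mul (hs x hx) (hθb x) (abs_nonneg _) (by positivity)
        _ = _ := by rw [div_mul_div_comm, one_mul]
    have h2 : |θ' x + (κ x - k) * θ x| ≤ (M + 1) / (N * √N) := by
      rw [add_div]
      exact (abs_add_le _ _).trans (add_le_add (hθ'b x) h1)
    have h3 : |θ' x - (κ x - k) * θ x| ≤ (M + 1) / (N * √N) := by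
      rw [add_div]
      exact (abs_sub _ _).trans (add_le_add (hθ'b x) h1)
    refine (norm_spinor_le _ _ x).trans ?_
    have e1 : ‖-(3 / 2) * Complex.I * ((θ' x + (κ x - k) * θ x) * q x)‖ =
        3 / 2 * (|θ' x + (κ x - k) * θ x| * β) := by
      rw [norm_mul, norm_mul _ (q x), hqn, ← Real.norm_eq_abs, ← Complex.norm_real]
      simp
    have e2 : ‖-(3 / 2) * Complex.I * ((θ' x - (κ x - k) * θ x) * p x)‖ =
        3 / 2 * (|θ' x - (κ x - k) * θ x| * α) := by
      rw [norm_mul, norm_mul _ (p x), hpn, ← Real.norm_eq_abs, ← Complex.norm_real]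
      simp
    rw [e1, e2]
    have h4 := mul_le_mul_of_nonneg_right h2 hβ0
    have h5 := mul_le_mul_of_nonneg_right h3 hα0.le
    calc _ ≤ 3 / 2 * ((M + 1) / (N * √N) * β) + 3 / 2 * ((M + 1) / (N * √N) * α) := by linarith
      _ = _ := by ring
  refine ⟨u, ?_, ?_, ?_, ?_⟩
  · rw [Lp.norm_def]
    refine (ENNReal.ofReal_le_iff_le_toReal (Lp.eLpNorm_ne_top _)).mp ?_
    rw [eLpNorm_congr_ae hu]
    have hle : √2 * α = α / √N * √(s + N - (s - N)) := by
      rw [show s + N - (s - N) = 2 * N by ring, Real.sqrt_mul (by norm_num)]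
      field_simp
    rw [hle]
    refine le_eLpNorm_two (by positivity) (by linarith) fun x hx => ?_
    refine le_trans (le_of_eq ?_) (norm_fst_le_norm_spinor _ _ x)
    have h1 : χ ((x - s) / N) = 1 := by
      refine χ.one_of_mem_closedBall ?_
      rw [mem_closedBall_zero_iff, Real.norm_eq_abs, abs_div, abs_of_pos hN0, div_le_iff₀ hN0,
        abs_le]
      constructor <;> simp only [χ] <;> linarith [hx.1, hx.2]
    rw [norm_mul, hpn, Complex.norm_real, show θ x = 1 / √N by rw [← h1],
      Real.norm_of_nonneg (by positivity)]
    ring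
  · rw [Lp.norm_def]
    refine ENNReal.toReal_le_of_le_ofReal (by positivity) ?_
    rw [eLpNorm_congr_ae hu]
    refine (eLpNorm_two_le_of_support (c := (α + β) / √N) (a := s - 2 * N) (b := s + 2 * N)
      (by positivity) (by linarith) (fun x hx => ?_) (fun x _ => hub x)).trans
      (ENNReal.ofReal_le_ofReal ?_)
    · rw [spinor_eq, hθs x hx]; simp
    · rw [hlen, show (α + β) / √N * (2 * √N) = 2 * (α + β) by field_simp]
      have : 0 ≤ 3 * (M + 1) * (α + β) := by positivity
      linarith
  · rw [hf, Lp.norm_def]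
    refine ENNReal.toReal_le_of_le_ofReal (by positivity) ?_
    rw [eLpNorm_congr_ae hfe]
    refine (eLpNorm_two_le_of_support (a := s - 2 * N) (b := s + 2 * N)
      (by positivity) (by linarith) (fun x hx => ?_) hfb).trans
      (ENNReal.ofReal_le_ofReal ?_)
    · rw [spinor_eq, hθs x hx, hθ's x hx]; simp
    · rw [hlen, show 3 / 2 * (M + 1) * (α + β) / (N * √N) * (2 * √N) =
        3 * (M + 1) * (α + β) / N by field_simp]
      exact div_le_div_of_nonneg_right (by nlinarith) hN0.le
  · filter_upwards [hu] with x hx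
    rw [hx]
    refine (hub x).trans (div_le_div_of_nonneg_right ?_ hsN.le)
    nlinarith [mul_nonneg hM0 (add_nonneg hα0.le hβ0)]

/-- A convergent subsequence of the Weyl sequence would have a limit of norm at least `δ`; but the
sequence tends to zero uniformly, so the limit is zero almost everywhere. -/
theorem not_isFredholmAt_dirac (hκ : Continuous κ) {L : ℝ} (hL : ∀ x, |κ x| ≤ L) {k E : ℝ}
    (hE : E ≠ 0) (hk : k ^ 2 ≤ (2 / 3 * E) ^ 2)
    (hlim : ∀ R ε : ℝ, 0 < R → 0 < ε → ∃ s, ∀ x ∈ Icc (s - R) (s + R), |κ x - k| ≤ ε) :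
    ¬ IsFredholmAt (dirac κ) E := by
  intro hF
  obtain ⟨C, δ, hδ, h⟩ := exists_weyl_sequence hκ hL hE hk hlim
  choose u hu1 hu2 hu3 hu4 using fun n : ℕ => h (n + 1) (by linarith [n.cast_nonneg (α := ℝ)])
  have hN : Tendsto (fun n : ℕ => (n + 1 : ℝ)) atTop atTop :=
    tendsto_natCast_atTop_atTop.atTop_add tendsto_const_nhds
  obtain ⟨a, φ, hφ, ha⟩ := hF.exists_subseq_tendsto
    (by rw [dirac_graph]; exact isClosed_diracGraph hκ hL) hu2
    (squeeze_zero_norm hu3 (tendsto_const_nhds.div_atTop hN))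
  obtain ⟨ns, hns, hae⟩ := (tendstoInMeasure_of_tendsto_Lp ha).exists_seq_tendsto_ae
  have ha0 : a = 0 := by
    refine Lp.ext ?_
    filter_upwards [hae, ae_all_iff.mpr hu4, Lp.coeFn_zero Spinor 2 (volume : Measure ℝ)]
      with x h1 h2 h3
    rw [h3]
    refine tendsto_nhds_unique h1 (squeeze_zero_norm (fun n => h2 (φ (ns n))) ?_)
    exact ((tendsto_const_nhds.div_atTop (Real.tendsto_sqrt_atTop.comp hN)).comp
      hφ.tendsto_atTop).comp hns.tendsto_atTop
  have := ge_of_tendsto' ha.norm fun n => hu1 (φ n)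
  rw [ha0, norm_zero] at this
  linarith

theorem essentialSpectrum_dirac {κp κm : ℝ} (hκ : Continuous κ)
    (hp : Tendsto κ atTop (𝓝 κp)) (hm : Tendsto κ atBot (𝓝 κm)) (hp0 : κp ≠ 0) (hm0 : κm ≠ 0)
    (hip : IntegrableOn (fun x => κ x - κp) (Ici 0))
    (him : IntegrableOn (fun x => κ x - κm) (Iic 0)) {a : ℝ} (ha : a = 3 / 2 * min |κp| |κm|) :
    essentialSpectrum (dirac κ) = Complex.ofReal '' (Iic (-a) ∪ Ici a) := by
  obtain ⟨L, hL⟩ := exists_abs_le_of_tendsto hκ hp hm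
  have hlp : ∀ R ε : ℝ, 0 < R → 0 < ε → ∃ s, ∀ x ∈ Icc (s - R) (s + R), |κ x - κp| ≤ ε := by
    intro R ε _ hε
    obtain ⟨X, hX⟩ := mem_atTop_sets.mp (hp (Metric.closedBall_mem_nhds κp hε))
    exact ⟨X + R, fun x hx => hX x (by linarith [hx.1])⟩
  have hlm : ∀ R ε : ℝ, 0 < R → 0 < ε → ∃ s, ∀ x ∈ Icc (s - R) (s + R), |κ x - κm| ≤ ε := by
    intro R ε _ hε
    obtain ⟨X, hX⟩ := mem_atBot_sets.mp (hm (Metric.closedBall_mem_nhds κm hε))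
    exact ⟨X - R, fun x hx => hX x (by linarith [hx.2])⟩
  have ha0 : 0 < a := by
    rw [ha]
    have := lt_min (abs_pos.mpr hp0) (abs_pos.mpr hm0)
    positivity
  have hmem : ∀ E : ℝ, E ∈ Iic (-a) ∪ Ici a ↔ a ≤ |E| := fun E => by
    rw [le_abs, mem_union, mem_Iic, mem_Ici, le_neg, or_comm]
  ext z
  constructor
  · intro hz
    by_contra hn
    have hne : ∀ E : ℝ, a ≤ |E| → z ≠ E := fun E hE h => hn ⟨E, (hmem E).mpr hE, h.symm⟩
    obtain ⟨μp, hμp, hp2⟩ := exists_sq_eq_re_pos (k := κp) (z := z) fun E hE =>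
      hne E (by linarith [min_le_left |κp| |κm|])
    obtain ⟨μm, hμm, hm2⟩ := exists_sq_eq_re_pos (k := κm) (z := z) fun E hE =>
      hne E (by linarith [min_le_right |κp| |κm|])
    exact hz (isFredholmAt_dirac hκ hL hip him hμp hμm hp2 hm2)
  · rintro ⟨E, hE, rfl⟩
    rw [hmem] at hE
    have hE0 : E ≠ 0 := by
      rintro rfl
      rw [abs_zero] at hE
      linarith
    -- The end attaining the minimum supports propagating waves at every energy with `|E| ≥ a`.
    rcases min_choice |κp| |κm| with h | h
    · refine not_isFredholmAt_dirac hκ hL hE0 (sq_le_sq.mpr ?_) hlp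
      rw [abs_mul, abs_of_pos (by norm_num : (0 : ℝ) < 2 / 3)]
      linarith
    · refine not_isFredholmAt_dirac hκ hL hE0 (sq_le_sq.mpr ?_) hlm
      rw [abs_mul, abs_of_pos (by norm_num : (0 : ℝ) < 2 / 3)]
      linarith

end WeylSequence

/-! ### Exponential asymptotics of real solutions and their derivatives. -/

section Asymptotics

/-- By the mean value theorem on unit intervals, `F'` takes the values `F (x + 1) - F x → 0` at
points going to infinity. -/
theorem eq_zero_of_tendsto_deriv {F F' : ℝ → ℝ} {w l : ℝ} (hd : ∀ x, HasDerivAt F (F' x) x)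
    (hF : Tendsto F atTop (𝓝 w)) (hF' : Tendsto F' atTop (𝓝 l)) : l = 0 := by
  have hm : ∀ x, ∃ c ∈ Ioo x (x + 1), F' c = F (x + 1) - F x := fun x => by
    obtain ⟨c, hc, h⟩ := exists_hasDerivAt_eq_slope F F' (lt_add_one x)
      (fun y _ => (hd y).continuousAt.continuousWithinAt) fun y _ => hd y
    exact ⟨c, hc, by rw [h, add_sub_cancel_left, div_one]⟩
  choose c hc hc' using hm
  have h1 : Tendsto c atTop atTop := tendsto_atTop_mono (fun x => (hc x).1.le) tendsto_id
  have h2 := (hF.comp (tendsto_atTop_add_const_right _ 1 tendsto_id)).sub hF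
  rw [sub_self] at h2
  refine tendsto_nhds_unique (hF'.comp h1) (h2.congr fun x => ?_)
  simp [hc']

/-- If `f` converges at `+∞` and `f''` is bounded, then `f'` tends to zero at `+∞`. -/
theorem tendsto_deriv_zero_of_bounded {f f' f'' : ℝ → ℝ} {l M : ℝ}
    (hd : ∀ x, HasDerivAt f (f' x) x) (hd' : ∀ x, HasDerivAt f' (f'' x) x)
    (hM : ∀ x, |f'' x| ≤ M) (hf : Tendsto f atTop (𝓝 l)) : Tendsto f' atTop (𝓝 0) := by
  rw [Metric.tendsto_atTop]
  intro ε hε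
  have hM0 : 0 ≤ M := (abs_nonneg _).trans (hM 0)
  set h : ℝ := ε / (2 * (M + 1)) with hh
  have hh0 : 0 < h := by positivity
  have hMh : M * h < ε / 2 := by
    rw [hh, mul_div_assoc', div_lt_div_iff₀ (by positivity) (by norm_num)]
    nlinarith
  have h2 := (hf.comp (tendsto_atTop_add_const_right _ h tendsto_id)).sub hf
  rw [sub_self, Metric.tendsto_atTop] at h2
  obtain ⟨X, hX⟩ := h2 (h * (ε / 2)) (by positivity)
  refine ⟨X, fun x hx => ?_⟩
  have h3 := hX x hx
  rw [Real.dist_eq, sub_zero] at h3 ⊢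
  obtain ⟨c, hc, hc'⟩ := exists_hasDerivAt_eq_slope f f' (lt_add_of_pos_right x hh0)
      (fun y _ => (hd y).continuousAt.continuousWithinAt) fun y _ => hd y
  have h4 : |f' c| < ε / 2 := by
    rw [hc', add_sub_cancel_left, abs_div, abs_of_pos hh0, div_lt_iff₀ hh0]
    simpa [mul_comm] using h3
  have h5 : |f' x - f' c| ≤ M * h := by
    have := convex_univ.norm_image_sub_le_of_norm_hasDerivWithin_le
      (fun y _ => (hd' y).hasDerivWithinAt) (fun y _ => hM y) (mem_univ c) (mem_univ x)
    refine this.trans (mul_le_mul_of_nonneg_left ?_ hM0)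
    rw [Real.norm_eq_abs, abs_le]
    constructor <;> linarith [hc.1, hc.2]
  calc |f' x| = |(f' x - f' c) + f' c| := by rw [sub_add_cancel]
    _ ≤ |f' x - f' c| + |f' c| := abs_add_le _ _
    _ < ε := by linarith

theorem hasDerivAt_iteratedDeriv {E : Type*} [NormedAddCommGroup E] [NormedSpace ℝ E] {f : ℝ → E}
    (hf : ContDiff ℝ ∞ f) (j : ℕ) (x : ℝ) :
    HasDerivAt (iteratedDeriv j f) (iteratedDeriv (j + 1) f x) x := by
  rw [iteratedDeriv_succ]
  exact (hf.differentiable_iteratedDeriv j (by exact_mod_cast WithTop.coe_lt_top j) x).hasDerivAt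

variable {κ : ℝ → ℝ}

/-- Induction on the order: a convergent function with bounded second derivative has derivative
tending to zero, so all limits beyond order zero vanish. -/
theorem IsCbInfty.tendsto_iteratedDeriv (h : IsCbInfty κ) {k : ℝ} (hk : Tendsto κ atTop (𝓝 k))
    (j : ℕ) : ∃ l, Tendsto (iteratedDeriv j κ) atTop (𝓝 l) := by
  induction j with
  | zero => exact ⟨k, by simpa using hk⟩
  | succ j ih =>
    obtain ⟨l, hl⟩ := ih
    obtain ⟨M, hM⟩ := h.2 (j + 1 + 1)
    exact ⟨0, tendsto_deriv_zero_of_bounded (hasDerivAt_iteratedDeriv h.1 j)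
      (hasDerivAt_iteratedDeriv h.1 (j + 1)) hM hl⟩

theorem IsCbInfty.reflect (h : IsCbInfty κ) : IsCbInfty fun x => -κ (-x) := by
  refine ⟨(h.1.comp contDiff_neg).neg, fun k => ?_⟩
  obtain ⟨C, hC⟩ := h.2 k
  refine ⟨C, fun x => ?_⟩
  rw [iteratedDeriv_fun_neg, iteratedDeriv_comp_neg, abs_neg, smul_eq_mul, abs_mul, abs_pow,
    abs_neg, abs_one, one_pow, one_mul]
  exact hC _

/-- Solutions of the real system `p' = κ p + ε q`, `q' = -ε p - κ q`. -/
structure RealSol (κ : ℝ → ℝ) (ε : ℝ) (p q : ℝ → ℝ) : Prop where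
  fst : ∀ x, HasDerivAt p (κ x * p x + ε * q x) x
  snd : ∀ x, HasDerivAt q (-ε * p x - κ x * q x) x

namespace RealSol

variable {ε : ℝ} {p q : ℝ → ℝ}

theorem toSol (h : RealSol κ ε p q) : Sol κ ε (-ε) (fun x => (p x : ℂ)) fun x => (q x : ℂ) :=
  ⟨fun x => (h.fst x).ofReal_comp.congr_deriv (by push_cast; ring),
    fun x => (h.snd x).ofReal_comp.congr_deriv (by push_cast; ring)⟩

theorem continuous_fst (h : RealSol κ ε p q) : Continuous p :=
  continuous_iff_continuousAt.mpr fun x => (h.fst x).continuousAt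

theorem continuous_snd (h : RealSol κ ε p q) : Continuous q :=
  continuous_iff_continuousAt.mpr fun x => (h.snd x).continuousAt

theorem reflect (h : RealSol κ ε p q) :
    RealSol (fun x => -κ (-x)) (-ε) (fun x => p (-x)) fun x => q (-x) := by
  refine ⟨fun x => ?_, fun x => ?_⟩
  · exact ((h.fst (-x)).comp x (hasDerivAt_neg x)).congr_deriv (by ring)
  · exact ((h.snd (-x)).comp x (hasDerivAt_neg x)).congr_deriv (by ring)

theorem contDiff (h : RealSol κ ε p q) (hκ : ContDiff ℝ ∞ κ) :
    ContDiff ℝ ∞ p ∧ ContDiff ℝ ∞ q := by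
  have key : ∀ n : ℕ, ContDiff ℝ n p ∧ ContDiff ℝ n q := by
    intro n
    induction n with
    | zero => exact ⟨contDiff_zero.mpr h.continuous_fst, contDiff_zero.mpr h.continuous_snd⟩
    | succ n ih =>
      have hκn : ContDiff ℝ n κ := hκ.of_le (by exact_mod_cast le_top)
      obtain ⟨h1, h2⟩ := ih
      push_cast
      simp only [contDiff_succ_iff_deriv, show deriv p = _ from funext fun x => (h.fst x).deriv,
        show deriv q = _ from funext fun x => (h.snd x).deriv]
      exact ⟨⟨fun x => (h.fst x).differentiableAt, by simp, by fun_prop⟩,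
        ⟨fun x => (h.snd x).differentiableAt, by simp, by fun_prop⟩⟩
  exact ⟨contDiff_infty.mpr fun n => (key n).1, contDiff_infty.mpr fun n => (key n).2⟩

/-- Square integrable real solutions decay exponentially, with a definite direction at `+∞`. -/
theorem exists_tendsto (h : RealSol κ ε p q) (hκ : Continuous κ) {L : ℝ} (hL : ∀ x, |κ x| ≤ L)
    {k : ℝ} (hi : IntegrableOn (fun x => κ x - k) (Ici 0)) (hε : ε ^ 2 < k ^ 2)
    (hp : MemLp p 2) (hq : MemLp q 2) (h0 : p 0 ≠ 0 ∨ q 0 ≠ 0) :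
    ∃ μ w₁ w₂ : ℝ, 0 < μ ∧ (w₁ ≠ 0 ∨ w₂ ≠ 0) ∧
      Tendsto (fun x => Real.exp (μ * x) * p x) atTop (𝓝 w₁) ∧
      Tendsto (fun x => Real.exp (μ * x) * q x) atTop (𝓝 w₂) := by
  set μ := √(k ^ 2 - ε ^ 2) with hμ
  have hμ0 : 0 < μ := Real.sqrt_pos.mpr (by linarith)
  have hμ2 : (μ : ℂ) ^ 2 = (k : ℂ) ^ 2 + (ε : ℂ) * (-ε : ℂ) := by
    rw [← Complex.ofReal_pow, hμ, Real.sq_sqrt (by linarith)]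
    push_cast
    ring
  obtain ⟨f, g, hs, W₁, W₂, hW, hf, hg⟩ := exists_decaying_sol hκ hi (μ := μ) (by simpa) hμ2
  obtain ⟨C₁, -, hC₁⟩ := norm_le_exp_of_tendsto hs.continuous_fst hf
  obtain ⟨C₂, -, hC₂⟩ := norm_le_exp_of_tendsto hs.continuous_snd hg
  have hfm := memLp_Ioi_of_exp_bound hs.continuous_fst.aestronglyMeasurable (by simpa) hC₁
  have hgm := memLp_Ioi_of_exp_bound hs.continuous_snd.aestronglyMeasurable (by simpa) hC₂
  have hf0 : f 0 ≠ 0 ∨ g 0 ≠ 0 := by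
    by_contra hcon
    push Not at hcon
    have hz := fun x => hs.eq_zero hκ hL hcon.1 hcon.2 x
    have z1 : W₁ = 0 := tendsto_nhds_unique hf (by simp [(hz _).1])
    have z2 : W₂ = 0 := tendsto_nhds_unique hg (by simp [(hz _).2])
    simp [z1, z2] at hW
  have hint : IntegrableOn (fun x => f x * q x - g x * p x) (Ioi 0) :=
    (hfm.integrable_mul (hq.restrict _).ofReal).sub (hgm.integrable_mul (hp.restrict _).ofReal)
  simp only [hs.wronskian h.toSol] at hint
  rw [integrableOn_const_iff] at hint
  -- The Wronskian with the decaying solution is a constant integrable on the half-line, hence zero,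
  -- so the two solutions are proportional.
  obtain ⟨t, ht⟩ := hs.exists_eq_mul_of_wronskian hκ hL h.toSol hf0 (by simpa using hint)
  have ht0 : t ≠ 0 := by
    rintro rfl
    have := ht 0
    simp only [zero_mul, Complex.ofReal_eq_zero] at this
    simp [this.1, this.2] at h0
  have key : ∀ (r : ℝ → ℝ) (φ : ℝ → ℂ) (W : ℂ), (∀ x, (r x : ℂ) = t * φ x) →
      Tendsto (fun x : ℝ => Complex.exp (μ * x) * φ x) atTop (𝓝 W) →
      Tendsto (fun x => Real.exp (μ * x) * r x) atTop (𝓝 (t * W).re) ∧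
        ((t * W).re = 0 → W = 0) := by
    intro r φ W hr hW
    have h1 : Tendsto (fun x => ((Real.exp (μ * x) * r x : ℝ) : ℂ)) atTop (𝓝 (t * W)) := by
      refine (hW.const_mul t).congr fun x => ?_
      push_cast
      rw [hr]
      ring
    have h2 := (Complex.continuous_re.tendsto _).comp h1
    have h3 := (Complex.continuous_im.tendsto _).comp h1
    -- The complex limit is approached through real values, so taking real parts loses nothing and
    -- keeps it nonzero.
    have h4 : (t * W).im = 0 := tendsto_nhds_unique h3
      (by simp only [Function.comp_def, Complex.ofReal_im, tendsto_const_nhds])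
    refine ⟨by simpa only [Function.comp_def, Complex.ofReal_re] using h2, fun h5 => ?_⟩
    exact (mul_eq_zero.mp (Complex.ext h5 h4)).resolve_left ht0
  obtain ⟨k1, k1'⟩ := key p f W₁ (fun x => (ht x).1) hf
  obtain ⟨k2, k2'⟩ := key q g W₂ (fun x => (ht x).2) hg
  exact ⟨μ, _, _, hμ0, hW.imp (mt k1') (mt k2'), k1, k2⟩

theorem iteratedDeriv_succ_eq (h : RealSol κ ε p q) (hκ : ContDiff ℝ ∞ κ) (j : ℕ) (x : ℝ) :
    iteratedDeriv (j + 1) p x = ∑ i ∈ Finset.range (j + 1),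
        j.choose i * iteratedDeriv i κ x * iteratedDeriv (j - i) p x + ε * iteratedDeriv j q x ∧
    iteratedDeriv (j + 1) q x = -ε * iteratedDeriv j p x - ∑ i ∈ Finset.range (j + 1),
        j.choose i * iteratedDeriv i κ x * iteratedDeriv (j - i) q x := by
  obtain ⟨hp, hq⟩ := h.contDiff hκ
  have hle : (j : WithTop ℕ∞) ≤ ∞ := by exact_mod_cast le_top
  have hp' : ContDiff ℝ j p := hp.of_le hle
  have hq' : ContDiff ℝ j q := hq.of_le hle
  have hκ' : ContDiff ℝ j κ := hκ.of_le hle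
  have e1 : ContDiff ℝ j fun x => κ x * p x := by fun_prop
  have e2 : ContDiff ℝ j fun x => ε * q x := by fun_prop
  have e3 : ContDiff ℝ j fun x => κ x * q x := by fun_prop
  have e4 : ContDiff ℝ j fun x => -ε * p x := by fun_prop
  constructor
  · rw [iteratedDeriv_succ', show deriv p = _ from funext fun x => (h.fst x).deriv,
      iteratedDeriv_fun_add e1.contDiffAt e2.contDiffAt, iteratedDeriv_const_mul_field,
      iteratedDeriv_fun_mul hκ'.contDiffAt hp'.contDiffAt]
  · rw [iteratedDeriv_succ', show deriv q = _ from funext fun x => (h.snd x).deriv,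
      iteratedDeriv_fun_sub e4.contDiffAt e3.contDiffAt, iteratedDeriv_const_mul_field,
      iteratedDeriv_fun_mul hκ'.contDiffAt hq'.contDiffAt]

/-- Differentiating the system with Leibniz' rule shows that all limits exist. Their values follow
because `e^{μx} r^{(j)}` and its derivative both converge, so the derivative tends to zero and each
new limit is `-μ` times the previous one. In particular a nonzero limit stays nonzero when `μ ≠ 0`.
-/
theorem tendsto_iteratedDeriv (h : RealSol κ ε p q) (hκ : IsCbInfty κ) {k : ℝ}
    (hk : Tendsto κ atTop (𝓝 k)) {μ w₁ w₂ : ℝ}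
    (h₁ : Tendsto (fun x => Real.exp (μ * x) * p x) atTop (𝓝 w₁))
    (h₂ : Tendsto (fun x => Real.exp (μ * x) * q x) atTop (𝓝 w₂)) (j : ℕ) :
    Tendsto (fun x => Real.exp (μ * x) * iteratedDeriv j p x) atTop (𝓝 ((-μ) ^ j * w₁)) ∧
      Tendsto (fun x => Real.exp (μ * x) * iteratedDeriv j q x) atTop (𝓝 ((-μ) ^ j * w₂)) := by
  obtain ⟨hp, hq⟩ := h.contDiff hκ.1
  choose l hl using hκ.tendsto_iteratedDeriv hk
  have conv : ∀ j, (∃ w, Tendsto (fun x => Real.exp (μ * x) * iteratedDeriv j p x) atTop (𝓝 w)) ∧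
      ∃ w, Tendsto (fun x => Real.exp (μ * x) * iteratedDeriv j q x) atTop (𝓝 w) := by
    intro j
    induction j using Nat.strong_induction_on with
    | _ j ih =>
      cases j with
      | zero => exact ⟨⟨w₁, by simpa using h₁⟩, ⟨w₂, by simpa using h₂⟩⟩
      | succ j =>
        have hsum : ∀ r : ℝ → ℝ, (∀ m < j + 1, ∃ w,
            Tendsto (fun x => Real.exp (μ * x) * iteratedDeriv m r x) atTop (𝓝 w)) →
            ∃ w, Tendsto (fun x => Real.exp (μ * x) * ∑ i ∈ Finset.range (j + 1),
              j.choose i * iteratedDeriv i κ x * iteratedDeriv (j - i) r x) atTop (𝓝 w) := by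
          intro r hr
          choose! w hw using hr
          refine ⟨∑ i ∈ Finset.range (j + 1), j.choose i * l i * w (j - i), ?_⟩
          simp only [Finset.mul_sum]
          refine tendsto_finsetSum _ fun i _ => ?_
          refine (((hl i).const_mul (j.choose i : ℝ)).mul (hw (j - i) (by omega))).congr fun x => ?_
          ring
        obtain ⟨a, ha⟩ := hsum p fun m hm => (ih m hm).1
        obtain ⟨b, hb⟩ := hsum q fun m hm => (ih m hm).2
        obtain ⟨⟨c, hc⟩, d, hd⟩ := ih j (lt_add_one j)
        refine ⟨⟨a + ε * d, (ha.add (hd.const_mul ε)).congr fun x => ?_⟩,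
          ⟨-ε * c - b, ((hc.const_mul (-ε)).sub hb).congr fun x => ?_⟩⟩
        · rw [(h.iteratedDeriv_succ_eq hκ.1 j x).1]; ring
        · rw [(h.iteratedDeriv_succ_eq hκ.1 j x).2]; ring
  have step : ∀ (r : ℝ → ℝ) (w : ℝ), ContDiff ℝ ∞ r →
      (∀ j, ∃ w, Tendsto (fun x => Real.exp (μ * x) * iteratedDeriv j r x) atTop (𝓝 w)) →
      Tendsto (fun x => Real.exp (μ * x) * r x) atTop (𝓝 w) →
      Tendsto (fun x => Real.exp (μ * x) * iteratedDeriv j r x) atTop (𝓝 ((-μ) ^ j * w)) := by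
    intro r w hr hc h0
    induction j with
    | zero => simpa using h0
    | succ j ih =>
      obtain ⟨v, hv⟩ := hc (j + 1)
      have hd : ∀ x, HasDerivAt (fun x => Real.exp (μ * x) * iteratedDeriv j r x)
          (μ * (Real.exp (μ * x) * iteratedDeriv j r x) +
            Real.exp (μ * x) * iteratedDeriv (j + 1) r x) x := fun x =>
        ((((hasDerivAt_id x).const_mul μ).exp).fun_mul (hasDerivAt_iteratedDeriv hr j x)).congr_deriv
          (by simp only [id]; ring)
      have := eq_zero_of_tendsto_deriv hd ih ((ih.const_mul μ).add hv)
      rwa [show (-μ) ^ (j + 1) * w = v by rw [pow_succ]; linarith]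
  exact ⟨step p w₁ hp (fun j => (conv j).1) h₁, step q w₂ hq (fun j => (conv j).2) h₂⟩

end RealSol

end Asymptotics

/-! ### Exponential decay of spinors at both ends. -/

section Decay

/-- The real linear map `v ↦ diag(e) v` from `ℝ²` to the spinor space. -/
def phaseMap (e : Fin 2 → ℂ) : (Fin 2 → ℝ) →L[ℝ] Spinor :=
  LinearMap.toContinuousLinearMap
    { toFun := fun v => WithLp.toLp 2 fun i => e i * (v i : ℂ)
      map_add' := fun v w => by ext i; simp [mul_add]
      map_smul' := fun t v => by ext i; simp [mul_left_comm] }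

theorem phaseMap_apply (e : Fin 2 → ℂ) (v : Fin 2 → ℝ) :
    phaseMap e v = WithLp.toLp 2 fun i => e i * (v i : ℂ) := rfl

theorem tendsto_vec {l : Filter ℝ} {p q : ℝ → ℝ} {w₁ w₂ : ℝ} (h₁ : Tendsto p l (𝓝 w₁))
    (h₂ : Tendsto q l (𝓝 w₂)) : Tendsto (fun x => ![p x, q x]) l (𝓝 ![w₁, w₂]) := by
  rw [tendsto_pi_nhds]
  intro i
  fin_cases i
  · exact h₁
  · exact h₂

theorem tendsto_exp_smul_phaseMap (e : Fin 2 → ℂ) {l : Filter ℝ} {μ w₁ w₂ : ℝ} {p q : ℝ → ℝ}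
    (h₁ : Tendsto (fun x => Real.exp (μ * x) * p x) l (𝓝 w₁))
    (h₂ : Tendsto (fun x => Real.exp (μ * x) * q x) l (𝓝 w₂)) :
    Tendsto (fun x => Real.exp (μ * x) • phaseMap e ![p x, q x]) l (𝓝 (phaseMap e ![w₁, w₂])) := by
  refine (((phaseMap e).continuous.tendsto _).comp (tendsto_vec h₁ h₂)).congr fun x => ?_
  rw [Function.comp_apply, ← map_smul]
  simp

theorem vec_ne_zero {w₁ w₂ : ℝ} (h : w₁ ≠ 0 ∨ w₂ ≠ 0) : ![w₁, w₂] ≠ 0 := by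
  intro h0
  have h1 := congrFun h0 0
  have h2 := congrFun h0 1
  simp only [Matrix.cons_val_zero, Matrix.cons_val_one, Pi.zero_apply] at h1 h2
  simp [h1, h2] at h

theorem memLp_of_tendsto_exp {f : ℝ → ℝ} (hf : Continuous f) {lp lm w w' : ℝ} (hlp : 0 < lp)
    (hlm : lm < 0) (h : Tendsto (fun x => Real.exp (lp * x) * f x) atTop (𝓝 w))
    (h' : Tendsto (fun x => Real.exp (lm * x) * f x) atBot (𝓝 w')) : MemLp f 2 := by
  have key : ∀ (g : ℝ → ℝ) (l v : ℝ), Continuous g → 0 < l →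
      Tendsto (fun x => Real.exp (l * x) * g x) atTop (𝓝 v) →
      MemLp g 2 (volume.restrict (Ioi 0)) := by
    intro g l v hg hl hv
    obtain ⟨C, -, hC⟩ := norm_le_exp_of_tendsto (μ := l) (f := fun x => (g x : ℂ)) (w := v)
      (by fun_prop) (((Complex.continuous_ofReal.tendsto _).comp hv).congr fun x => by simp)
    exact memLp_Ioi_of_exp_bound hg.aestronglyMeasurable hl
      fun x hx => by simpa using hC x hx
  have h2 := key (fun x => f (-x)) (-lm) w' (by fun_prop) (by linarith)
    ((h'.comp tendsto_neg_atTop_atBot).congr fun x => by simp)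
  have h3 := h2.comp_measurePreserving measurePreserving_neg_Iio
  simp only [Function.comp_def, neg_neg] at h3
  exact memLp_of_Iio_Ioi h3 (key f lp w hf hlp h)

variable {κ : ℝ → ℝ} {ε : ℝ} {p q : ℝ → ℝ}

theorem RealSol.exists_tendsto_atBot (h : RealSol κ ε p q) (hκ : Continuous κ) {L : ℝ}
    (hL : ∀ x, |κ x| ≤ L) {k : ℝ} (hi : IntegrableOn (fun x => κ x - k) (Iic 0))
    (hε : ε ^ 2 < k ^ 2) (hp : MemLp p 2) (hq : MemLp q 2) (h0 : p 0 ≠ 0 ∨ q 0 ≠ 0) :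
    ∃ ν w₁ w₂ : ℝ, ν < 0 ∧ (w₁ ≠ 0 ∨ w₂ ≠ 0) ∧
      Tendsto (fun x => Real.exp (ν * x) * p x) atBot (𝓝 w₁) ∧
      Tendsto (fun x => Real.exp (ν * x) * q x) atBot (𝓝 w₂) := by
  have hn := Measure.measurePreserving_neg (volume : Measure ℝ)
  obtain ⟨μ, w₁, w₂, hμ, hw, h₁, h₂⟩ := h.reflect.exists_tendsto (by fun_prop) (L := L)
    (fun x => by rw [abs_neg]; exact hL _) (integrableOn_reflect hi) (by simpa using hε)
    (hp.comp_measurePreserving hn) (hq.comp_measurePreserving hn) (by simpa using h0)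
  exact ⟨-μ, w₁, w₂, by linarith, hw,
    (h₁.comp tendsto_neg_atBot_atTop).congr fun x => by simp,
    (h₂.comp tendsto_neg_atBot_atTop).congr fun x => by simp⟩

theorem RealSol.tendsto_iteratedDeriv_atBot (h : RealSol κ ε p q) (hκ : IsCbInfty κ) {k : ℝ}
    (hk : Tendsto κ atBot (𝓝 k)) {ν w₁ w₂ : ℝ}
    (h₁ : Tendsto (fun x => Real.exp (ν * x) * p x) atBot (𝓝 w₁))
    (h₂ : Tendsto (fun x => Real.exp (ν * x) * q x) atBot (𝓝 w₂)) (j : ℕ) :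
    Tendsto (fun x => Real.exp (ν * x) * iteratedDeriv j p x) atBot (𝓝 ((-ν) ^ j * w₁)) ∧
      Tendsto (fun x => Real.exp (ν * x) * iteratedDeriv j q x) atBot (𝓝 ((-ν) ^ j * w₂)) := by
  obtain ⟨r1, r2⟩ := h.reflect.tendsto_iteratedDeriv hκ.reflect (k := -k) (μ := -ν)
    ((hk.comp tendsto_neg_atTop_atBot).neg)
    ((h₁.comp tendsto_neg_atTop_atBot).congr fun x => by simp)
    ((h₂.comp tendsto_neg_atTop_atBot).congr fun x => by simp) j
  have key : ∀ (r : ℝ → ℝ) (w : ℝ), Tendsto (fun x => Real.exp (-ν * x) *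
      iteratedDeriv j (fun x => r (-x)) x) atTop (𝓝 ((-(-ν)) ^ j * w)) →
      Tendsto (fun x => Real.exp (ν * x) * iteratedDeriv j r x) atBot (𝓝 ((-ν) ^ j * w)) := by
    intro r w hr
    -- The sign produced by differentiating the reflected function `j` times is compensated by
    -- turning `μ^j` into `(-μ)^j`.
    have hs : ((-1 : ℝ) ^ j) * (-1) ^ j = 1 := by rw [← mul_pow]; simp
    have := (hr.comp tendsto_neg_atBot_atTop).const_mul ((-1 : ℝ) ^ j)
    rw [neg_neg, ← mul_assoc, ← mul_pow, neg_one_mul] at this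
    refine this.congr fun x => ?_
    simp only [Function.comp_apply, iteratedDeriv_comp_neg, neg_neg, smul_eq_mul, neg_mul_neg]
    linear_combination (Real.exp (ν * x) * iteratedDeriv j r x) * hs
  exact ⟨key p w₁ r1, key q w₂ r2⟩

theorem iteratedDeriv_phaseMap (e : Fin 2 → ℂ) (hp : ContDiff ℝ ∞ p) (hq : ContDiff ℝ ∞ q)
    (j : ℕ) : iteratedDeriv j (fun x => phaseMap e ![p x, q x]) =
      fun x => phaseMap e ![iteratedDeriv j p x, iteratedDeriv j q x] := by
  induction j with
  | zero => simp
  | succ j ih =>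
    rw [iteratedDeriv_succ, ih]
    ext1 x
    refine HasDerivAt.deriv ?_
    refine (phaseMap e).hasFDerivAt.comp_hasDerivAt x (hasDerivAt_pi.mpr fun i => ?_)
    fin_cases i
    · exact hasDerivAt_iteratedDeriv hp j x
    · exact hasDerivAt_iteratedDeriv hq j x

theorem contDiff_phaseMap (e : Fin 2 → ℂ) (hp : ContDiff ℝ ∞ p) (hq : ContDiff ℝ ∞ q) :
    ContDiff ℝ ∞ fun x => phaseMap e ![p x, q x] := by
  refine (phaseMap e).contDiff.comp (contDiff_pi.mpr fun i => ?_)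
  fin_cases i
  · exact hp
  · exact hq

theorem eigenfunctionDecay_of_realSol (h : RealSol κ ε p q) (hκ : Continuous κ) {L : ℝ}
    (hL : ∀ x, |κ x| ≤ L) {κp κm : ℝ} (hkp : Tendsto κ atTop (𝓝 κp))
    (hkm : Tendsto κ atBot (𝓝 κm)) (hip : IntegrableOn (fun x => κ x - κp) (Ici 0))
    (him : IntegrableOn (fun x => κ x - κm) (Iic 0)) (hεp : ε ^ 2 < κp ^ 2)
    (hεm : ε ^ 2 < κm ^ 2) (hp : MemLp p 2) (hq : MemLp q 2) (h0 : p 0 ≠ 0 ∨ q 0 ≠ 0)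
    {e : Fin 2 → ℂ} {c : ℂ} (hc : c ≠ 0) {u : L2}
    (hu : u =ᵐ[volume] fun x => phaseMap (fun i => c * e i) ![p x, q x]) :
    EigenfunctionDecay κ e u := by
  obtain ⟨μ, w₁, w₂, hμ, hw, h₁, h₂⟩ := h.exists_tendsto hκ hL hip hεp hp hq h0
  obtain ⟨ν, v₁, v₂, hν, hv, k₁, k₂⟩ := h.exists_tendsto_atBot hκ hL him hεm hp hq h0
  refine ⟨_, c, ?_, hu, hc, ⟨ν, μ, hν, hμ, ![v₁, v₂], ![w₁, w₂], vec_ne_zero hv, vec_ne_zero hw,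
    tendsto_exp_smul_phaseMap _ h₁ h₂, tendsto_exp_smul_phaseMap _ k₁ k₂⟩, fun hC => ?_⟩
  · have hpc := h.continuous_fst
    have hqc := h.continuous_snd
    fun_prop
  obtain ⟨hps, hqs⟩ := h.contDiff hC.1
  have hd := fun j => h.tendsto_iteratedDeriv hC hkp h₁ h₂ j
  have hd' := fun j => h.tendsto_iteratedDeriv_atBot hC hkm k₁ k₂ j
  set Ψ : ℝ → Spinor := fun x => phaseMap (fun i => c * e i) ![p x, q x] with hΨ
  have hΨs : ContDiff ℝ ∞ Ψ := contDiff_phaseMap _ hps hqs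
  have hΨj : ∀ j, iteratedDeriv j Ψ = _ := fun j => iteratedDeriv_phaseMap _ hps hqs j
  refine ⟨hΨs, fun j => ?_, fun s => ?_⟩
  · have hne : ∀ {μ a b : ℝ}, μ ≠ 0 → (a ≠ 0 ∨ b ≠ 0) → (-μ) ^ j * a ≠ 0 ∨ (-μ) ^ j * b ≠ 0 := by
      intro μ a b hμ
      have := pow_ne_zero j (neg_ne_zero.mpr hμ)
      exact Or.imp (mul_ne_zero this) (mul_ne_zero this)
    rw [hΨj]
    exact ⟨ν, μ, hν, hμ, _, _, vec_ne_zero (hne hν.ne hv), vec_ne_zero (hne hμ.ne' hw),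
      tendsto_exp_smul_phaseMap _ (hd j).1 (hd j).2,
      tendsto_exp_smul_phaseMap _ (hd' j).1 (hd' j).2⟩
  · have hcont : ∀ j, ∀ r : ℝ → ℝ, ContDiff ℝ ∞ r → Continuous (iteratedDeriv j r) := fun j r hr =>
      hr.continuous_iteratedDeriv j (by exact_mod_cast le_top)
    have hm : ∀ j, MemLp (iteratedDeriv j Ψ) 2 := fun j => by
      have m1 := memLp_of_tendsto_exp (hcont j p hps) hμ hν (hd j).1 (hd' j).1
      have m2 := memLp_of_tendsto_exp (hcont j q hqs) hμ hν (hd j).2 (hd' j).2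
      rw [hΨj]
      refine (phaseMap _).comp_memLp' (memLp_pi_iff.mpr fun i => ?_)
      fin_cases i
      · exact m1
      · exact m2
    have hD := memSobolev_of_hasL2Deriv (D := fun j => (hm j).toLp _) (fun j => by
      refine hasL2Deriv_of_isPrim (U := iteratedDeriv j Ψ) ?_ (hm j).coeFn_toLp
      refine (IsPrim.of_hasDerivAt ?_ (hasDerivAt_iteratedDeriv hΨs j)).congr
        (hm (j + 1)).coeFn_toLp.symm
      exact hΨs.continuous_iteratedDeriv _ (by exact_mod_cast le_top)) s
    have hu0 : u = (hm 0).toLp _ := Lp.ext (by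
      filter_upwards [hu, (hm 0).coeFn_toLp] with x h1 h2
      rw [h1, h2, iteratedDeriv_zero])
    rw [hu0]
    exact hD

end Decay

/-! ### The zero mode and the reduction of eigenfunctions to real solutions. -/

section Eigenfunctions

variable {κ : ℝ → ℝ}

/-- Square integrable solutions of the linear system are eigenfunctions. -/
theorem exists_eigenfunction_of_sol (hκ : Continuous κ) {L : ℝ} (hL : ∀ x, |κ x| ≤ L) {z : ℂ}
    {p q : ℝ → ℂ} (h : Sol κ (2 / 3 * Complex.I * z) (2 / 3 * Complex.I * z) p q)
    (hp : MemLp p 2) (hq : MemLp q 2) :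
    ∃ u : (dirac κ).domain, dirac κ u = z • (u : L2) ∧ (u : L2) =ᵐ[volume] spinor p q := by
  have hU := memLp_spinor hp hq
  have hv : ∀ᵐ x, (z • hU.toLp _ : L2) x = z • spinor p q x := by
    filter_upwards [Lp.coeFn_smul z (hU.toLp _), hU.coeFn_toLp] with x h2 h3
    rw [h2, Pi.smul_apply, h3]
  obtain ⟨u, hu, hD⟩ := exists_dirac_apply_eq (mem_diracGraph_of_isPrim
    (v := z • hU.toLp _) hκ hL hU.coeFn_toLp ((h.isPrim_fst hκ).congr (by
      filter_upwards [hv] with x hx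
      rw [hx]; simp [spinor]; ring)) ((h.isPrim_snd hκ).congr (by
      filter_upwards [hv] with x hx
      rw [hx]; simp [spinor]; ring)))
  exact ⟨u, by rw [hD, hu], by rw [hu]; exact hU.coeFn_toLp⟩

/-- The function `exp (-∫₀ˣ κ)`. -/
def zeroMode (κ : ℝ → ℝ) (x : ℝ) : ℝ := Real.exp (-∫ t in (0 : ℝ)..x, κ t)

theorem hasDerivAt_zeroMode (hκ : Continuous κ) (x : ℝ) :
    HasDerivAt (zeroMode κ) (-κ x * zeroMode κ x) x := by
  have := ((intervalIntegral.integral_hasDerivAt_right (hκ.intervalIntegrable 0 x)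
    (hκ.stronglyMeasurableAtFilter _ _) hκ.continuousAt).neg).exp
  exact this.congr_deriv (by rw [mul_comm]; rfl)

theorem continuous_zeroMode (hκ : Continuous κ) : Continuous (zeroMode κ) :=
  continuous_iff_continuousAt.mpr fun x => (hasDerivAt_zeroMode hκ x).continuousAt

/-- The product equals `exp(-∫₀ˣ (κ - k))`, whose exponent converges by integrability. -/
theorem tendsto_exp_mul_zeroMode (hκ : Continuous κ) {k : ℝ}
    (hi : IntegrableOn (fun x => κ x - k) (Ici 0)) :
    Tendsto (fun x => Real.exp (k * x) * zeroMode κ x) atTop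
      (𝓝 (Real.exp (-∫ x in Ioi 0, (κ x - k)))) := by
  have h1 := intervalIntegral_tendsto_integral_Ioi 0 (hi.mono_set Ioi_subset_Ici_self) tendsto_id
  refine ((Real.continuous_exp.tendsto _).comp h1.neg).congr fun x => ?_
  rw [zeroMode, ← Real.exp_add, Function.comp_apply, id, intervalIntegral.integral_sub
    (hκ.intervalIntegrable _ _) intervalIntegrable_const]
  simp
  ring

theorem zeroMode_neg (x : ℝ) : zeroMode κ (-x) = zeroMode (fun x => -κ (-x)) x := by
  simp only [zeroMode]
  rw [intervalIntegral.integral_neg, intervalIntegral.integral_comp_neg, neg_zero,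
    intervalIntegral.integral_symm]

theorem memLp_zeroMode (hκ : Continuous κ) {κp κm : ℝ}
    (hip : IntegrableOn (fun x => κ x - κp) (Ici 0))
    (him : IntegrableOn (fun x => κ x - κm) (Iic 0)) (hp : 0 < κp) (hm : κm < 0) :
    MemLp (zeroMode κ) 2 := by
  refine memLp_of_tendsto_exp (continuous_zeroMode hκ) hp hm (tendsto_exp_mul_zeroMode hκ hip)
    (((tendsto_exp_mul_zeroMode (κ := fun x => -κ (-x)) (by fun_prop)
      (integrableOn_reflect him)).comp tendsto_neg_atBot_atTop).congr fun x => ?_)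
  rw [Function.comp_apply, neg_mul_neg, ← zeroMode_neg, neg_neg]

/-- At energy zero the components decouple into `p' = κ p` and `q' = -κ q`. The second has a
decaying solution when `κp > 0 > κm`, the first in the opposite case. -/
theorem isEigenvalue_zero (hκ : Continuous κ) {L : ℝ} (hL : ∀ x, |κ x| ≤ L) {κp κm : ℝ}
    (hip : IntegrableOn (fun x => κ x - κp) (Ici 0))
    (him : IntegrableOn (fun x => κ x - κm) (Iic 0)) (hsign : κp * κm < 0) :
    IsEigenvalue (dirac κ) 0 := by
  obtain ⟨p, q, h, hp, hq, h0⟩ : ∃ p q : ℝ → ℝ, RealSol κ 0 p q ∧ MemLp p 2 ∧ MemLp q 2 ∧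
      (p 0 ≠ 0 ∨ q 0 ≠ 0) := by
    rcases mul_neg_iff.mp hsign with ⟨h1, h2⟩ | ⟨h1, h2⟩
    · refine ⟨fun _ => 0, zeroMode κ, ⟨fun x => ?_, fun x => ?_⟩, MemLp.zero,
        memLp_zeroMode hκ hip him h1 h2, Or.inr (Real.exp_pos _).ne'⟩
      · simpa using hasDerivAt_const x (0 : ℝ)
      · simpa using hasDerivAt_zeroMode hκ x
    · refine ⟨zeroMode (fun x => -κ x), fun _ => 0, ⟨fun x => ?_, fun x => ?_⟩,
        memLp_zeroMode (κp := -κp) (κm := -κm) hκ.neg ?_ ?_ (by linarith) (by linarith), MemLp.zero,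
        Or.inl (Real.exp_pos _).ne'⟩
      · simpa using hasDerivAt_zeroMode (κ := fun x => -κ x) (by fun_prop) x
      · simpa using hasDerivAt_const x (0 : ℝ)
      · exact hip.neg.congr (ae_of_all _ fun x => by simp; ring)
      · exact him.neg.congr (ae_of_all _ fun x => by simp; ring)
  obtain ⟨u, hu, hu'⟩ := exists_eigenfunction_of_sol (z := 0)
    (p := fun x => (p x : ℂ)) (q := fun x => (q x : ℂ)) hκ hL (by simpa using h.toSol)
    hp.ofReal hq.ofReal
  refine ⟨u, ?_, hu⟩
  rintro rfl
  have hz : spinor (fun x => (p x : ℂ)) (fun x => (q x : ℂ)) =ᵐ[volume] fun _ => (0 : Spinor) := by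
    filter_upwards [hu', Lp.coeFn_zero Spinor 2 (volume : Measure ℝ)] with x h1 h2
    rw [← h1]
    exact h2
  have hpc := h.continuous_fst
  have hqc := h.continuous_snd
  have hc : Continuous (spinor (fun x => (p x : ℂ)) fun x => (q x : ℂ)) := by
    simp only [funext (spinor_eq _ _)]
    fun_prop
  have h1 := congrFun (Continuous.ae_eq_iff_eq volume hc continuous_const |>.mp hz) 0
  have e0 := congrArg (fun v : Spinor => v 0) h1
  have e1 := congrArg (fun v : Spinor => v 1) h1
  simp [spinor] at e0 e1
  simp [e0, e1] at h0

/-- A square integrable complex solution of the real system is a multiple of a real one. -/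
theorem Sol.exists_realSol (hκ : Continuous κ) {L : ℝ} (hL : ∀ x, |κ x| ≤ L) {ε : ℝ}
    {P Q : ℝ → ℂ} (h : Sol κ ε (-ε) P Q) (hP : MemLp P 2) (hQ : MemLp Q 2)
    (h0 : P 0 ≠ 0 ∨ Q 0 ≠ 0) :
    ∃ (p q : ℝ → ℝ) (t : ℂ), RealSol κ ε p q ∧ MemLp p 2 ∧ MemLp q 2 ∧ (p 0 ≠ 0 ∨ q 0 ≠ 0) ∧
      t ≠ 0 ∧ ∀ x, P x = t * p x ∧ Q x = t * q x := by
  obtain ⟨p, q, hs, hp, hq, hne⟩ : ∃ p q : ℝ → ℝ, RealSol κ ε p q ∧ MemLp p 2 ∧ MemLp q 2 ∧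
      (p 0 ≠ 0 ∨ q 0 ≠ 0) := by
    -- Real and imaginary parts both solve the real system, and at least one of them is nonzero at
    -- the origin.
    by_cases hre : (P 0).re ≠ 0 ∨ (Q 0).re ≠ 0
    · refine ⟨fun x => (P x).re, fun x => (Q x).re, ⟨fun x => ?_, fun x => ?_⟩, hP.re, hQ.re, hre⟩
      · exact (Complex.reCLM.hasFDerivAt.comp_hasDerivAt x (h.fst x)).congr_deriv (by simp)
      · exact (Complex.reCLM.hasFDerivAt.comp_hasDerivAt x (h.snd x)).congr_deriv (by simp)
    · refine ⟨fun x => (P x).im, fun x => (Q x).im, ⟨fun x => ?_, fun x => ?_⟩, hP.im, hQ.im, ?_⟩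
      · exact (Complex.imCLM.hasFDerivAt.comp_hasDerivAt x (h.fst x)).congr_deriv (by simp)
      · exact (Complex.imCLM.hasFDerivAt.comp_hasDerivAt x (h.snd x)).congr_deriv (by simp)
      · push Not at hre
        exact h0.imp (fun h h' => h (Complex.ext hre.1 h')) fun h h' => h (Complex.ext hre.2 h')
  obtain ⟨t, ht⟩ := hs.toSol.exists_eq_mul hκ hL h hp.ofReal hq.ofReal hP hQ (by simpa using hne)
  refine ⟨p, q, t, hs, hp, hq, hne, ?_, ht⟩
  rintro rfl
  simp [(ht 0).1, (ht 0).2] at h0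

theorem eigenfunctionDecay_of_sol (hκ : Continuous κ) {L : ℝ}
    (hL : ∀ x, |κ x| ≤ L) {κp κm : ℝ} (hkp : Tendsto κ atTop (𝓝 κp))
    (hkm : Tendsto κ atBot (𝓝 κm)) (hip : IntegrableOn (fun x => κ x - κp) (Ici 0))
    (him : IntegrableOn (fun x => κ x - κm) (Iic 0)) {ε : ℝ} (hεp : ε ^ 2 < κp ^ 2)
    (hεm : ε ^ 2 < κm ^ 2) {P Q : ℝ → ℂ} (h : Sol κ ε (-ε) P Q) (hP : MemLp P 2) (hQ : MemLp Q 2)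
    (h0 : P 0 ≠ 0 ∨ Q 0 ≠ 0) {e : Fin 2 → ℂ} {u : L2}
    (hu : u =ᵐ[volume] spinor (fun x => e 0 * P x) (fun x => e 1 * Q x)) :
    EigenfunctionDecay κ e u := by
  obtain ⟨p, q, t, hs, hp, hq, hne, ht0, ht⟩ := h.exists_realSol hκ hL hP hQ h0
  refine eigenfunctionDecay_of_realSol hs hκ hL hkp hkm hip him hεp hεm hp hq hne ht0 ?_
  filter_upwards [hu] with x hx
  rw [hx]
  ext i
  fin_cases i
  · simp [spinor, phaseMap_apply, (ht x).1]; ring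
  · simp [spinor, phaseMap_apply, (ht x).2]; ring

/-- Conjugation by `diag(e^{iπ/4}, e^{-iπ/4})` makes the coefficients of the system real. -/
theorem Sol.conj_phases {E : ℝ} {P Q : ℝ → ℂ}
    (h : Sol κ (2 / 3 * Complex.I * E) (2 / 3 * Complex.I * E) P Q) :
    Sol κ (2 / 3 * E : ℝ) (-(2 / 3 * E : ℝ)) (fun x => realPhases 1 * P x)
      (fun x => realPhases 0 * Q x) := by
  have h10 : realPhases 1 * realPhases 0 = 1 := by
    simp [realPhases, ← Complex.exp_add]
  have h00 : realPhases 0 * realPhases 0 = Complex.I := by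
    simp only [realPhases, Matrix.cons_val_zero, ← Complex.exp_add]
    rw [show Complex.I * (Real.pi / 4) + Complex.I * (Real.pi / 4) = Real.pi / 2 * Complex.I by ring,
      Complex.exp_pi_div_two_mul_I]
  have h11 : realPhases 1 * Complex.I = realPhases 0 := by
    rw [← h00, ← mul_assoc, h10, one_mul]
  refine ⟨fun x => ((h.fst x).const_mul _).congr_deriv ?_,
    fun x => ((h.snd x).const_mul _).congr_deriv ?_⟩
  · push_cast
    linear_combination (2 / 3 * E * Q x) * h11
  · push_cast
    linear_combination (2 / 3 * E * P x) * (-Complex.I * h11 + realPhases 1 * Complex.I_sq)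

end Eigenfunctions

end DiracDomainWall

end

/-! ### Assembly of the three claims. -/

theorem lemma4p2 (κ : ℝ → ℝ) (κp κm : ℝ) (hκ : Continuous κ)
    (hp : Tendsto κ atTop (𝓝 κp)) (hm : Tendsto κ atBot (𝓝 κm)) (hsign : κp * κm < 0)
    (hip : IntegrableOn (fun x => κ x - κp) (Ici 0))
    (him : IntegrableOn (fun x => κ x - κm) (Iic 0))
    (a : ℝ) (ha : a = 3 / 2 * min |κp| |κm|) :
    DiracDomainWall.essentialSpectrum (DiracDomainWall.dirac κ) =
        Complex.ofReal '' (Iic (-a) ∪ Ici a) ∧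
    (DiracDomainWall.IsSimpleEigenvalue (DiracDomainWall.dirac κ) 0 ∧
      ∀ u : (DiracDomainWall.dirac κ).domain, u ≠ 0 → DiracDomainWall.dirac κ u = 0 →
        DiracDomainWall.EigenfunctionDecay κ (fun _ => 1) u) ∧
    (∀ E ∈ Ioo (-a) a, DiracDomainWall.IsEigenvalue (DiracDomainWall.dirac κ) (E : ℂ) →
      DiracDomainWall.IsSimpleEigenvalue (DiracDomainWall.dirac κ) (E : ℂ) ∧
      ∀ u : (DiracDomainWall.dirac κ).domain, u ≠ 0 →
        DiracDomainWall.dirac κ u = (E : ℂ) • (u : DiracDomainWall.L2) →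
        DiracDomainWall.EigenfunctionDecay κ DiracDomainWall.realPhases u) := by
  obtain ⟨L, hL⟩ := DiracDomainWall.exists_abs_le_of_tendsto hκ hp hm
  have hp0 : κp ≠ 0 := by rintro rfl; simp at hsign
  have hm0 : κm ≠ 0 := by rintro rfl; simp at hsign
  refine ⟨DiracDomainWall.essentialSpectrum_dirac hκ hp hm hp0 hm0 hip him ha,
    ⟨DiracDomainWall.isSimpleEigenvalue_of_dirac_eq hκ hL
      (DiracDomainWall.isEigenvalue_zero hκ hL hip him hsign), fun u hu0 hu => ?_⟩,
    fun E hE hev => ⟨DiracDomainWall.isSimpleEigenvalue_of_dirac_eq hκ hL hev,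
      fun u hu0 hu => ?_⟩⟩
  · obtain ⟨P, Q, hPQ, hP, hQ, h⟩ :=
      DiracDomainWall.exists_sol_of_dirac_eq (z := 0) hκ (by rw [hu, zero_smul])
    -- At energy zero the off-diagonal coefficients vanish, so the system is already real and no
    -- phases are needed.
    exact DiracDomainWall.eigenfunctionDecay_of_sol (ε := 0) hκ hL hp hm hip him
      (by rw [zero_pow two_ne_zero]; positivity)
      (by rw [zero_pow two_ne_zero]; positivity) (by simpa using h) hP hQ
      (DiracDomainWall.zero_ne_of_ne_zero hκ hL hPQ h (by simpa using hu0)) (by simpa using hPQ)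
  · obtain ⟨P, Q, hPQ, hP, hQ, h⟩ := DiracDomainWall.exists_sol_of_dirac_eq hκ hu
    have hr : DiracDomainWall.realPhases 0 * DiracDomainWall.realPhases 1 = 1 := by
      simp [DiracDomainWall.realPhases, ← Complex.exp_add]
    -- The gap condition makes both exponents `√(κ±² - (2E/3)²)` real and positive.
    have hεk : ∀ k : ℝ, a ≤ 3 / 2 * |k| → (2 / 3 * E) ^ 2 < k ^ 2 := fun k hk => by
      refine sq_lt_sq.mpr ?_
      rw [abs_mul, abs_of_pos (by norm_num : (0 : ℝ) < 2 / 3)]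
      linarith [abs_lt.mpr hE]
    refine DiracDomainWall.eigenfunctionDecay_of_sol hκ hL hp hm hip him
      (hεk κp (by rw [ha]; linarith [min_le_left |κp| |κm|]))
      (hεk κm (by rw [ha]; linarith [min_le_right |κp| |κm|])) h.conj_phases
      (hP.const_mul _) (hQ.const_mul _) ?_ ?_
    · exact (DiracDomainWall.zero_ne_of_ne_zero hκ hL hPQ h (by simpa using hu0)).imp
        (mul_ne_zero (right_ne_zero_of_mul_eq_one hr)) (mul_ne_zero (left_ne_zero_of_mul_eq_one hr))
    -- The two phases are inverse to each other, so multiplying by them undoes the conjugation.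
    · simpa only [← mul_assoc, hr, (mul_comm _ _).trans hr, one_mul] using hPQ
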